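/- Let $G$ be a finite group of order $g=|G|$. A $G$-scheme is a scheme with an action of $G$; over a base $S$ with trivial action this is the same as an $S$-scheme with an action of the constant finite group scheme $G_S\to S$. The equivariant Nisnevich topology on $G$-schemes is generated by the empty cover of $\emptyset$ and the families $\{A\xrightarrow{i} X,\ Y\xrightarrow{p} X\}$ of equivariant morphisms, separated and of finite type, with $i$ an open immersion, $p$ \'etale, and such that, with $B=A\times_XY$, $p$ induces an isomorphism $(Y-B)_{\mathrm{red}}\cong (X-A)_{\mathrm{red}}$; a Nisnevich cover of a $G$-scheme is a family of equivariant \'etale morphisms, separated and of finite type, that is covering for this topology. A $G$-vector bundle $E\to U$ over a $G$-scheme $U$ is a (geometric) vector bundle of finite rank with an action of $G$ on $E$ that is linear over the action on $U$. An $N$-affine bundle over a $G$-scheme $X$ is an equivariant morphism of $G$-schemes $Y\to X$ for which there is a Nisnevich cover $\{U_i\to X\}_{i\in I}$ such that every $Y\times_XU_i\to U_i$ is a $G$-vector bundle. A scheme $X$ has an ample family of line bundles if it is quasi-compact and covered by affine open subsets of the form $X_s=\{s\neq 0\}$, where $s$ is a global section of a line bundle on $X$. (1) Let $X$ be a $G$-scheme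 that has an ample family of line bundles, with $g^{-1}\in\Gamma(X,\mathcal O_X)$. Then there exists an $N$-affine bundle $W\to X$ where $W$ is an affine scheme. (2) Let $S$ be a regular separated Noetherian scheme with $g^{-1}\in\Gamma(S,\mathcal O_S)$, and let $X$ be a smooth separated $S$-scheme of finite type with an action of $G$ by $S$-automorphisms. Then there exists an $N$-affine bundle $W\to X$ where $W$ is an affine scheme. -/

import Mathlib

open CategoryTheory CategoryTheory.Limits AlgebraicGeometry

universe v u

namespace EquivariantJouanolou

noncomputable section

/-! ### Line bundles and ample families -/

section Ample

variable {X : Scheme.{u}}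

/-- Restriction of a section of a sheaf of modules to a smaller open subset. -/
def res {L : X.Modules} {U V : X.Opens} (h : V ≤ U) (e : Γ(L, U)) : Γ(L, V) :=
  L.presheaf.map (homOfLE h).op e

/-- The section `e` of `L` over `U` is a free generator of `L` over `U`: the map
`𝒪_U ⟶ L|_U`, `a ↦ a • e`, is an isomorphism of sheaves. -/
def IsFreeGenerator {L : X.Modules} {U : X.Opens} (e : Γ(L, U)) : Prop :=
  ∀ (V : X.Opens) (h : V ≤ U), Function.Bijective fun a : Γ(X, V) => a • res h e

/-- A line bundle: a sheaf of modules which is locally free of rank one. -/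
def IsLineBundle (L : X.Modules) : Prop :=
  ∀ x : X, ∃ U : X.Opens, x ∈ U ∧ ∃ e : Γ(L, U), IsFreeGenerator e

/-- The open set `X_s` where the global section `s` of a line bundle `L` does not vanish,
i.e. the largest open set over which `s : 𝒪_X ⟶ L` is an isomorphism. -/
def nonvanishingLocus {L : X.Modules} (s : Γ(L, ⊤)) : X.Opens :=
  sSup {U : X.Opens | IsFreeGenerator (res (le_top : U ≤ ⊤) s)}

variable (X) in
/-- `X` has an ample family of line bundles: `X` is quasi-compact, and it has a family of line
bundles such that the affine open sets among the `X_s`, `s` a global section of a member of the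
family, cover `X`. (Usually `s` may be a section of a positive tensor power of a member. As such
powers are line bundles and can be added to the family, existence is the same. Such an `X` is
automatically quasi-separated, and the affine `X_s` form a basis of the topology if one allows all
tensor powers.) -/
def HasAmpleFamily : Prop :=
  CompactSpace X ∧
    ∃ (ι : Type u) (L : ι → X.Modules), (∀ i, IsLineBundle (L i)) ∧
      ∀ x : X, ∃ (i : ι) (s : Γ(L i, ⊤)),
        x ∈ nonvanishingLocus s ∧ IsAffineOpen (nonvanishingLocus s)

end Ample

/-! ### Regular schemes -/

/-- A locally Noetherian scheme is regular if all its local rings are regular. -/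
class IsRegular (S : Scheme.{u}) : Prop extends IsLocallyNoetherian S where
  stalk : ∀ s : S, IsRegularLocalRing (S.presheaf.stalk s)

/-! ### Vector bundles -/

/-- The `T`-points of the `U`-scheme `π : E ⟶ U`, where `T` is a `U`-scheme via `t`. -/
def Points {E U T : Scheme.{u}} (π : E ⟶ U) (t : T ⟶ U) : Type u :=
  {s : T ⟶ E // s ≫ π = t}

/-- Pullback of points along a morphism `h : T' ⟶ T`. -/
def Points.pull {E U T T' : Scheme.{u}} {π : E ⟶ U} {t : T ⟶ U} (h : T' ⟶ T)
    (s : Points π t) : Points π (h ≫ t) :=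
  ⟨h ≫ s.1, by rw [Category.assoc, s.2]⟩

/-- The structure of a (geometric) vector bundle on a `U`-scheme `π : E ⟶ U`: the structure of
an `𝒪`-module on the functor of points `T ↦ E(T)` of `E` over `U` which is, Zariski locally on `U`,
isomorphic to the one of some affine space `𝔸ⁿ`, i.e. locally on `U` there are sections
`e₁, …, eₙ` of `E` such that `E(T)` is a free `Γ(T, 𝒪_T)`-module on the pullbacks of the `eⱼ`,
for all `T`. -/
structure VectorBundleStructure {E U : Scheme.{u}} (π : E ⟶ U) where
  addCommGroup : ∀ {T : Scheme.{u}} (t : T ⟶ U), AddCommGroup (Points π t)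
  module : ∀ {T : Scheme.{u}} (t : T ⟶ U), Module Γ(T, ⊤) (Points π t)
  pull_add : ∀ {T T' : Scheme.{u}} (h : T' ⟶ T) (t : T ⟶ U) (s s' : Points π t),
    (s + s').pull h = s.pull h + s'.pull h
  pull_smul : ∀ {T T' : Scheme.{u}} (h : T' ⟶ T) (t : T ⟶ U) (a : Γ(T, ⊤)) (s : Points π t),
    (a • s).pull h = (h.appTop a) • s.pull h
  locally_trivial : ∀ x : U, ∃ V : U.Opens, x ∈ V ∧ ∃ (n : ℕ) (e : Fin n → Points π V.ι),
    ∀ {T : Scheme.{u}} (t : T ⟶ V),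
      Function.Bijective fun c : Fin n → Γ(T, ⊤) => ∑ j, c j • (e j).pull t

end

/-! ### `G`-schemes

For a (finite) group `G`, a `G`-scheme is an object of `Action Scheme G`, a scheme with an action
of `G` by automorphisms; morphisms are the equivariant morphisms. If the action is one by
`S`-automorphisms, this is the same as an action of the constant `S`-group scheme with group `G`. -/

variable {G : Type v} [Group G]

/-- The action of `g` on points: it takes `T`-points of `E` over `t` to `T`-points over `g ∘ t`. -/
def Points.act {E U : Action Scheme.{u} G} {π : E ⟶ U} {T : Scheme.{u}} {t : T ⟶ U.V} (g : G)
    (s : Points π.hom t) : Points π.hom (t ≫ U.ρ g) :=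
  ⟨s.1 ≫ E.ρ g, by rw [Category.assoc, π.comm, ← Category.assoc, s.2]⟩

/-- The structure of a `G`-vector bundle on an equivariant morphism of `G`-schemes `π : E ⟶ U`:
the structure of a vector bundle on `E` over `U` such that each `g` acts linearly on `E`
(over its action on `U`). -/
structure GVectorBundleStructure {E U : Action Scheme.{u} G} (π : E ⟶ U) extends
    VectorBundleStructure π.hom where
  act_add : ∀ (g : G) {T : Scheme.{u}} (t : T ⟶ U.V) (s s' : Points π.hom t),
    (s + s').act g = s.act g + s'.act g
  act_smul : ∀ (g : G) {T : Scheme.{u}} (t : T ⟶ U.V) (a : Γ(T, ⊤)) (s : Points π.hom t),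
    (a • s).act g = a • s.act g

/-- The equivariant morphism `π : E ⟶ U` is a `G`-vector bundle. -/
def IsGVectorBundle {E U : Action Scheme.{u} G} (π : E ⟶ U) : Prop :=
  Nonempty (GVectorBundleStructure π)

/-! ### The equivariant Nisnevich topology -/

/-- The cartesian square of `G`-schemes on `i : A ⟶ X` and `p : Y ⟶ X`, with fourth vertex
`B = A ×_X Y`, is a distinguished Nisnevich square: `i` is an open immersion, `p` is étale, and
`p` induces an isomorphism `(Y - B)_red ≅ (X - A)_red`. Both `i` and `p` are to be separated and
of finite type; besides étaleness this says that `i` and `p` are quasi-compact and that `p` is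
separated. -/
structure IsDistinguished {X A Y : Action Scheme.{u} G} (i : A ⟶ X) (p : Y ⟶ X) : Prop where
  isOpenImmersion : IsOpenImmersion i.hom
  quasiCompact_left : QuasiCompact i.hom
  etale : Etale p.hom
  isSeparated : IsSeparated p.hom
  quasiCompact_right : QuasiCompact p.hom
  complement : ∃ (Z' Z : Scheme.{u}) (z' : Z' ⟶ Y.V) (z : Z ⟶ X.V) (e : Z' ≅ Z),
    IsReduced Z' ∧ IsReduced Z ∧ IsClosedImmersion z' ∧ IsClosedImmersion z ∧
    Set.range z = (Set.range i.hom)ᶜ ∧ Set.range z' = (p.hom ⁻¹' Set.range i.hom)ᶜ ∧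
    e.hom ≫ z = z' ≫ p.hom

variable (G) in
/-- The equivariant Nisnevich topology on `G`-schemes: the topology generated by the
distinguished Nisnevich squares, i.e. the coarsest one in which `{A ⟶ X, Y ⟶ X}` covers `X` for
every distinguished square and the empty family covers the empty scheme. -/
def nisnevichTopology : GrothendieckTopology (Action Scheme.{u} G) :=
  sInf {J | (∀ {X A Y : Action Scheme.{u} G} (i : A ⟶ X) (p : Y ⟶ X), IsDistinguished i p →
      Sieve.generate (Presieve.singleton i ⊔ Presieve.singleton p) ∈ J X) ∧
    ∀ X : Action Scheme.{u} G, IsEmpty X.V → (⊥ : Sieve X) ∈ J X}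

/-- A Nisnevich cover of the `G`-scheme `X`: a family of equivariant étale morphisms, separated and
of finite type, which is a covering family for the equivariant Nisnevich topology. -/
structure IsNisnevichCover {X : Action Scheme.{u} G} {ι : Type u} (U : ι → Action Scheme.{u} G)
    (f : ∀ i, U i ⟶ X) : Prop where
  etale : ∀ i, Etale (f i).hom
  isSeparated : ∀ i, IsSeparated (f i).hom
  quasiCompact : ∀ i, QuasiCompact (f i).hom
  mem : Sieve.ofArrows U f ∈ nisnevichTopology G X

/-- An equivariant morphism `π : Y ⟶ X` is an `N`-affine bundle if for some Nisnevich cover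
`{U i ⟶ X}` all base changes `Y ×_X U i ⟶ U i` are `G`-vector bundles. -/
def IsNAffineBundle {Y X : Action Scheme.{u} G} (π : Y ⟶ X) : Prop :=
  ∃ (ι : Type u) (U : ι → Action Scheme.{u} G) (f : ∀ i, U i ⟶ X), IsNisnevichCover U f ∧
    ∀ i, IsGVectorBundle (pullback.snd π (f i))

end EquivariantJouanolou

/-!
Suppose that `X` has finitely many line bundles with sections `s i` whose nonvanishing loci `D i`
are affine and cover `X`. The solutions of `∑ i, s i * x i = 1`, with `x i` in the dual of the
`i`-th line bundle, form an `X`-scheme `W` (the Jouanolou torsor). It is affine, because the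
functions `s i * x i` on it have sum `1` and affine nonvanishing loci, and it is a torsor under the
kernel of `x ↦ ∑ i, s i * x i`, a vector bundle.

For a `G`-scheme `X`, coinduction turns `W` into a `G`-scheme: over `t : T ⟶ X` it parametrizes
families of lifts of the translates of `t`, that is, it is the fibre product of the translates of
`W`. This is still an affine torsor under a `G`-vector bundle. Over an affine `G`-scheme `W` has a
section, and coinduction makes it equivariant at no cost, so there the torsor becomes a `G`-vector
bundle. It remains to cover `X` by affine `G`-schemes in the Nisnevich topology. If the translates
of finitely many affine open subsets cover `X`, stratify `X` by the number of members of this cover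
containing a point: the disjoint union of the intersections of `n` members is a `G`-scheme, étale
over `X`, which restricts to an isomorphism over the points contained in exactly `n` members.

On a Noetherian separated scheme with factorial local rings, the complement of a dense affine open
subset is locally cut out by one equation, which provides the line bundles and sections. Schemes
smooth over a regular scheme have regular, hence factorial, local rings.
-/

namespace EquivariantJouanolou

noncomputable section

universe w

/-- A presheaf on the category of schemes over `X`, in unbundled form: the equality `h ≫ t = t'` is
an argument of `pull`, so that sections need not be transported along equalities of morphisms. -/
structure RelPresheaf (X : Scheme.{u}) where
  obj : ∀ {T : Scheme.{u}} (_ : T ⟶ X), Type u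
  pull : ∀ {T T' : Scheme.{u}} (h : T' ⟶ T) {t : T ⟶ X} {t' : T' ⟶ X} (_ : h ≫ t = t'),
    obj t → obj t'
  pull_id : ∀ {T : Scheme.{u}} {t : T ⟶ X} (e : 𝟙 T ≫ t = t) (p : obj t), pull (𝟙 T) e p = p
  pull_pull : ∀ {T T' T'' : Scheme.{u}} (h' : T'' ⟶ T') (h : T' ⟶ T) {t : T ⟶ X} {t' : T' ⟶ X}
    {t'' : T'' ⟶ X} (e : h ≫ t = t') (e' : h' ≫ t' = t'') (e'' : (h' ≫ h) ≫ t = t'') (p : obj t),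
    pull h' e' (pull h e p) = pull (h' ≫ h) e'' p

namespace RelPresheaf

variable {X : Scheme.{u}} (P : RelPresheaf X)

/-- The sheaf condition for Zariski coverings. -/
def IsSheaf : Prop :=
  ∀ {T : Scheme.{u}} (t : T ⟶ X) (𝒰 : Scheme.OpenCover.{u} T) (p : ∀ i, P.obj (𝒰.f i ≫ t)),
    (∀ i j, P.pull (pullback.fst (𝒰.f i) (𝒰.f j)) rfl (p i) =
      P.pull (pullback.snd (𝒰.f i) (𝒰.f j)) (by rw [← pullback.condition_assoc]) (p j)) →
    ∃! q : P.obj t, ∀ i, P.pull (𝒰.f i) rfl q = p i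

lemma sigma_pull_eq_iff {T T' : Scheme.{u}} {h : T' ⟶ T} {t : T ⟶ X} {t' : T' ⟶ X} {p : P.obj t}
    {p' : P.obj t'} :
    (⟨h ≫ t, P.pull h rfl p⟩ : Σ t : T' ⟶ X, P.obj t) = ⟨t', p'⟩ ↔
      ∃ e : h ≫ t = t', P.pull h e p = p' := by
  constructor
  · rintro ⟨⟩
    exact ⟨rfl, rfl⟩
  · rintro ⟨rfl, rfl⟩
    rfl

/-- The presheaf on schemes with sections over `T` the pairs of a morphism `t : T ⟶ X` and a
section of `P` over `t`. -/
def total : Scheme.{u}ᵒᵖ ⥤ Type u where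
  obj T := Σ t : T.unop ⟶ X, P.obj t
  map f := ↾fun x => ⟨f.unop ≫ x.1, P.pull f.unop rfl x.2⟩
  map_id T := by
    apply ConcreteCategory.hom_ext
    rintro ⟨t, p⟩
    exact P.sigma_pull_eq_iff.mpr ⟨Category.id_comp t, P.pull_id _ _⟩
  map_comp f g := by
    apply ConcreteCategory.hom_ext
    rintro ⟨t, p⟩
    exact P.sigma_pull_eq_iff.mpr ⟨Category.assoc _ _ _, (P.pull_pull _ _ _ _ _ _).symm⟩

variable {P} in
lemma IsSheaf.total (hP : P.IsSheaf) : Presieve.IsSheaf Scheme.zariskiTopology P.total := by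
  rw [Precoverage.isSheaf_toGrothendieck_iff_of_isStableUnderBaseChange_of_small.{u}]
  intro T 𝒰
  rw [Presieve.isSheafFor_arrows_iff]
  intro x hx
  let τ (i : 𝒰.I₀) : 𝒰.X i ⟶ X := (x i).1
  let π (i : 𝒰.I₀) : P.obj (τ i) := (x i).2
  have hc (i j : 𝒰.I₀) : ∃ e : pullback.snd (𝒰.f i) (𝒰.f j) ≫ τ j = pullback.fst _ _ ≫ τ i,
      P.pull _ e (π j) = P.pull _ rfl (π i) :=
    P.sigma_pull_eq_iff.mp (hx i j _ (pullback.fst (𝒰.f i) (𝒰.f j))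
      (pullback.snd _ _) pullback.condition).symm
  let t : T ⟶ X := Scheme.Cover.glueMorphisms 𝒰 τ (fun i j => (hc i j).1.symm)
  have ht (i) : 𝒰.f i ≫ t = τ i := Scheme.Cover.ι_glueMorphisms 𝒰 _ _ i
  obtain ⟨q, hq, hq'⟩ : ∃! q : P.obj t, ∀ i, P.pull (𝒰.f i) (ht i) q = π i := by
    clear_value τ π t
    obtain rfl : (fun i => 𝒰.f i ≫ t) = τ := funext ht
    exact hP t 𝒰 π fun i j => (hc i j).2.symm
  refine ⟨⟨t, q⟩, fun i => P.sigma_pull_eq_iff.mpr ⟨ht i, hq i⟩, ?_⟩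
  rintro ⟨t', q'⟩ h
  have h' (i) : ∃ e : 𝒰.f i ≫ t' = τ i, P.pull (𝒰.f i) e q' = π i :=
    P.sigma_pull_eq_iff.mp (h i)
  obtain rfl : t' = t := Scheme.Cover.hom_ext 𝒰 _ _ fun i => (h' i).1.trans (ht i).symm
  rw [hq' q' fun i => (h' i).2]

/-- The section `univ` of `P` over `w : W ⟶ X` makes `W` represent the restriction of `P` to the
schemes over `U`. -/
structure IsUniversal (U : X.Opens) {W : Scheme.{u}} (w : W ⟶ X) (univ : P.obj w) : Prop where
  preimage_eq : w ⁻¹ᵁ U = ⊤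
  existsUnique : ∀ {T : Scheme.{u}} (t : T ⟶ X), t ⁻¹ᵁ U = ⊤ → ∀ p : P.obj t,
    ∃! h : T ⟶ W, ∃ e : h ≫ w = t, P.pull h e univ = p

/-- The morphism of presheaves given by a section. -/
def toTotal {W : Scheme.{u}} (w : W ⟶ X) (p : P.obj w) : yoneda.obj W ⟶ P.total :=
  yonedaEquiv.symm ⟨w, p⟩

variable {P} in
lemma IsUniversal.exists_pull_eq {U : X.Opens} {W : Scheme.{u}} {w : W ⟶ X} {univ : P.obj w}
    (H : P.IsUniversal U w univ) {T : Scheme.{u}} (t : T ⟶ X) (p : P.obj t) :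
    ∃ (h : (t ⁻¹ᵁ U).toScheme ⟶ W) (e : h ≫ w = (t ⁻¹ᵁ U).ι ≫ t),
      P.pull h e univ = P.pull (t ⁻¹ᵁ U).ι rfl p := by
  obtain ⟨h, he, -⟩ := H.existsUnique ((t ⁻¹ᵁ U).ι ≫ t) (by simp) (P.pull (t ⁻¹ᵁ U).ι rfl p)
  exact ⟨h, he⟩

variable {P} in
lemma IsUniversal.range_subset {U : X.Opens} {W : Scheme.{u}} {w : W ⟶ X} {univ : P.obj w}
    (H : P.IsUniversal U w univ) {T T' : Scheme.{u}} {t : T ⟶ X} {a : T' ⟶ W} {b : T' ⟶ T}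
    (e : a ≫ w = b ≫ t) : Set.range b ⊆ Set.range (t ⁻¹ᵁ U).ι := by
  rintro _ ⟨y, rfl⟩
  have hy : w (a y) ∈ U := show a y ∈ w ⁻¹ᵁ U from H.preimage_eq ▸ trivial
  rw [← Scheme.Hom.comp_apply, e] at hy
  simpa using hy

variable {P} in
/-- The base change of `P.toTotal w univ` along the section of `P.total` given by `t : T ⟶ X` and
`p : P.obj t` is the open immersion of `t ⁻¹ᵁ U` into `T`. -/
lemma IsUniversal.isOpenImmersion_toTotal {U : X.Opens} {W : Scheme.{u}} {w : W ⟶ X}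
    {univ : P.obj w} (H : P.IsUniversal U w univ) :
    IsOpenImmersion.presheaf (P.toTotal w univ) := by
  apply MorphismProperty.relative.of_exists
  intro T g
  obtain ⟨⟨t, p⟩, rfl⟩ := yonedaEquiv.symm.surjective g
  obtain ⟨h, e, he⟩ := H.exists_pull_eq t p
  have pull_comp {T' : Scheme.{u}} (k : T' ⟶ (t ⁻¹ᵁ U).toScheme) :
      ∃ e' : (k ≫ h) ≫ w = (k ≫ (t ⁻¹ᵁ U).ι) ≫ t, P.pull (k ≫ h) e' univ = P.pull _ rfl p :=
    ⟨by simp [e], by rw [← P.pull_pull k h e (by simp), he, P.pull_pull _ _ _ _ rfl]⟩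
  refine ⟨(t ⁻¹ᵁ U).toScheme, yoneda.map h, (t ⁻¹ᵁ U).ι, ?_, inferInstance⟩
  apply IsPullback.of_forall_isPullback_app
  rintro ⟨T'⟩
  rw [Types.isPullback_iff]
  refine ⟨?_, ?_, ?_⟩
  · ext (k : T' ⟶ _)
    exact P.sigma_pull_eq_iff.mpr (pull_comp k)
  · rintro (k : T' ⟶ _) (k' : T' ⟶ _) ⟨-, hι : k ≫ (t ⁻¹ᵁ U).ι = k' ≫ (t ⁻¹ᵁ U).ι⟩
    rwa [cancel_mono] at hι
  · rintro (a : T' ⟶ _) (b : T' ⟶ _) hab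
    obtain ⟨e', he'⟩ : ∃ e : a ≫ w = b ≫ t, P.pull a e univ = P.pull b rfl p :=
      P.sigma_pull_eq_iff.mp hab
    obtain ⟨k, rfl⟩ : ∃ k, k ≫ (t ⁻¹ᵁ U).ι = b :=
      ⟨_, IsOpenImmersion.lift_fac (t ⁻¹ᵁ U).ι b (H.range_subset e')⟩
    refine ⟨k, ?_, rfl⟩
    refine (H.existsUnique ((k ≫ (t ⁻¹ᵁ U).ι) ≫ t) ?_ (P.pull _ rfl p)).unique (pull_comp k)
      ⟨e', he'⟩
    rw [Category.assoc, Scheme.Hom.comp_preimage, Scheme.Hom.comp_preimage]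
    simp

variable {P} in
lemma IsUniversal.restrict {W : Scheme.{u}} {w : W ⟶ X} {univ : P.obj w}
    (H : P.IsUniversal ⊤ w univ) (U : X.Opens) :
    P.IsUniversal U ((w ⁻¹ᵁ U).ι ≫ w) (P.pull (w ⁻¹ᵁ U).ι rfl univ) := by
  refine ⟨by simp, fun {T} t ht p => ?_⟩
  obtain ⟨h, ⟨rfl, he⟩, huniq⟩ := H.existsUnique t rfl p
  have hU : Set.range h ⊆ Set.range (w ⁻¹ᵁ U).ι := by
    rintro _ ⟨y, rfl⟩
    have hy : y ∈ (h ≫ w) ⁻¹ᵁ U := ht ▸ trivial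
    simpa using hy
  obtain ⟨l, rfl⟩ : ∃ l, l ≫ (w ⁻¹ᵁ U).ι = h := ⟨_, IsOpenImmersion.lift_fac _ h hU⟩
  refine ⟨l, ⟨by simp, by rw [P.pull_pull _ _ _ _ rfl, he]⟩, ?_⟩
  rintro k ⟨e, hk⟩
  rw [P.pull_pull _ _ _ _ (by simpa using e)] at hk
  exact (cancel_mono _).mp (huniq _ ⟨by simpa using e, hk⟩)

variable {P} in
lemma IsUniversal.nonempty_iso {U : X.Opens} {W W' : Scheme.{u}} {w : W ⟶ X} {w' : W' ⟶ X}
    {univ : P.obj w} {univ' : P.obj w'} (H : P.IsUniversal U w univ)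
    (H' : P.IsUniversal U w' univ') : Nonempty (W ≅ W') := by
  obtain ⟨h, ⟨e, he⟩, -⟩ := H'.existsUnique w H.preimage_eq univ
  obtain ⟨k, ⟨f, hf⟩, -⟩ := H.existsUnique w' H'.preimage_eq univ'
  refine ⟨⟨h, k, ?_, ?_⟩⟩
  · refine (H.existsUnique w H.preimage_eq univ).unique ⟨by rw [Category.assoc, f, e], ?_⟩
      ⟨Category.id_comp _, P.pull_id _ _⟩
    rw [← P.pull_pull h k f e, hf, he]
  · refine (H'.existsUnique w' H'.preimage_eq univ').unique ⟨by rw [Category.assoc, e, f], ?_⟩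
      ⟨Category.id_comp _, P.pull_id _ _⟩
    rw [← P.pull_pull k h e f, he, hf]

variable {P} in
lemma isLocallySurjective_sigmaDesc_toTotal {ι : Type u} {U : ι → X.Opens} (hU : ⨆ i, U i = ⊤)
    {W : ι → Scheme.{u}} {w : ∀ i, W i ⟶ X} {univ : ∀ i, P.obj (w i)}
    (H : ∀ i, P.IsUniversal (U i) (w i) (univ i)) :
    Presheaf.IsLocallySurjective Scheme.zariskiTopology
      (Sigma.desc fun i => P.toTotal (w i) (univ i)) := by
  refine ⟨fun {T} x => ?_⟩
  obtain ⟨t, p⟩ : Σ t : T ⟶ X, P.obj t := x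
  let 𝒰 : T.OpenCover := T.openCoverOfIsOpenCover (fun i => t ⁻¹ᵁ U i) (by
    rw [TopologicalSpace.IsOpenCover, ← Scheme.Hom.preimage_iSup, hU, Scheme.Hom.preimage_top])
  refine Scheme.zariskiTopology.superset_covering ?_ 𝒰.mem_grothendieckTopology
  rw [Sieve.ofArrows, Sieve.generate_le_iff]
  rintro _ _ ⟨i : ι⟩
  obtain ⟨h, e, he⟩ := (H i).exists_pull_eq t p
  refine ⟨(Sigma.ι (fun i => yoneda.obj (W i)) i).app _ h, ?_⟩
  have hι : Sigma.ι (fun i => yoneda.obj (W i)) i ≫ Sigma.desc (fun i => P.toTotal (w i) (univ i)) =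
      P.toTotal (w i) (univ i) := Sigma.ι_desc _ _
  have hpull : (⟨h ≫ w i, P.pull h rfl (univ i)⟩ : Σ t : (t ⁻¹ᵁ U i).toScheme ⟶ X, P.obj t) =
      ⟨(t ⁻¹ᵁ U i).ι ≫ t, P.pull (t ⁻¹ᵁ U i).ι rfl p⟩ := P.sigma_pull_eq_iff.mpr ⟨e, he⟩
  exact (ConcreteCategory.congr_hom (NatTrans.congr_app hι _) h).trans hpull

lemma exists_isUniversal_top_of_representableBy {V : Scheme.{u}} (r : P.total.RepresentableBy V) :
    ∃ (w : V ⟶ X) (univ : P.obj w), P.IsUniversal ⊤ w univ := by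
  let x : Σ t : V ⟶ X, P.obj t := r.homEquiv (𝟙 V)
  have homEquiv_eq {T : Scheme.{u}} (h : T ⟶ V) :
      r.homEquiv h = (⟨h ≫ x.1, P.pull h rfl x.2⟩ : Σ t : T ⟶ X, P.obj t) := by
    have := r.homEquiv_comp h (𝟙 V)
    rwa [Category.comp_id] at this
  refine ⟨x.1, x.2, by simp, fun {T} t _ p => ⟨r.homEquiv.symm ⟨t, p⟩, ?_, fun h he => ?_⟩⟩
  · apply P.sigma_pull_eq_iff.mp
    rw [← homEquiv_eq]
    exact r.homEquiv.apply_symm_apply _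
  · apply r.homEquiv.injective
    rw [homEquiv_eq]
    exact (P.sigma_pull_eq_iff.mpr he).trans (r.homEquiv.apply_symm_apply _).symm

theorem IsSheaf.exists_isUniversal_top {P : RelPresheaf X} (hP : P.IsSheaf) {ι : Type u}
    {U : ι → X.Opens} (hU : ⨆ i, U i = ⊤) {W : ι → Scheme.{u}} {w : ∀ i, W i ⟶ X}
    {univ : ∀ i, P.obj (w i)} (H : ∀ i, P.IsUniversal (U i) (w i) (univ i)) :
    ∃ (W : Scheme.{u}) (w : W ⟶ X) (univ : P.obj w), P.IsUniversal ⊤ w univ := by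
  let F : Sheaf Scheme.zariskiTopology.{u} (Type u) :=
    ⟨P.total, (isSheaf_iff_isSheaf_of_type _ _).mpr (hP.total)⟩
  let f (i : ι) : yoneda.obj (W i) ⟶ F.1 := P.toTotal (w i) (univ i)
  have hf (i : ι) : IsOpenImmersion.presheaf (f i) := (H i).isOpenImmersion_toTotal
  have : Presheaf.IsLocallySurjective Scheme.zariskiTopology (Sigma.desc f) :=
    isLocallySurjective_sigmaDesc_toTotal hU H
  exact ⟨_, P.exists_isUniversal_top_of_representableBy
    (Scheme.LocalRepresentability.representableBy hf)⟩

end RelPresheaf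

section Functions

variable {X T T' : Scheme.{u}}

/-- Restriction of functions to a smaller open subset, as a ring homomorphism. -/
def resFn {U V : X.Opens} (h : V ≤ U) : Γ(X, U) →+* Γ(X, V) := (X.presheaf.map (homOfLE h).op).hom

/-- Pullback of functions along `t`, as a ring homomorphism. -/
def pullFn (t : T ⟶ X) {U : X.Opens} {V : T.Opens} (h : V ≤ t ⁻¹ᵁ U) : Γ(X, U) →+* Γ(T, V) :=
  (t.appLE U V h).hom

@[simp]
lemma resFn_resFn {U V W : X.Opens} (h : V ≤ U) (h' : W ≤ V) (x : Γ(X, U)) :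
    resFn h' (resFn h x) = resFn (h'.trans h) x := by
  simp only [resFn, ← CommRingCat.comp_apply, ← Functor.map_comp]
  rfl

@[simp]
lemma resFn_self {U : X.Opens} (h : U ≤ U) (x : Γ(X, U)) : resFn h x = x := by
  simp only [resFn]
  exact congr($(X.presheaf.map_id _) x)

@[simp]
lemma resFn_pullFn (t : T ⟶ X) {U : X.Opens} {V W : T.Opens} (h : V ≤ t ⁻¹ᵁ U) (h' : W ≤ V)
    (x : Γ(X, U)) : resFn h' (pullFn t h x) = pullFn t (h'.trans h) x :=
  congr($(t.appLE_map h (homOfLE h').op) x)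

@[simp]
lemma pullFn_resFn (t : T ⟶ X) {U U' : X.Opens} {V : T.Opens} (h : V ≤ t ⁻¹ᵁ U) (h' : U ≤ U')
    (x : Γ(X, U')) : pullFn t h (resFn h' x) = pullFn t (h.trans (t.preimage_mono h')) x :=
  congr($(t.map_appLE h (homOfLE h').op) x)

lemma pullFn_pullFn (h : T' ⟶ T) (t : T ⟶ X) {t' : T' ⟶ X} (e : h ≫ t = t') {U : X.Opens}
    {V : T.Opens} {V' : T'.Opens} (hV : V ≤ t ⁻¹ᵁ U) (hV' : V' ≤ h ⁻¹ᵁ V) (x : Γ(X, U)) :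
    pullFn h hV' (pullFn t hV x) =
      pullFn t' (by subst e; exact hV'.trans (h.preimage_mono hV)) x := by
  subst e
  exact congr($(Scheme.Hom.appLE_comp_appLE h t U V V' hV hV') x)

@[simp]
lemma pullFn_id {U V : X.Opens} (h : V ≤ 𝟙 X ⁻¹ᵁ U) (x : Γ(X, U)) :
    pullFn (𝟙 X) h x = resFn (by simpa using h : V ≤ U) x := by
  have : (𝟙 X : X ⟶ X).appLE U V h = X.presheaf.map (homOfLE h).op := by
    rw [Scheme.Hom.appLE, Scheme.Hom.id_app]
    exact Category.id_comp _
  rw [pullFn, this]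
  rfl

lemma pullFn_bijective (f : T ⟶ X) [IsOpenImmersion f] {U : X.Opens} (hU : U ≤ f.opensRange)
    {V : T.Opens} (h : V ≤ f ⁻¹ᵁ U) (h' : f ⁻¹ᵁ U ≤ V) : Function.Bijective (pullFn f h) := by
  obtain rfl := le_antisymm h h'
  have := f.isIso_app U hU
  rw [show pullFn f h = (f.app U).hom by rw [pullFn, Scheme.Hom.appLE_eq_app]]
  exact ConcreteCategory.bijective_of_isIso (f.app U)

lemma resFn_ext {ι : Type*} {V : X.Opens} (U : ι → X.Opens) (hU : ∀ i, U i ≤ V) (hV : V ≤ ⨆ i, U i)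
    {x y : Γ(X, V)} (h : ∀ i, resFn (hU i) x = resFn (hU i) y) : x = y :=
  TopCat.Sheaf.eq_of_locally_eq' X.sheaf U V (fun i => homOfLE (hU i)) hV x y h

lemma exists_resFn_eq {ι : Type*} {V : X.Opens} (U : ι → X.Opens) (hU : ∀ i, U i ≤ V)
    (hV : V ≤ ⨆ i, U i) (x : ∀ i, Γ(X, U i))
    (h : ∀ i j, resFn (inf_le_left : U i ⊓ U j ≤ _) (x i) = resFn inf_le_right (x j)) :
    ∃ y : Γ(X, V), ∀ i, resFn (hU i) y = x i :=
  (TopCat.Sheaf.existsUnique_gluing' X.sheaf U V (fun i => homOfLE (hU i)) hV x h).exists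

lemma preimage_le_preimage_inf_opensRange (f : T' ⟶ T) [IsOpenImmersion f] (V : T.Opens) :
    f ⁻¹ᵁ V ≤ f ⁻¹ᵁ (V ⊓ f.opensRange) :=
  fun y hy => ⟨hy, ⟨y, rfl⟩⟩

lemma pullFn_bijective_inf_opensRange (f : T' ⟶ T) [IsOpenImmersion f] (V : T.Opens) :
    Function.Bijective (pullFn f (preimage_le_preimage_inf_opensRange f V)) :=
  pullFn_bijective f inf_le_right _ (f.preimage_mono inf_le_left)

lemma le_iSup_inf_opensRange (𝒰 : Scheme.OpenCover.{u} T) (V : T.Opens) :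
    V ≤ ⨆ i, V ⊓ (𝒰.f i).opensRange := by
  rw [← inf_iSup_eq, 𝒰.iSup_opensRange, inf_top_eq]

lemma pullFn_ext (𝒰 : Scheme.OpenCover.{u} T) {V : T.Opens} {x y : Γ(T, V)}
    (h : ∀ i, pullFn (𝒰.f i) le_rfl x = pullFn (𝒰.f i) le_rfl y) : x = y :=
  resFn_ext _ (fun _ => inf_le_left) (le_iSup_inf_opensRange 𝒰 V) fun i =>
    (pullFn_bijective_inf_opensRange (𝒰.f i) V).1 (by simpa using h i)

lemma existsUnique_pullFn_eq (𝒰 : Scheme.OpenCover.{u} T) (V : T.Opens)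
    (x : ∀ i, Γ(𝒰.X i, 𝒰.f i ⁻¹ᵁ V))
    (hx : ∀ i j, pullFn (pullback.fst (𝒰.f i) (𝒰.f j)) le_rfl (x i) =
      pullFn (pullback.snd (𝒰.f i) (𝒰.f j)) (by
        rw [← Scheme.Hom.comp_preimage, ← Scheme.Hom.comp_preimage, pullback.condition]) (x j)) :
    ∃! y : Γ(T, V), ∀ i, pullFn (𝒰.f i) le_rfl y = x i := by
  choose x' hx' using fun i => (pullFn_bijective_inf_opensRange (𝒰.f i) V).2 (x i)
  have hcompat (i j) : resFn (inf_le_left : V ⊓ (𝒰.f i).opensRange ⊓ (V ⊓ (𝒰.f j).opensRange) ≤ _)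
      (x' i) = resFn inf_le_right (x' j) := by
    apply (pullFn_bijective (pullback.fst (𝒰.f i) (𝒰.f j) ≫ 𝒰.f i)
      (U := V ⊓ (𝒰.f i).opensRange ⊓ (V ⊓ (𝒰.f j).opensRange)) ?_ le_rfl le_rfl).1
    · have hle : (pullback.fst (𝒰.f i) (𝒰.f j) ≫ 𝒰.f i) ⁻¹ᵁ
          (V ⊓ (𝒰.f i).opensRange ⊓ (V ⊓ (𝒰.f j).opensRange)) ≤
          pullback.fst (𝒰.f i) (𝒰.f j) ⁻¹ᵁ 𝒰.f i ⁻¹ᵁ V :=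
        Scheme.Hom.preimage_mono _ (inf_le_left.trans inf_le_left)
      have := congrArg (resFn hle) (hx i j)
      rw [← hx', ← hx', pullFn_pullFn _ _ rfl, pullFn_pullFn _ _ pullback.condition.symm] at this
      simpa only [resFn_pullFn, pullFn_resFn] using this
    · rintro z ⟨⟨-, hi⟩, -, hj⟩
      exact (Set.ext_iff.mp (IsOpenImmersion.range_pullback_to_base_of_left _ _) z).mpr ⟨hi, hj⟩
  obtain ⟨y, hy⟩ := exists_resFn_eq _ (fun _ => inf_le_left) (le_iSup_inf_opensRange 𝒰 V) x' hcompat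
  have hyx (i) : pullFn (𝒰.f i) le_rfl y = x i := by rw [← hx' i, ← hy i, pullFn_resFn]
  exact ⟨y, hyx, fun z hz => pullFn_ext 𝒰 fun i => (hz i).trans (hyx i).symm⟩

lemma le_preimage_inf {t : T ⟶ X} {U : X.Opens} (h : ⊤ ≤ t ⁻¹ᵁ U) (V : X.Opens) :
    t ⁻¹ᵁ V ≤ t ⁻¹ᵁ (U ⊓ V) :=
  fun y hy => ⟨h (TopologicalSpace.Opens.mem_top y), hy⟩

lemma appTop_apply (h : T' ⟶ T) (r : Γ(T, ⊤)) :
    h.appTop r = pullFn h (V := ⊤) h.preimage_top.ge r :=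
  congr($((h.appLE_eq_app (U := ⊤)).symm) r)

lemma toSpecΓ_SpecMap_appLE_fromSpec {U : X.Opens} (hU : IsAffineOpen U) (t : T ⟶ X)
    (h : ⊤ ≤ t ⁻¹ᵁ U) : T.toSpecΓ ≫ Spec.map (t.appLE U ⊤ h) ≫ hU.fromSpec = t := by
  have : IsIso (⊤ : T.Opens).ι := by
    rw [← Scheme.topIso_hom]
    infer_instance
  rw [← cancel_epi (⊤ : T.Opens).ι, ← Category.assoc, ← Scheme.Opens.toSpecΓ_top,
    Scheme.Opens.toSpecΓ_SpecMap_appLE_assoc, hU.toSpecΓ_fromSpec, Scheme.Hom.resLE_comp_ι]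

lemma existsUnique_pullFn_eq_ringHom {U : X.Opens} (hU : IsAffineOpen U)
    (f : Γ(X, U) →+* Γ(T, ⊤)) : ∃! t : T ⟶ X, ∃ h : ⊤ ≤ t ⁻¹ᵁ U, pullFn t h = f := by
  let t : T ⟶ X := T.toSpecΓ ≫ Spec.map (CommRingCat.ofHom f) ≫ hU.fromSpec
  have ht : ⊤ ≤ t ⁻¹ᵁ U := by
    rw [Scheme.Hom.comp_preimage, Scheme.Hom.comp_preimage, hU.fromSpec_preimage_self]
    simp
  refine ⟨t, ⟨ht, ?_⟩, ?_⟩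
  · have hSpec : T.toSpecΓ ≫ Spec.map (t.appLE U ⊤ ht) =
        T.toSpecΓ ≫ Spec.map (CommRingCat.ofHom f) := by
      rw [← cancel_mono hU.fromSpec, Category.assoc, Category.assoc]
      exact toSpecΓ_SpecMap_appLE_fromSpec hU t ht
    have hΓ := congr(Scheme.Hom.appTop $hSpec)
    simp only [Scheme.Hom.comp_appTop, Scheme.toSpecΓ_appTop] at hΓ
    rw [Scheme.ΓSpecIso_naturality, Scheme.ΓSpecIso_naturality] at hΓ
    exact congr(CommRingCat.Hom.hom $((cancel_epi (Scheme.ΓSpecIso Γ(X, U)).hom).mp hΓ))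
  · rintro t' ⟨h, rfl⟩
    exact (toSpecΓ_SpecMap_appLE_fromSpec hU t' h).symm

lemma existsUnique_comp_eq_and_pullFn_eq {W : Scheme.{u}} [IsAffine W] {U : X.Opens}
    (hU : IsAffineOpen U) {w : W ⟶ X} (hw : ⊤ ≤ w ⁻¹ᵁ U) {t : T ⟶ X} (ht : ⊤ ≤ t ⁻¹ᵁ U)
    (f : Γ(W, ⊤) →+* Γ(T, ⊤)) (hf : f.comp (pullFn w hw) = pullFn t ht) :
    ∃! h : T ⟶ W, h ≫ w = t ∧ pullFn h h.preimage_top.ge = f := by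
  obtain ⟨h, ⟨htop, rfl⟩, huniq⟩ := existsUnique_pullFn_eq_ringHom (isAffineOpen_top W) f
  refine ⟨h, ⟨?_, rfl⟩, fun h' hh' => huniq h' ⟨h'.preimage_top.ge, hh'.2⟩⟩
  have hle : ⊤ ≤ (h ≫ w) ⁻¹ᵁ U := by
    rw [Scheme.Hom.comp_preimage, top_le_iff.mp hw, Scheme.Hom.preimage_top]
  refine (existsUnique_pullFn_eq_ringHom hU (pullFn t ht)).unique ⟨hle, ?_⟩ ⟨ht, rfl⟩
  rw [← hf]
  ext r
  exact (pullFn_pullFn h w rfl hw htop r).symm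

end Functions

/-! ### The universal solution of `∑ sᵢ xᵢ = 1` -/

/-- The universal `R`-algebra with a solution `x` of `∑ i, s i * x i = 1`. -/
abbrev UnimodularRing {I R : Type*} [Fintype I] [CommRing R] (s : I → R) : Type _ :=
  MvPolynomial I R ⧸ Ideal.span
    {∑ i, MvPolynomial.C (s i) * MvPolynomial.X i - (1 : MvPolynomial I R)}

namespace UnimodularRing

variable {I R : Type*} [Fintype I] [CommRing R] (s : I → R)

/-- The structure morphism of the `R`-algebra `UnimodularRing s`. -/
def C : R →+* UnimodularRing s := (Ideal.Quotient.mk _).comp MvPolynomial.C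

/-- The universal solution of `∑ i, s i * x i = 1`. -/
def X (i : I) : UnimodularRing s := Ideal.Quotient.mk _ (MvPolynomial.X i)

lemma sum_C_mul_X : ∑ i, C s (s i) * X s i = 1 := by
  have : (Ideal.Quotient.mk _ : _ →+* UnimodularRing s)
      (∑ i, MvPolynomial.C (s i) * MvPolynomial.X i) = 1 :=
    Ideal.Quotient.eq.mpr (Ideal.subset_span rfl)
  simpa only [map_sum, map_mul] using! this

lemma existsUnique_ringHom {S : Type*} [CommRing S] (f : R →+* S) (x : I → S)
    (hx : ∑ i, f (s i) * x i = 1) :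
    ∃! F : UnimodularRing s →+* S, F.comp (C s) = f ∧ ∀ i, F (X s i) = x i := by
  have hker : Ideal.span {∑ i, MvPolynomial.C (s i) * MvPolynomial.X i - (1 : MvPolynomial I R)} ≤
      RingHom.ker (MvPolynomial.eval₂Hom f x) := by
    rw [Ideal.span_le, Set.singleton_subset_iff]
    simp [RingHom.mem_ker, hx]
  refine ⟨Ideal.Quotient.lift _ (MvPolynomial.eval₂Hom f x) fun r hr => hker hr,
    ⟨RingHom.ext fun r => MvPolynomial.eval₂_C _ _ r, fun i => MvPolynomial.eval₂_X _ _ i⟩, ?_⟩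
  rintro F ⟨hC, hX⟩
  exact Ideal.Quotient.ringHom_ext (MvPolynomial.ringHom_ext
    (fun r => (DFunLike.congr_fun hC r).trans (MvPolynomial.eval₂_C _ _ _).symm)
    fun i => (hX i).trans (MvPolynomial.eval₂_X _ _ _).symm)

end UnimodularRing

/-- A family of line bundles with sections on `X`, indexed by `I`, such that the loci `D i` where
the sections do not vanish are affine and cover `X`. The line bundles are trivialized over an affine
open cover `U a`, `a : A`, and encoded by their transition functions `g i a b`; the sections are
encoded by their coordinates `s i a`. -/
structure AmpleCocycle (X : Scheme.{u}) (A I : Type u) where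
  U : A → X.Opens
  isAffineOpen_U : ∀ a, IsAffineOpen (U a)
  iSup_U : ⨆ a, U a = ⊤
  s : ∀ (_ : I) (a : A), Γ(X, U a)
  g : ∀ (_ : I) (a b : A), Γ(X, U a ⊓ U b)
  g_self : ∀ i a, g i a a = 1
  g_mul : ∀ i a b c, resFn (inf_le_left : U a ⊓ U b ⊓ U c ≤ U a ⊓ U b) (g i a b) *
    resFn (le_inf (inf_le_left.trans inf_le_right) inf_le_right) (g i b c) =
      resFn (le_inf (inf_le_left.trans inf_le_left) inf_le_right) (g i a c)
  s_eq : ∀ i a b, resFn inf_le_left (s i a) = g i a b * resFn inf_le_right (s i b)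
  D : I → X.Opens
  isAffineOpen_D : ∀ i, IsAffineOpen (D i)
  iSup_D : ⨆ i, D i = ⊤
  D_inf : ∀ i a, D i ⊓ U a = X.basicOpen (s i a)

namespace AmpleCocycle

variable {X : Scheme.{u}} {A I : Type u} (d : AmpleCocycle X A I)

variable {T T' : Scheme.{u}}

/-- Families of functions on the preimages of the `U a`, thought of as coordinates of sections of
the duals of the line bundles. -/
abbrev Coord (t : T ⟶ X) : Type u := ∀ (_ : I) (a : A), Γ(T, t ⁻¹ᵁ d.U a)

instance (t : T ⟶ X) : Module Γ(T, ⊤) (d.Coord t) where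
  smul r φ i a := resFn le_top r * φ i a
  one_smul φ := by funext i a; change resFn _ 1 * _ = _; simp
  mul_smul r r' φ := by funext i a; change resFn _ _ * _ = _ * (_ * _); simp [mul_assoc]
  smul_zero r := by funext i a; exact mul_zero _
  smul_add r φ ψ := by funext i a; exact mul_add _ _ _
  add_smul r r' φ := by
    funext i a; change resFn _ _ * φ i a = _ * φ i a + _ * φ i a; rw [map_add, add_mul]
  zero_smul φ := by funext i a; change resFn _ 0 * _ = 0; simp

variable {d} in
@[simp]
lemma Coord.smul_apply {t : T ⟶ X} (r : Γ(T, ⊤)) (φ : d.Coord t) (i : I) (a : A) :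
    (r • φ) i a = resFn le_top r * φ i a := rfl

/-- The sections over `T` of the pullback of the direct sum of the duals of the line bundles. -/
def dual (t : T ⟶ X) : Submodule Γ(T, ⊤) (d.Coord t) where
  carrier := {φ | ∀ i a b, resFn (t.preimage_mono (inf_le_right : d.U a ⊓ d.U b ≤ _)) (φ i b) =
    pullFn t le_rfl (d.g i a b) * resFn (t.preimage_mono (inf_le_left : d.U a ⊓ d.U b ≤ _)) (φ i a)}
  zero_mem' i a b := by simp
  add_mem' {φ ψ} hφ hψ i a b := by simp [hφ i a b, hψ i a b, mul_add]
  smul_mem' r φ hφ i a b := by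
    simp only [Coord.smul_apply, map_mul, resFn_resFn, hφ i a b]
    ring

/-- Pullback of families of functions. -/
def pullCoord (h : T' ⟶ T) {t : T ⟶ X} {t' : T' ⟶ X} (e : h ≫ t = t') :
    d.Coord t →+ d.Coord t' where
  toFun φ i a := pullFn h (by rw [← e, Scheme.Hom.comp_preimage]) (φ i a)
  map_zero' := by funext i a; exact map_zero _
  map_add' φ ψ := by funext i a; exact map_add _ _ _

lemma pullCoord_apply (h : T' ⟶ T) {t : T ⟶ X} {t' : T' ⟶ X} (e : h ≫ t = t') (φ : d.Coord t)
    (i : I) (a : A) : d.pullCoord h e φ i a =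
      pullFn h (by rw [← e, Scheme.Hom.comp_preimage]) (φ i a) := rfl

lemma pullCoord_smul (h : T' ⟶ T) {t : T ⟶ X} {t' : T' ⟶ X} (e : h ≫ t = t') (r : Γ(T, ⊤))
    (φ : d.Coord t) : d.pullCoord h e (r • φ) = h.appTop r • d.pullCoord h e φ := by
  funext i a
  rw [pullCoord_apply, Coord.smul_apply, Coord.smul_apply, map_mul, pullFn_resFn, appTop_apply,
    resFn_pullFn, pullCoord_apply]

lemma pullCoord_id {t : T ⟶ X} (e : 𝟙 T ≫ t = t) (φ : d.Coord t) : d.pullCoord (𝟙 T) e φ = φ := by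
  funext i a
  simp [pullCoord_apply]

lemma pullCoord_pullCoord {T'' : Scheme.{u}} (h' : T'' ⟶ T') (h : T' ⟶ T) {t : T ⟶ X} {t' : T' ⟶ X}
    {t'' : T'' ⟶ X} (e : h ≫ t = t') (e' : h' ≫ t' = t'') (e'' : (h' ≫ h) ≫ t = t'')
    (φ : d.Coord t) :
    d.pullCoord h' e' (d.pullCoord h e φ) = d.pullCoord (h' ≫ h) e'' φ := by
  funext i a
  simp [pullCoord_apply, pullFn_pullFn h' h rfl]

lemma pullCoord_mem_dual (h : T' ⟶ T) {t : T ⟶ X} {t' : T' ⟶ X} (e : h ≫ t = t') {φ : d.Coord t}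
    (hφ : φ ∈ d.dual t) : d.pullCoord h e φ ∈ d.dual t' := by
  subst e
  intro i a b
  have := congr(pullFn h le_rfl $(hφ i a b))
  rw [map_mul, pullFn_pullFn h t rfl, pullFn_resFn, pullFn_resFn] at this
  rw [pullCoord_apply, pullCoord_apply, resFn_pullFn, resFn_pullFn]
  exact this

/-- The dual section with prescribed coordinates over `U a`, where `t` factors through `U a`. -/
def ofTriv (t : T ⟶ X) (a : A) (h : ⊤ ≤ t ⁻¹ᵁ d.U a) (x : I → Γ(T, ⊤)) : d.Coord t :=
  fun i b => pullFn t (le_preimage_inf h _) (d.g i a b) * resFn le_top (x i)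

lemma ofTriv_mem_dual (t : T ⟶ X) (a : A) (h : ⊤ ≤ t ⁻¹ᵁ d.U a) (x : I → Γ(T, ⊤)) :
    d.ofTriv t a h x ∈ d.dual t := by
  intro i b c
  have hle : t ⁻¹ᵁ (d.U b ⊓ d.U c) ≤ t ⁻¹ᵁ (d.U a ⊓ d.U b ⊓ d.U c) := by
    rw [inf_assoc]
    exact le_preimage_inf h _
  have := congr(pullFn t hle $(d.g_mul i a b c))
  rw [map_mul, pullFn_resFn, pullFn_resFn, pullFn_resFn] at this
  simp only [ofTriv, map_mul, resFn_pullFn, resFn_resFn]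
  rw [← this]
  ring

lemma resFn_ofTriv (t : T ⟶ X) (a : A) (h : ⊤ ≤ t ⁻¹ᵁ d.U a) (x : I → Γ(T, ⊤)) (i : I) :
    resFn h (d.ofTriv t a h x i a) = x i := by
  have hle : (⊤ : T.Opens) ≤ t ⁻¹ᵁ (d.U a ⊓ d.U a) := by rwa [inf_idem]
  have : pullFn t hle (d.g i a a) = 1 := by rw [d.g_self, map_one]
  rw [ofTriv, map_mul, resFn_pullFn, resFn_resFn, resFn_self, this, one_mul]

lemma ofTriv_resFn (t : T ⟶ X) (a : A) (h : ⊤ ≤ t ⁻¹ᵁ d.U a) {φ : d.Coord t} (hφ : φ ∈ d.dual t) :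
    d.ofTriv t a h (fun i => resFn h (φ i a)) = φ := by
  funext i b
  have hle := le_preimage_inf h (d.U b)
  have := congr(resFn hle $(hφ i a b))
  rw [map_mul, resFn_resFn, resFn_self, resFn_resFn, resFn_pullFn] at this
  rw [this, ofTriv, resFn_resFn]

variable [Fintype I]

/-- The pairing of a dual section with the given sections, computed over `U a`. -/
def ev (t : T ⟶ X) (φ : d.Coord t) (a : A) : Γ(T, t ⁻¹ᵁ d.U a) :=
  ∑ i, pullFn t le_rfl (d.s i a) * φ i a

lemma ev_add (t : T ⟶ X) (φ ψ : d.Coord t) (a : A) :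
    d.ev t (φ + ψ) a = d.ev t φ a + d.ev t ψ a := by
  simp [ev, mul_add, Finset.sum_add_distrib]

lemma ev_smul (t : T ⟶ X) (r : Γ(T, ⊤)) (φ : d.Coord t) (a : A) :
    d.ev t (r • φ) a = resFn le_top r * d.ev t φ a := by
  rw [ev, ev, Finset.mul_sum]
  refine Finset.sum_congr rfl fun i _ => ?_
  rw [Coord.smul_apply]
  ring

lemma ev_pullCoord (h : T' ⟶ T) {t : T ⟶ X} {t' : T' ⟶ X} (e : h ≫ t = t') (φ : d.Coord t) (a : A) :
    d.ev t' (d.pullCoord h e φ) a =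
      pullFn h (by rw [← e, Scheme.Hom.comp_preimage]) (d.ev t φ a) := by
  subst e
  simp only [ev, map_sum, map_mul, pullFn_pullFn h t rfl, pullCoord_apply]

/-- The presheaf of those dual sections which take the value `1` on the given sections, i.e. of the
splittings of the morphism from `𝒪` to the direct sum of the line bundles. -/
def splittings : RelPresheaf X where
  obj {T} t := {φ : d.Coord t // φ ∈ d.dual t ∧ ∀ a, d.ev t φ a = 1}
  pull h _ _ e φ := ⟨d.pullCoord h e φ.1, d.pullCoord_mem_dual h e φ.2.1, fun a => by
    rw [ev_pullCoord, φ.2.2, map_one]⟩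
  pull_id e p := Subtype.ext (d.pullCoord_id e _)
  pull_pull h' h t t' t'' e e' e'' p := Subtype.ext (d.pullCoord_pullCoord h' h e e' e'' _)

theorem isSheaf_splittings : d.splittings.IsSheaf := by
  intro T t 𝒰 p hp
  obtain ⟨q, hq, hq'⟩ : ∃! q : d.Coord t, ∀ j, d.pullCoord (𝒰.f j) rfl q = (p j).1 := by
    have (i : I) (a : A) := existsUnique_pullFn_eq 𝒰 (t ⁻¹ᵁ d.U a) (fun j => (p j).1 i a) fun j k =>
      congrFun (congrFun (congrArg Subtype.val (hp j k)) i) a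
    choose q hq hq' using this
    refine ⟨q, fun j => ?_, fun q' h => ?_⟩
    · funext i a
      exact hq i a j
    · funext i a
      exact hq' i a _ fun j => congrFun (congrFun (h j) i) a
  refine ⟨⟨q, ?_, ?_⟩, ?_, ?_⟩
  · intro i a b
    apply pullFn_ext 𝒰
    intro j
    have := (p j).2.1 i a b
    rw [← hq, pullCoord_apply, pullCoord_apply, resFn_pullFn, resFn_pullFn] at this
    rw [map_mul, pullFn_resFn, pullFn_resFn, pullFn_pullFn _ _ rfl]
    exact this
  · intro a
    apply pullFn_ext 𝒰
    intro j
    have := (p j).2.2 a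
    rw [← hq, ev_pullCoord] at this
    rw [map_one]
    exact this
  · intro j
    exact Subtype.ext (hq j)
  · intro q' h
    exact Subtype.ext (hq' _ fun j => congrArg Subtype.val (h j))

lemma ev_ofTriv (t : T ⟶ X) (a : A) (h : ⊤ ≤ t ⁻¹ᵁ d.U a) (x : I → Γ(T, ⊤)) (b : A) :
    d.ev t (d.ofTriv t a h x) b = resFn le_top (∑ i, pullFn t h (d.s i a) * x i) := by
  rw [ev, map_sum]
  refine Finset.sum_congr rfl fun i _ => ?_
  have hle := le_preimage_inf h (d.U b)
  have := congr(pullFn t hle $(d.s_eq i a b))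
  rw [map_mul, pullFn_resFn, pullFn_resFn] at this
  rw [map_mul, resFn_pullFn, this, ofTriv]
  ring

lemma splittings_ext {t : T ⟶ X} {a : A} (h : ⊤ ≤ t ⁻¹ᵁ d.U a) {p q : d.splittings.obj t}
    (hpq : ∀ i, resFn h (p.1 i a) = resFn h (q.1 i a)) : p = q :=
  Subtype.ext (by rw [← d.ofTriv_resFn t a h p.2.1, funext hpq, d.ofTriv_resFn t a h q.2.1])

/-- The splitting with prescribed coordinates over `U a`, where `t` factors through `U a`. -/
def splittingOfTriv {t : T ⟶ X} {a : A} (h : ⊤ ≤ t ⁻¹ᵁ d.U a) {x : I → Γ(T, ⊤)}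
    (hx : ∑ i, pullFn t h (d.s i a) * x i = 1) : d.splittings.obj t :=
  ⟨d.ofTriv t a h x, d.ofTriv_mem_dual t a h x, fun b => by rw [ev_ofTriv, hx, map_one]⟩

lemma resFn_pull_splittingOfTriv {t : T ⟶ X} {a : A} (ht : ⊤ ≤ t ⁻¹ᵁ d.U a) {x : I → Γ(T, ⊤)}
    (hx : ∑ i, pullFn t ht (d.s i a) * x i = 1) {t' : T' ⟶ X} (ht' : ⊤ ≤ t' ⁻¹ᵁ d.U a)
    {h : T' ⟶ T} (e : h ≫ t = t') (i : I) :
    resFn ht' ((d.splittings.pull h e (d.splittingOfTriv ht hx)).1 i a) =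
      pullFn h h.preimage_top.ge (x i) := by
  rw [← d.resFn_ofTriv t a ht x i, pullFn_resFn]
  exact resFn_pullFn h _ ht' _

lemma sum_mul_resFn_eq_one {t : T ⟶ X} {a : A} (h : ⊤ ≤ t ⁻¹ᵁ d.U a) (p : d.splittings.obj t) :
    ∑ i, pullFn t h (d.s i a) * resFn h (p.1 i a) = 1 := by
  have := congr(resFn h $(p.2.2 a))
  simpa only [ev, map_sum, map_mul, resFn_pullFn, map_one] using this

lemma isUniversal_splittingOfTriv {W : Scheme.{u}} [IsAffine W] {w : W ⟶ X} {a : A}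
    (hw : ⊤ ≤ w ⁻¹ᵁ d.U a) (ε : UnimodularRing (d.s · a) ≃+* Γ(W, ⊤))
    (hε : pullFn w hw = ε.toRingHom.comp (UnimodularRing.C _))
    (hx : ∑ i, pullFn w hw (d.s i a) * ε (UnimodularRing.X _ i) = 1) :
    d.splittings.IsUniversal (d.U a) w (d.splittingOfTriv hw hx) := by
  refine ⟨top_le_iff.mp hw, fun {T} t ht p => ?_⟩
  obtain ⟨F, ⟨hFC, hFX⟩, hF⟩ := UnimodularRing.existsUnique_ringHom (d.s · a) (pullFn t ht.ge)
    (fun i => resFn ht.ge (p.1 i a)) (d.sum_mul_resFn_eq_one ht.ge p)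
  have hFε : (F.comp ε.symm.toRingHom).comp (pullFn w hw) = pullFn t ht.ge := by
    rw [hε, ← hFC]
    ext r
    exact congrArg F (ε.symm_apply_apply _)
  obtain ⟨h, ⟨e, hh⟩, huniq⟩ :=
    existsUnique_comp_eq_and_pullFn_eq (d.isAffineOpen_U a) hw ht.ge _ hFε
  refine ⟨h, ⟨e, d.splittings_ext ht.ge fun i => ?_⟩, ?_⟩
  · rw [resFn_pull_splittingOfTriv, hh, ← hFX]
    exact congrArg F (ε.symm_apply_apply _)
  · rintro h' ⟨e', rfl⟩
    refine huniq h' ⟨e', ?_⟩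
    rw [← hF ((pullFn h' h'.preimage_top.ge).comp ε.toRingHom) ⟨?_, fun i => ?_⟩]
    · ext r
      exact congrArg (pullFn h' _) (ε.apply_symm_apply r).symm
    · rw [RingHom.comp_assoc, ← hε]
      ext r
      exact pullFn_pullFn h' w e' hw h'.preimage_top.ge r
    · exact (d.resFn_pull_splittingOfTriv hw hx ht.ge e' i).symm

lemma exists_isAffine_isUniversal_splittings (a : A) :
    ∃ (W : Scheme.{u}) (w : W ⟶ X) (univ : d.splittings.obj w),
      IsAffine W ∧ d.splittings.IsUniversal (d.U a) w univ := by
  let ε : UnimodularRing (d.s · a) ≃+* Γ(Spec (.of (UnimodularRing (d.s · a))), ⊤) :=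
    (Scheme.ΓSpecIso (.of (UnimodularRing (d.s · a)))).symm.commRingCatIsoToRingEquiv
  obtain ⟨w, ⟨hw, hε⟩, -⟩ := existsUnique_pullFn_eq_ringHom (d.isAffineOpen_U a)
    (ε.toRingHom.comp (UnimodularRing.C (d.s · a)))
  have hx : ∑ i, pullFn w hw (d.s i a) * ε (UnimodularRing.X _ i) = 1 := by
    simpa only [hε, map_one, map_sum, map_mul] using!
      congrArg ε (UnimodularRing.sum_C_mul_X (d.s · a))
  exact ⟨_, w, _, inferInstance, d.isUniversal_splittingOfTriv hw ε hε hx⟩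

end AmpleCocycle

section Functions

variable {X T : Scheme.{u}}

lemma isAffineOpen_preimage_of_isAffineHom_ι [IsAffine T] (t : T ⟶ X) (U : X.Opens)
    [IsAffineHom U.ι] : IsAffineOpen (t ⁻¹ᵁ U) := by
  have h : (pullback.fst t U.ι).opensRange = t ⁻¹ᵁ U := by
    ext1
    simpa using IsOpenImmersion.range_pullbackFst U.ι t
  rw [← h]
  exact isAffineOpen_opensRange _

lemma basicOpen_resFn {U V : X.Opens} (h : V ≤ U) (x : Γ(X, U)) :
    X.basicOpen (resFn h x) = V ⊓ X.basicOpen x := X.basicOpen_res _ _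

lemma basicOpen_pullFn (t : T ⟶ X) {U : X.Opens} {V : T.Opens} (h : V ≤ t ⁻¹ᵁ U)
    (x : Γ(X, U)) : T.basicOpen (pullFn t h x) = V ⊓ t ⁻¹ᵁ X.basicOpen x :=
  Scheme.basicOpen_appLE t V U h x

lemma isUnit_of_le_basicOpen {U : X.Opens} {f : Γ(X, U)} (h : U ≤ X.basicOpen f) : IsUnit f := by
  have hres : IsUnit (resFn (X.basicOpen_le f) f) := RingedSpace.isUnit_res_basicOpen _ f
  simpa using hres.map (resFn h)

lemma exists_mul_eq_pow {U : X.Opens} (hU : IsAffineOpen U) {f s : Γ(X, U)}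
    (h : X.basicOpen f ≤ X.basicOpen s) : ∃ (N : ℕ) (c : Γ(X, U)), c * s = f ^ N := by
  have := hU.fromSpec.preimage_mono h
  rw [hU.fromSpec_preimage_basicOpen, hU.fromSpec_preimage_basicOpen] at this
  obtain ⟨N, hN⟩ := (PrimeSpectrum.basicOpen_le_basicOpen_iff f s).mp this
  obtain ⟨c, hc⟩ := Ideal.mem_span_singleton'.mp hN
  exact ⟨N, c, hc⟩

lemma exists_mul_eq_pow_of_finite {A : Type*} [Finite A] {R : A → Type*} [∀ a, CommRing (R a)]
    {f s : ∀ a, R a} (h : ∀ a, ∃ (N : ℕ) (c : R a), c * s a = f a ^ N) :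
    ∃ (N : ℕ) (c : ∀ a, R a), ∀ a, c a * s a = f a ^ N := by
  choose N c hc using h
  obtain ⟨M, hM⟩ := (Set.finite_range N).bddAbove
  refine ⟨M, fun a => c a * f a ^ (M - N a), fun a => ?_⟩
  have hNM : N a ≤ M := hM ⟨a, rfl⟩
  rw [mul_right_comm, hc, ← pow_add, Nat.add_sub_cancel' hNM]

lemma ideal_eq_top_of_forall_mem_basicOpen [IsAffine X] (J : Ideal Γ(X, ⊤))
    (h : ∀ x : X, ∃ f ∈ J, x ∈ X.basicOpen f) : J = ⊤ := by
  have hle : (⊤ : X.Opens) ≤ ⨆ f : (J : Set Γ(X, ⊤)), X.basicOpen (f : Γ(X, ⊤)) := fun x _ => by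
    obtain ⟨f, hf, hx⟩ := h x
    exact TopologicalSpace.Opens.mem_iSup.mpr ⟨⟨f, hf⟩, hx⟩
  rw [(isAffineOpen_top X).self_le_iSup_basicOpen_iff, Ideal.span_eq] at hle
  exact hle

end Functions

namespace AmpleCocycle

variable {X : Scheme.{u}} {A I : Type u} (d : AmpleCocycle X A I)

lemma exists_mem_U (x : X) : ∃ a, x ∈ d.U a :=
  TopologicalSpace.Opens.mem_iSup.mp (d.iSup_U ▸ TopologicalSpace.Opens.mem_top x)

lemma exists_mem_D (x : X) : ∃ i, x ∈ d.D i :=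
  TopologicalSpace.Opens.mem_iSup.mp (d.iSup_D ▸ TopologicalSpace.Opens.mem_top x)

lemma isAffineHom_ι_D (i : I) : IsAffineHom (d.D i).ι := by
  refine isAffineHom_of_forall_exists_isAffineOpen _ fun x => ?_
  obtain ⟨a, ha⟩ := d.exists_mem_U x
  refine ⟨d.U a, ha, d.isAffineOpen_U a, ?_⟩
  rw [← (d.D i).ι.isAffineOpen_iff_of_isOpenImmersion, Scheme.Hom.image_preimage_eq_opensRange_inf,
    Scheme.Opens.opensRange_ι, d.D_inf]
  exact (d.isAffineOpen_U a).basicOpen _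

include d in
lemma isAffineHom_of_isAffine {Y : Scheme.{u}} [IsAffine Y] (y : Y ⟶ X) : IsAffineHom y := by
  refine isAffineHom_of_forall_exists_isAffineOpen _ fun x => ?_
  obtain ⟨i, hi⟩ := d.exists_mem_D x
  have := d.isAffineHom_ι_D i
  exact ⟨d.D i, hi, d.isAffineOpen_D i, isAffineOpen_preimage_of_isAffineHom_ι y _⟩

include d in
lemma isAffineHom_diagonal : IsAffineHom (pullback.diagonal (terminal.from X)) := by
  rw [isAffineHom_diagonal_iff]
  intro _ _ V _ V' _ hV hV'
  have : IsAffine V.toScheme := hV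
  have := d.isAffineHom_of_isAffine V.ι
  have := hV'.preimage V.ι
  rwa [← V.ι.isAffineOpen_iff_of_isOpenImmersion, Scheme.Hom.image_preimage_eq_opensRange_inf,
    Scheme.Opens.opensRange_ι] at this

lemma le_iSup_preimage_U {W : Scheme.{u}} (w : W ⟶ X) : (⊤ : W.Opens) ≤ ⨆ a, w ⁻¹ᵁ d.U a := by
  rw [← Scheme.Hom.preimage_iSup, d.iSup_U, Scheme.Hom.preimage_top]

variable [Fintype I]

lemma exists_isUniversal_top_splittings : ∃ (W : Scheme.{u}) (w : W ⟶ X)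
    (univ : d.splittings.obj w), IsAffineHom w ∧ d.splittings.IsUniversal ⊤ w univ := by
  choose W₀ w₀ univ₀ hW₀ H₀ using d.exists_isAffine_isUniversal_splittings
  obtain ⟨W, w, univ, H⟩ :=
    RelPresheaf.IsSheaf.exists_isUniversal_top d.isSheaf_splittings d.iSup_U H₀
  refine ⟨W, w, univ, isAffineHom_of_forall_exists_isAffineOpen _ fun x => ?_, H⟩
  obtain ⟨a, ha⟩ := d.exists_mem_U x
  refine ⟨d.U a, ha, d.isAffineOpen_U a, ?_⟩
  obtain ⟨e⟩ := (H.restrict (d.U a)).nonempty_iso (H₀ a)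
  have := hW₀ a
  exact IsAffine.of_isIso e.hom

lemma exists_resFn_eq_mul_splitting {W : Scheme.{u}} {w : W ⟶ X} (φ : d.splittings.obj w) (i : I) :
    ∃ f : Γ(W, ⊤), ∀ a, resFn le_top f = pullFn w le_rfl (d.s i a) * φ.1 i a := by
  refine exists_resFn_eq (fun a => w ⁻¹ᵁ d.U a) (fun _ => le_top) (d.le_iSup_preimage_U w) _
    fun a b => ?_
  change resFn (w.preimage_mono (inf_le_left : d.U a ⊓ d.U b ≤ _)) _ =
    resFn (w.preimage_mono (inf_le_right : d.U a ⊓ d.U b ≤ _)) _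
  have := congr(pullFn w le_rfl $(d.s_eq i a b))
  rw [map_mul, pullFn_resFn, pullFn_resFn] at this
  rw [map_mul, map_mul, resFn_pullFn, resFn_pullFn, this, φ.2.1 i a b]
  ring

omit [Fintype I] in
lemma basicOpen_le_preimage_D {W : Scheme.{u}} {w : W ⟶ X} {i : I} {φ : d.Coord w} {f : Γ(W, ⊤)}
    (hf : ∀ a, resFn le_top f = pullFn w le_rfl (d.s i a) * φ i a) :
    W.basicOpen f ≤ w ⁻¹ᵁ d.D i := by
  intro x hx
  obtain ⟨a, ha⟩ := d.exists_mem_U (w x)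
  have hxa : x ∈ W.basicOpen (resFn (le_top : w ⁻¹ᵁ d.U a ≤ ⊤) f) := by
    rw [basicOpen_resFn]
    exact ⟨ha, hx⟩
  rw [hf, Scheme.basicOpen_mul, basicOpen_pullFn, ← d.D_inf] at hxa
  exact hxa.1.2.1

/-- The functions `sᵢ φᵢ` on `W` have sum `1` and affine non-vanishing loci. -/
lemma isAffine_of_splitting {W : Scheme.{u}} (w : W ⟶ X) [IsAffineHom w] (φ : d.splittings.obj w) :
    IsAffine W := by
  choose f hf using d.exists_resFn_eq_mul_splitting φ
  have hsum : ∑ i, f i = 1 := by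
    refine resFn_ext (fun a => w ⁻¹ᵁ d.U a) (fun _ => le_top) (d.le_iSup_preimage_U w) fun a => ?_
    rw [map_sum, map_one, ← φ.2.2 a]
    exact Finset.sum_congr rfl fun i _ => hf i a
  apply isAffine_of_isAffineOpen_basicOpen (Set.range f)
  · rw [Ideal.eq_top_iff_one, ← hsum]
    exact sum_mem fun i _ => Ideal.subset_span ⟨i, rfl⟩
  · rintro _ ⟨i, rfl⟩
    have := ((d.isAffineOpen_D i).preimage w).basicOpen (resFn le_top (f i))
    rwa [basicOpen_resFn, inf_eq_right.mpr (d.basicOpen_le_preimage_D (hf i))] at this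

/-- The image of the evaluation map on the sections of the dual over `Y`. -/
def evIdeal {Y : Scheme.{u}} (y : Y ⟶ X) : Ideal Γ(Y, ⊤) where
  carrier := {r | ∃ φ ∈ d.dual y, ∀ a, d.ev y φ a = resFn le_top r}
  zero_mem' := ⟨0, zero_mem _, fun a => by simp [ev]⟩
  add_mem' := by
    rintro r r' ⟨φ, hφ, h⟩ ⟨φ', hφ', h'⟩
    exact ⟨φ + φ', add_mem hφ hφ', fun a => by rw [ev_add, h, h', map_add]⟩
  smul_mem' := by
    rintro c r ⟨φ, hφ, h⟩
    exact ⟨c • φ, Submodule.smul_mem _ _ hφ, fun a => by rw [ev_smul, h, smul_eq_mul, map_mul]⟩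

omit [Fintype I] in
/-- The `c a` are coordinates over `D i` of the section `F / s i` of the dual of the `i`-th line
bundle; multiplying once more by `F = c a * s i a` makes the cocycle relation hold everywhere. -/
lemma single_sq_mul_mem_dual [DecidableEq I] {Y : Scheme.{u}} (y : Y ⟶ X) {i : I} {F : Γ(Y, ⊤)}
    {c : ∀ a, Γ(Y, y ⁻¹ᵁ d.U a)} (hc : ∀ a, c a * pullFn y le_rfl (d.s i a) = resFn le_top F) :
    (Pi.single i fun a => c a ^ 2 * pullFn y le_rfl (d.s i a) : d.Coord y) ∈ d.dual y := by
  intro j a b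
  obtain rfl | hj := eq_or_ne j i
  · have ha := congr(resFn (y.preimage_mono (inf_le_left : d.U a ⊓ d.U b ≤ _)) $(hc a))
    have hb := congr(resFn (y.preimage_mono (inf_le_right : d.U a ⊓ d.U b ≤ _)) $(hc b))
    have hs := congr(pullFn y le_rfl $(d.s_eq j a b))
    simp only [map_mul, resFn_resFn, pullFn_resFn] at ha hb hs
    rw [resFn_pullFn] at ha hb
    simp only [Pi.single_eq_same, map_mul, map_pow]
    rw [resFn_pullFn, resFn_pullFn]
    have hab := ha.trans hb.symm
    set ca := resFn _ (c a)
    set cb := resFn _ (c b)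
    set g := pullFn y _ (d.g j a b)
    linear_combination -cb * hab + ca * cb * hs - ca * g * hab
  · simp [hj]

lemma exists_pow_mem_evIdeal [Finite A] {Y : Scheme.{u}} [IsAffine Y] (y : Y ⟶ X) {i : I}
    {f : Γ(Y, ⊤)} (hf : Y.basicOpen f ≤ y ⁻¹ᵁ d.D i) : ∃ N, f ^ N ∈ d.evIdeal y := by
  classical
  have := d.isAffineHom_of_isAffine y
  obtain ⟨N, c, hc⟩ : ∃ (N : ℕ) (c : ∀ a, Γ(Y, y ⁻¹ᵁ d.U a)),
      ∀ a, c a * pullFn y le_rfl (d.s i a) = resFn le_top f ^ N := by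
    refine exists_mul_eq_pow_of_finite fun a =>
      exists_mul_eq_pow ((d.isAffineOpen_U a).preimage y) ?_
    rw [basicOpen_resFn, basicOpen_pullFn, ← d.D_inf]
    exact fun z hz => ⟨hz.1, hf hz.2, hz.1⟩
  simp only [← map_pow] at hc
  refine ⟨N + N, _, d.single_sq_mul_mem_dual y hc, fun a => ?_⟩
  rw [ev, Finset.sum_eq_single i (by simp +contextual) (by simp), Pi.single_eq_same, pow_add,
    map_mul, ← hc a]
  ring

lemma nonempty_splittings_of_isAffine [Finite A] {Y : Scheme.{u}} [IsAffine Y] (y : Y ⟶ X) :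
    Nonempty (d.splittings.obj y) := by
  have htop : d.evIdeal y = ⊤ := by
    refine ideal_eq_top_of_forall_mem_basicOpen _ fun x => ?_
    obtain ⟨i, hi⟩ := d.exists_mem_D (y x)
    obtain ⟨f, hf, hx⟩ := (isAffineOpen_top Y).exists_basicOpen_le
      ⟨x, show x ∈ y ⁻¹ᵁ d.D i from hi⟩ (TopologicalSpace.Opens.mem_top _)
    obtain ⟨N, hN⟩ := d.exists_pow_mem_evIdeal y hf
    refine ⟨f ^ (N + 1), pow_succ f N ▸ Ideal.mul_mem_right f _ hN, ?_⟩
    rwa [Scheme.basicOpen_pow _ _ N.succ_pos]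
  obtain ⟨φ, hφ, h⟩ : (1 : Γ(Y, ⊤)) ∈ d.evIdeal y := htop ▸ Submodule.mem_top
  exact ⟨φ, hφ, fun a => by rw [h, map_one]⟩

end AmpleCocycle

/-- A presheaf of modules on the category of `U`-schemes. As for `RelPresheaf`, pullback takes an
equation between structure morphisms as an argument, so that no transport is needed. -/
structure RelModule (U : Scheme.{u}) where
  obj : ∀ {T : Scheme.{u}} (_ : T ⟶ U), Type w
  [addCommGroup : ∀ {T : Scheme.{u}} (t : T ⟶ U), AddCommGroup (obj t)]
  [module : ∀ {T : Scheme.{u}} (t : T ⟶ U), Module Γ(T, ⊤) (obj t)]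
  pull : ∀ {T T' : Scheme.{u}} (h : T' ⟶ T) {t : T ⟶ U} {t' : T' ⟶ U} (_ : h ≫ t = t'),
    obj t →+ obj t'
  pull_smul : ∀ {T T' : Scheme.{u}} (h : T' ⟶ T) {t : T ⟶ U} {t' : T' ⟶ U} (e : h ≫ t = t')
    (a : Γ(T, ⊤)) (s : obj t), pull h e (a • s) = h.appTop a • pull h e s
  pull_pull : ∀ {T T' T'' : Scheme.{u}} (h' : T'' ⟶ T') (h : T' ⟶ T) {t : T ⟶ U} {t' : T' ⟶ U}
    {t'' : T'' ⟶ U} (e : h ≫ t = t') (e' : h' ≫ t' = t'') (e'' : (h' ≫ h) ≫ t = t'') (s : obj t),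
    pull h' e' (pull h e s) = pull (h' ≫ h) e'' s

namespace RelModule

attribute [instance] RelModule.addCommGroup RelModule.module

variable {U : Scheme.{u}} (N : RelModule.{u, w} U)

lemma pull_id_smul {T : Scheme.{u}} {t t' : T ⟶ U} (e : 𝟙 T ≫ t = t') (a : Γ(T, ⊤))
    (s : N.obj t) : N.pull (𝟙 T) e (a • s) = a • N.pull (𝟙 T) e s := by
  rw [N.pull_smul, Scheme.Hom.id_appTop]
  rfl

variable {N} in
/-- The sections `e k` over `V` form a basis of `N`, universally over all `V`-schemes. -/
structure IsBasis {κ : Type*} [Fintype κ] {V : Scheme.{u}} {v : V ⟶ U} (e : κ → N.obj v) :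
    Prop where
  bijective : ∀ {T : Scheme.{u}} (h : T ⟶ V) {t : T ⟶ U} (he : h ≫ v = t),
    Function.Bijective fun c : κ → Γ(T, ⊤) => ∑ k, c k • N.pull h he (e k)

variable {N} in
lemma IsBasis.pull {κ : Type*} [Fintype κ] {V V' : Scheme.{u}} {v : V ⟶ U} {e : κ → N.obj v}
    (he : IsBasis e) (r : V' ⟶ V) {v' : V' ⟶ U} (hr : r ≫ v = v') :
    IsBasis fun k => N.pull r hr (e k) := by
  refine ⟨fun h t ht => ?_⟩
  have hrt : (h ≫ r) ≫ v = t := by rw [Category.assoc, hr, ht]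
  simpa only [N.pull_pull h r hr ht hrt] using he.bijective (h ≫ r) hrt

variable {N} in
lemma IsBasis.comp_equiv {κ κ' : Type*} [Fintype κ] [Fintype κ'] {V : Scheme.{u}} {v : V ⟶ U}
    {e : κ → N.obj v} (he : IsBasis e) (σ : κ' ≃ κ) : IsBasis (e ∘ σ) := by
  refine ⟨fun {T} h t ht => ?_⟩
  convert (he.bijective h ht).comp (σ.arrowCongr (Equiv.refl Γ(T, ⊤))).bijective using 1
  funext c
  exact Fintype.sum_equiv σ _ _ fun k => by simp [Equiv.arrowCongr]

/-- `N` is, Zariski locally on `U`, free of finite rank. -/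
def IsLocallyFree : Prop :=
  ∀ x : U, ∃ V : U.Opens, x ∈ V ∧ ∃ (n : ℕ) (e : Fin n → N.obj V.ι), IsBasis e

variable {N} in
lemma isLocallyFree_of_forall_exists_isBasis
    (h : ∀ x : U, ∃ V : U.Opens, x ∈ V ∧ ∃ (κ : Type u) (_ : Fintype κ) (e : κ → N.obj V.ι),
      IsBasis e) : N.IsLocallyFree := by
  intro x
  obtain ⟨V, hx, κ, _, e, he⟩ := h x
  exact ⟨V, hx, _, _, he.comp_equiv (Fintype.equivFin κ).symm⟩

/-- The pullback of `N` along `y`. -/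
def comap {Y : Scheme.{u}} (y : Y ⟶ U) : RelModule.{u, w} Y where
  obj t := N.obj (t ≫ y)
  pull h _ _ e := N.pull h (by rw [← Category.assoc, e])
  pull_smul h _ _ _ := N.pull_smul h _
  pull_pull h' h _ _ _ _ _ e'' := N.pull_pull h' h _ _ (by rw [← e'', Category.assoc _ _ y])

variable {N} in
lemma IsLocallyFree.comap (hN : N.IsLocallyFree) {Y : Scheme.{u}} (y : Y ⟶ U) :
    (N.comap y).IsLocallyFree := by
  intro x
  obtain ⟨V, hx, n, e, he⟩ := hN (y x)
  exact ⟨y ⁻¹ᵁ V, hx, n, fun k => N.pull (y ∣_ V) (morphismRestrict_ι y V) (e k),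
    ⟨fun h t ht => (he.pull (y ∣_ V) (morphismRestrict_ι y V)).bijective h _⟩⟩

section Pi

variable {J : Type v} (M : J → RelModule.{u, w} U)

/-- The product of a family of presheaves of modules. -/
def pi : RelModule.{u, max v w} U where
  obj t := ∀ j, (M j).obj t
  pull h _ _ e := AddMonoidHom.pi fun j => ((M j).pull h e).comp (Pi.evalAddMonoidHom _ j)
  pull_smul h _ _ e a s := funext fun j => (M j).pull_smul h e a (s j)
  pull_pull h' h _ _ _ e e' e'' s := funext fun j => (M j).pull_pull h' h e e' e'' (s j)

variable {M}

lemma IsBasis.pi [Fintype J] [DecidableEq J] {κ : J → Type*} [∀ j, Fintype (κ j)] {V : Scheme.{u}}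
    {v : V ⟶ U} {e : ∀ j, κ j → (M j).obj v} (he : ∀ j, IsBasis (e j)) :
    IsBasis (N := RelModule.pi M)
      (fun k : Σ j, κ j => (Pi.single k.1 (e k.1 k.2) : ∀ j, (M j).obj v)) := by
  refine ⟨fun {T} h t ht => ?_⟩
  convert! (Function.Bijective.piMap fun j => (he j).bijective h ht).comp
    (Equiv.piCurry fun _ _ => Γ(T, ⊤)).bijective using 1
  funext c j
  refine (Finset.sum_apply j Finset.univ _).trans ?_
  rw [Fintype.sum_sigma, Finset.sum_eq_single j ?_ (by simp)]
  · refine Finset.sum_congr rfl fun l _ => congrArg (c ⟨j, l⟩ • (M j).pull h ht ·) ?_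
    exact Pi.single_eq_same j _
  · intro i _ hi
    refine Finset.sum_eq_zero fun l _ => ?_
    have : (Pi.single i (e i l) : ∀ j, (M j).obj v) j = 0 := Pi.single_eq_of_ne hi.symm _
    change c ⟨i, l⟩ • (M j).pull h ht ((Pi.single i (e i l) : ∀ j, (M j).obj v) j) = 0
    rw [this, map_zero, smul_zero]

lemma IsLocallyFree.pi [Finite J] (hM : ∀ j, (M j).IsLocallyFree) :
    (RelModule.pi M).IsLocallyFree := by
  classical
  have := Fintype.ofFinite J
  intro x
  choose V hx n e he using fun j => hM j x
  let V' : U.Opens := ⟨⋂ j, V j, isOpen_iInter_of_finite fun j => (V j).2⟩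
  have hV' (j : J) : V' ≤ V j := fun z hz => Set.mem_iInter.mp hz j
  have hpi := IsBasis.pi fun j =>
    (he j).pull (U.homOfLE (hV' j)) (U.homOfLE_ι (hV' j))
  exact ⟨V', Set.mem_iInter.mpr hx, _, _, hpi.comp_equiv (Fintype.equivFin _).symm⟩

end Pi

end RelModule

/-- The functor of points of a vector bundle. -/
def VectorBundleStructure.relModule {E U : Scheme.{u}} {π : E ⟶ U}
    (β : VectorBundleStructure π) : RelModule.{u, u} U :=
  letI := fun {T : Scheme.{u}} (t : T ⟶ U) => β.addCommGroup t
  letI := fun {T : Scheme.{u}} (t : T ⟶ U) => β.module t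
  { obj := Points π
    pull h t _ e := AddMonoidHom.mk' (fun s => ⟨h ≫ s.1, by rw [Category.assoc, s.2, e]⟩)
      (by subst e; exact β.pull_add h t)
    pull_smul h t _ e := by subst e; exact β.pull_smul h t
    pull_pull h' h _ _ _ _ _ _ s := Subtype.ext (Category.assoc h' h s.1).symm }

lemma VectorBundleStructure.isLocallyFree_relModule {E U : Scheme.{u}} {π : E ⟶ U}
    (β : VectorBundleStructure π) : β.relModule.IsLocallyFree := by
  intro x
  obtain ⟨V, hx, n, e, he⟩ := β.locally_trivial x
  refine ⟨V, hx, n, e, ⟨fun h t ht => ?_⟩⟩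
  subst ht
  exact he h

/-- The vector bundle structure obtained from an identification of the functor of points with a
locally free presheaf of modules. -/
def VectorBundleStructure.ofEquiv {E U : Scheme.{u}} {π : E ⟶ U} {N : RelModule.{u, w} U}
    (hN : N.IsLocallyFree) (Φ : ∀ {T : Scheme.{u}} (t : T ⟶ U), Points π t ≃ N.obj t)
    (hΦ : ∀ {T T' : Scheme.{u}} (h : T' ⟶ T) (t : T ⟶ U) (s : Points π t),
      Φ (h ≫ t) (s.pull h) = N.pull h rfl (Φ t s)) : VectorBundleStructure π :=
  letI := fun {T : Scheme.{u}} (t : T ⟶ U) => (Φ t).addCommGroup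
  letI := fun {T : Scheme.{u}} (t : T ⟶ U) => (Φ t).module Γ(T, ⊤)
  let Ψ {T : Scheme.{u}} (t : T ⟶ U) : Points π t ≃ₗ[Γ(T, ⊤)] N.obj t := (Φ t).linearEquiv Γ(T, ⊤)
  have hΨ {T T' : Scheme.{u}} (h : T' ⟶ T) (t : T ⟶ U) (s : Points π t) :
    Ψ (h ≫ t) (s.pull h) = N.pull h rfl (Ψ t s) := hΦ h t s
  { addCommGroup t := inferInstance
    module t := inferInstance
    pull_add h t s s' := (Ψ (h ≫ t)).injective (by simp only [hΨ, map_add])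
    pull_smul h t a s := (Ψ (h ≫ t)).injective (by simp only [hΨ, map_smul, N.pull_smul])
    locally_trivial x := by
      obtain ⟨V, hx, n, e, he⟩ := hN x
      refine ⟨V, hx, n, fun j => (Ψ V.ι).symm (e j), fun t => ?_⟩
      rw [← Function.Bijective.of_comp_iff' (Ψ (t ≫ V.ι)).bijective]
      convert he.bijective t rfl using 1
      funext c
      simp only [Function.comp_apply, map_sum, map_smul, hΨ, LinearEquiv.apply_symm_apply] }

/-! ### Relations between the coordinates of a unimodular vector -/

section Relation

variable {I R S : Type*} [DecidableEq I] [CommRing R] [CommRing S]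

/-- If `u * s i = 1`, then the `relation s u i j`, `j ≠ i`, form a basis of the module of solutions
`x` of `∑ k, s k * x k = 0`. -/
def relation (s : I → R) (u : R) (i j : I) : I → R :=
  Pi.single j 1 - Pi.single i (u * s j)

lemma map_relation (f : R →+* S) (s : I → R) (u : R) (i j k : I) :
    f (relation s u i j k) = relation (f ∘ s) (f u) i j k := by
  simp only [relation, Pi.sub_apply, map_sub, Pi.single_apply, apply_ite f, map_one, map_mul,
    map_zero, Function.comp_apply]

variable [Fintype I] {s : I → R} {u : R} {i : I}

lemma sum_mul_relation (hu : u * s i = 1) (j : I) : ∑ k, s k * relation s u i j k = 0 := by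
  simp only [relation, Pi.sub_apply, mul_sub, Finset.sum_sub_distrib, Pi.single_apply, mul_ite,
    mul_one, mul_zero, Finset.sum_ite_eq', Finset.mem_univ, if_true]
  linear_combination -s j * hu

lemma sum_smul_relation_apply (c : {j // j ≠ i} → R) (k : {j // j ≠ i}) :
    (∑ j, c j • relation s u i j) k.1 = c k := by
  rw [Finset.sum_apply, Finset.sum_eq_single k ?_ (by simp)]
  · simp [relation, k.2]
  · intro j _ hj
    have : k.1 ≠ j.1 := fun h => hj (Subtype.ext h).symm
    simp [relation, k.2, this]

lemma sum_smul_relation_eq (hu : u * s i = 1) {x : I → R} (hx : ∑ k, s k * x k = 0) :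
    ∑ j : {j // j ≠ i}, x j • relation s u i j = x := by
  set y := ∑ j : {j // j ≠ i}, x j • relation s u i j with hy
  have hne (k : I) (hk : k ≠ i) : y k = x k :=
    sum_smul_relation_apply (fun j => x j.1) ⟨k, hk⟩
  have hsum : ∑ k, s k * y k = 0 := by
    calc ∑ k, s k * y k = ∑ j : {j // j ≠ i}, x j * ∑ k, s k * relation s u i j k := by
          simp only [hy, Finset.sum_apply, Pi.smul_apply, smul_eq_mul, Finset.mul_sum]
          rw [Finset.sum_comm]
          exact Finset.sum_congr rfl fun j _ => Finset.sum_congr rfl fun k _ => mul_left_comm ..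
      _ = 0 := by simp only [sum_mul_relation hu, mul_zero, Finset.sum_const_zero]
  have hi : s i * (y i - x i) = 0 := by
    calc s i * (y i - x i) = ∑ k, s k * (y k - x k) :=
          (Fintype.sum_eq_single (f := fun k => s k * (y k - x k)) i fun k hk => by
            rw [hne k hk, sub_self, mul_zero]).symm
      _ = 0 := by simp only [mul_sub, Finset.sum_sub_distrib, hsum, hx, sub_zero]
  funext k
  obtain rfl | hk := eq_or_ne k i
  · linear_combination u * hi - (y k - x k) * hu
  · exact hne k hk

end Relation

/-! ### The kernel of the evaluation map -/

namespace AmpleCocycle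

variable {X T T' : Scheme.{u}} {A I : Type u} (d : AmpleCocycle X A I)

lemma pullCoord_ofTriv (h : T' ⟶ T) {t : T ⟶ X} {t' : T' ⟶ X} (e : h ≫ t = t') (a : A)
    (ht : ⊤ ≤ t ⁻¹ᵁ d.U a) (ht' : ⊤ ≤ t' ⁻¹ᵁ d.U a) (x : I → Γ(T, ⊤)) :
    d.pullCoord h e (d.ofTriv t a ht x) =
      d.ofTriv t' a ht' (fun i => pullFn h h.preimage_top.ge (x i)) := by
  funext i b
  rw [pullCoord_apply, ofTriv, ofTriv, map_mul, pullFn_pullFn h t e, pullFn_resFn, resFn_pullFn]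

variable [Fintype I]

/-- The kernel of the evaluation map on the sections of the dual over `T`. -/
def kernelAt (t : T ⟶ X) : Submodule Γ(T, ⊤) (d.Coord t) where
  carrier := {φ | φ ∈ d.dual t ∧ ∀ a, d.ev t φ a = 0}
  zero_mem' := ⟨zero_mem _, fun a => by simp [ev]⟩
  add_mem' := fun h h' => ⟨add_mem h.1 h'.1, fun a => by rw [ev_add, h.2, h'.2, add_zero]⟩
  smul_mem' := fun r φ h => ⟨Submodule.smul_mem _ _ h.1, fun a => by rw [ev_smul, h.2, mul_zero]⟩

/-- The kernel of the evaluation map from the direct sum of the duals of the line bundles to `𝒪`. -/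
def kernel : RelModule.{u, u} X where
  obj t := d.kernelAt t
  pull h _ _ e := AddMonoidHom.mk' (fun φ => ⟨d.pullCoord h e φ.1, d.pullCoord_mem_dual h e φ.2.1,
    fun a => by rw [ev_pullCoord, φ.2.2, map_zero]⟩) fun _ _ => Subtype.ext (map_add _ _ _)
  pull_smul h _ _ e r φ := Subtype.ext (d.pullCoord_smul h e r φ.1)
  pull_pull h' h _ _ _ e e' e'' φ := Subtype.ext (d.pullCoord_pullCoord h' h e e' e'' φ.1)

lemma ev_sub (t : T ⟶ X) (φ ψ : d.Coord t) (a : A) :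
    d.ev t (φ - ψ) a = d.ev t φ a - d.ev t ψ a := by
  simp [ev, mul_sub, Finset.sum_sub_distrib]

/-- Subtracting a fixed splitting identifies the splittings with the kernel. -/
def splittingsEquiv {t : T ⟶ X} (ψ : d.splittings.obj t) :
    d.splittings.obj t ≃ d.kernel.obj t where
  toFun φ := ⟨φ.1 - ψ.1, sub_mem φ.2.1 ψ.2.1, fun a => by rw [ev_sub, φ.2.2, ψ.2.2, sub_self]⟩
  invFun φ := ⟨φ.1 + ψ.1, add_mem φ.2.1 ψ.2.1, fun a => by rw [ev_add, φ.2.2, ψ.2.2, zero_add]⟩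
  left_inv φ := Subtype.ext (sub_add_cancel _ _)
  right_inv φ := Subtype.ext (add_sub_cancel_right _ _)

lemma pull_splittingsEquiv (h : T' ⟶ T) {t : T ⟶ X} {t' : T' ⟶ X} (e : h ≫ t = t')
    (ψ φ : d.splittings.obj t) : d.kernel.pull h e (d.splittingsEquiv ψ φ) =
      d.splittingsEquiv (d.splittings.pull h e ψ) (d.splittings.pull h e φ) :=
  Subtype.ext (map_sub _ _ _)

section Triv

variable {t : T ⟶ X} {a : A} (ht : ⊤ ≤ t ⁻¹ᵁ d.U a)

/-- The coordinates over `U a` of an element of the kernel, where `t` factors through `U a`. -/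
def kernelCoord : d.kernel.obj t →ₗ[Γ(T, ⊤)] I → Γ(T, ⊤) where
  toFun φ i := resFn ht (φ.1 i a)
  map_add' φ ψ := funext fun i => map_add _ _ _
  map_smul' r φ := funext fun i => by
    change resFn ht (resFn le_top r * φ.1 i a) = _
    simp

lemma kernelCoord_injective : Function.Injective (d.kernelCoord ht) := fun φ ψ h =>
  Subtype.ext (by
    rw [← d.ofTriv_resFn t a ht φ.2.1, ← d.ofTriv_resFn t a ht ψ.2.1]
    exact congrArg _ h)

lemma sum_mul_kernelCoord (φ : d.kernel.obj t) :
    ∑ i, pullFn t ht (d.s i a) * d.kernelCoord ht φ i = 0 := by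
  have := congr(resFn ht $(φ.2.2 a))
  change ∑ i, pullFn t ht (d.s i a) * resFn ht (φ.1 i a) = 0
  simpa only [ev, map_sum, map_mul, resFn_pullFn, map_zero] using this

/-- The element of the kernel with prescribed coordinates over `U a`. -/
def kernelOfTriv {x : I → Γ(T, ⊤)} (hx : ∑ i, pullFn t ht (d.s i a) * x i = 0) : d.kernel.obj t :=
  ⟨d.ofTriv t a ht x, d.ofTriv_mem_dual _ _ _ _, fun b => by rw [ev_ofTriv, hx, map_zero]⟩

lemma kernelCoord_pull_kernelOfTriv {x : I → Γ(T, ⊤)}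
    (hx : ∑ i, pullFn t ht (d.s i a) * x i = 0) (h : T' ⟶ T) {t' : T' ⟶ X} (e : h ≫ t = t')
    (ht' : ⊤ ≤ t' ⁻¹ᵁ d.U a) (i : I) :
    d.kernelCoord ht' (d.kernel.pull h e (d.kernelOfTriv ht hx)) i =
      pullFn h h.preimage_top.ge (x i) := by
  change resFn ht' (d.pullCoord h e (d.ofTriv t a ht x) i a) = _
  rw [d.pullCoord_ofTriv h e a ht ht', resFn_ofTriv]

lemma isBasis_kernelOfTriv [DecidableEq I] {i : I} {u : Γ(T, ⊤)}
    (hu : u * pullFn t ht (d.s i a) = 1) :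
    RelModule.IsBasis fun j : {j // j ≠ i} => d.kernelOfTriv ht
      (sum_mul_relation (s := fun k => pullFn t ht (d.s k a)) hu j.1) := by
  refine ⟨fun {T'} h t' e => ?_⟩
  have ht' : ⊤ ≤ t' ⁻¹ᵁ d.U a := by
    rw [← e, Scheme.Hom.comp_preimage, top_le_iff.mp ht, Scheme.Hom.preimage_top]
  set s' : I → Γ(T', ⊤) := fun k => pullFn t' ht' (d.s k a)
  set u' := pullFn h h.preimage_top.ge u
  have hs' : pullFn h h.preimage_top.ge ∘ (fun k => pullFn t ht (d.s k a)) = s' :=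
    funext fun k => pullFn_pullFn h t e ht h.preimage_top.ge _
  have hu' : u' * s' i = 1 := by
    rw [← hs', Function.comp_apply, ← map_mul, hu, map_one]
  have hcoord (c : {j // j ≠ i} → Γ(T', ⊤)) :
      d.kernelCoord ht' (∑ j, c j • d.kernel.pull h e (d.kernelOfTriv ht
          (sum_mul_relation (s := fun k => pullFn t ht (d.s k a)) hu j.1))) =
        ∑ j : {j // j ≠ i}, c j • relation s' u' i j := by
    rw [map_sum]
    refine Finset.sum_congr rfl fun j _ => ?_
    rw [map_smul]
    congr 1
    funext k
    rw [kernelCoord_pull_kernelOfTriv, map_relation, hs']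
  constructor
  · intro c c' hcc'
    funext k
    rw [← sum_smul_relation_apply (s := s') (u := u') c k, ← hcoord c]
    simp only at hcc'
    rw [hcc', hcoord, sum_smul_relation_apply]
  · intro φ
    refine ⟨fun j => d.kernelCoord ht' φ j, d.kernelCoord_injective ht' ?_⟩
    exact (hcoord _).trans (sum_smul_relation_eq hu' (d.sum_mul_kernelCoord ht' φ))

end Triv

lemma isLocallyFree_kernel : d.kernel.IsLocallyFree := by
  classical
  refine RelModule.isLocallyFree_of_forall_exists_isBasis fun x => ?_
  obtain ⟨i, hi⟩ := d.exists_mem_D x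
  obtain ⟨a, ha⟩ := d.exists_mem_U x
  have ht : ⊤ ≤ (d.D i ⊓ d.U a).ι ⁻¹ᵁ d.U a := fun z _ => z.2.2
  have hunit : IsUnit (pullFn (d.D i ⊓ d.U a).ι ht (d.s i a)) := by
    apply isUnit_of_le_basicOpen
    rw [basicOpen_pullFn, ← d.D_inf]
    exact fun z _ => ⟨trivial, z.2⟩
  obtain ⟨u, hu⟩ := hunit.exists_left_inv
  exact ⟨d.D i ⊓ d.U a, ⟨hi, ha⟩, {j // j ≠ i}, inferInstance, _, d.isBasis_kernelOfTriv ht hu⟩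

end AmpleCocycle

/-- The points of the base change along `y` of an object representing `P` are sections of `P`. -/
def RelPresheaf.IsUniversal.pointsEquiv {X W Y : Scheme.{u}} {P : RelPresheaf X} {w : W ⟶ X}
    {univ : P.obj w} (H : P.IsUniversal ⊤ w univ) (y : Y ⟶ X) {T : Scheme.{u}} (t : T ⟶ Y) :
    Points (pullback.snd w y) t ≃ P.obj (t ≫ y) :=
  Equiv.ofBijective (fun s => P.pull (s.1 ≫ pullback.fst w y)
      (by rw [Category.assoc, pullback.condition, ← Category.assoc, s.2]) univ) <| by
    constructor
    · intro s s' hs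
      refine Subtype.ext (pullback.hom_ext ?_ (s.2.trans s'.2.symm))
      exact (H.existsUnique (t ≫ y) (by simp) _).unique ⟨_, hs⟩ ⟨_, rfl⟩
    · intro p
      obtain ⟨h, ⟨e, he⟩, -⟩ := H.existsUnique (t ≫ y) (by simp) p
      refine ⟨⟨pullback.lift h t e, pullback.lift_snd _ _ _⟩, ?_⟩
      simp only [pullback.lift_fst, he]

lemma RelPresheaf.IsUniversal.pull_pointsEquiv {X W Y : Scheme.{u}} {P : RelPresheaf X} {w : W ⟶ X}
    {univ : P.obj w} (H : P.IsUniversal ⊤ w univ) (y : Y ⟶ X) {T T' : Scheme.{u}} (h : T' ⟶ T)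
    (t : T ⟶ Y) (s : Points (pullback.snd w y) t) :
    P.pull h (Category.assoc h t y).symm (H.pointsEquiv y t s) =
      H.pointsEquiv y (h ≫ t) (s.pull h) := by
  change P.pull h _ (P.pull (s.1 ≫ pullback.fst w y) _ univ) =
    P.pull ((h ≫ s.1) ≫ pullback.fst w y) _ univ
  rw [P.pull_pull _ _ _ _ (by simp [pullback.condition, reassoc_of% s.2])]
  simp only [Category.assoc]

lemma AmpleCocycle.nonempty_vectorBundleStructure {X : Scheme.{u}} {A I : Type u}
    (d : AmpleCocycle X A I) [Fintype I] [Finite A] {W : Scheme.{u}} {w : W ⟶ X}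
    {univ : d.splittings.obj w} (H : d.splittings.IsUniversal ⊤ w univ) {Y : Scheme.{u}}
    [IsAffine Y] (y : Y ⟶ X) : Nonempty (VectorBundleStructure (pullback.snd w y)) := by
  obtain ⟨ψ⟩ := d.nonempty_splittings_of_isAffine y
  refine ⟨.ofEquiv (d.isLocallyFree_kernel.comap y) (fun t =>
    (H.pointsEquiv y t).trans (d.splittingsEquiv (d.splittings.pull t rfl ψ))) fun h t s => ?_⟩
  refine Eq.trans ?_ (d.pull_splittingsEquiv h (Category.assoc h t y).symm _ _).symm
  rw [d.splittings.pull_pull h t rfl (Category.assoc h t y).symm (Category.assoc h t y).symm,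
    H.pull_pointsEquiv]
  rfl

/-! ### Coinduction -/

section FiberProduct

variable {J : Type v} {W B X P : Scheme.{u}}

/-- `P`, with the projections `p` and `q j`, is the fibre product over `X` of the base changes of
`w` along the `r j`. -/
structure IsFiberProduct (w : W ⟶ B) (r : J → (X ⟶ B)) (p : P ⟶ X) (q : J → (P ⟶ W)) : Prop where
  comp_eq : ∀ j, q j ≫ w = p ≫ r j
  existsUnique : ∀ {T : Scheme.{u}} (t : T ⟶ X) (f : J → (T ⟶ W)), (∀ j, f j ≫ w = t ≫ r j) →
    ∃! h : T ⟶ P, h ≫ p = t ∧ ∀ j, h ≫ q j = f j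

namespace IsFiberProduct

variable {w : W ⟶ B} {r : J → (X ⟶ B)} {p : P ⟶ X} {q : J → (P ⟶ W)}

lemma comp_equiv_symm {J' : Type v} {r : J' → (X ⟶ B)} (σ : J ≃ J')
    (H : IsFiberProduct w (r ∘ σ) p q) : IsFiberProduct w r p (q ∘ σ.symm) where
  comp_eq j := by simp [H.comp_eq]
  existsUnique t f hf := by
    obtain ⟨h, ⟨h1, h2⟩, h3⟩ := H.existsUnique t (f ∘ σ) fun j => hf _
    exact ⟨h, ⟨h1, fun j => by simp [h2]⟩, fun k hk => h3 k ⟨hk.1, fun j => by simp [← hk.2]⟩⟩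

lemma option {r : Option J → (X ⟶ B)} (H : IsFiberProduct w (r ∘ some) p q) :
    IsFiberProduct w r (pullback.snd w (p ≫ r none) ≫ p)
      (fun j => j.elim (pullback.fst _ _) fun j => pullback.snd _ _ ≫ q j) where
  comp_eq := by
    rintro (_ | j)
    · simpa using! pullback.condition
    · simp [H.comp_eq]
  existsUnique t f hf := by
    obtain ⟨h, ⟨h1, h2⟩, h3⟩ := H.existsUnique t (f ∘ some) fun j => hf _
    have e : f none ≫ w = h ≫ p ≫ r none := by rw [hf, reassoc_of% h1]
    refine ⟨pullback.lift (f none) h e, ⟨?_, ?_⟩, ?_⟩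
    · rw [pullback.lift_snd_assoc, h1]
    · rintro (_ | j)
      · exact pullback.lift_fst _ _ _
      · exact (pullback.lift_snd_assoc _ _ _ _).trans (h2 j)
    · rintro k ⟨k1, k2⟩
      apply pullback.hom_ext
      · rw [pullback.lift_fst]
        exact k2 none
      · rw [pullback.lift_snd]
        exact h3 _ ⟨by simpa using k1, fun j => by simpa using k2 (some j)⟩

lemma exists_isAffineHom [Finite J] (w : W ⟶ B) [IsAffineHom w] (r : J → (X ⟶ B)) :
    ∃ (P : Scheme.{u}) (p : P ⟶ X) (q : J → (P ⟶ W)), IsAffineHom p ∧ IsFiberProduct w r p q := by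
  induction J using Finite.induction_empty_option with
  | of_equiv σ ih =>
    obtain ⟨P, p, q, hp, H⟩ := ih (r ∘ σ)
    exact ⟨P, p, _, hp, H.comp_equiv_symm σ⟩
  | h_empty =>
    exact ⟨X, 𝟙 X, PEmpty.rec, inferInstance, nofun, fun t _ _ =>
      ⟨t, ⟨Category.comp_id _, nofun⟩, fun h hh => by simpa using hh.1⟩⟩
  | h_option ih =>
    obtain ⟨P, p, q, hp, H⟩ := ih (r ∘ some)
    have : IsAffineHom (pullback.snd w (p ≫ r none)) :=
      MorphismProperty.of_isPullback (P := @IsAffineHom) (.of_hasPullback _ _) ‹_›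
    exact ⟨_, _, _, inferInstance, H.option⟩

lemma baseChange (H : IsFiberProduct w r p q) {Y P' B' : Scheme.{u}} {fst : P' ⟶ P} {snd : P' ⟶ Y}
    {f : Y ⟶ X} (hP : IsPullback fst snd p f) {b : B' ⟶ B} {r' : J → (Y ⟶ B')}
    (hr : ∀ j, f ≫ r j = r' j ≫ b) :
    IsFiberProduct (pullback.snd w b) r' snd fun j =>
      pullback.lift (fst ≫ q j) (snd ≫ r' j) (by
        rw [Category.assoc, Category.assoc, H.comp_eq, reassoc_of% hP.w, hr]) where
  comp_eq j := pullback.lift_snd _ _ _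
  existsUnique t g hg := by
    have hgf (j : J) : (g j ≫ pullback.fst w b) ≫ w = (t ≫ f) ≫ r j := by
      rw [Category.assoc, pullback.condition, reassoc_of% hg, Category.assoc, hr]
    obtain ⟨k, ⟨hk, hkq⟩, hk'⟩ := H.existsUnique (t ≫ f) (fun j => g j ≫ pullback.fst w b) hgf
    refine ⟨hP.lift k t hk, ⟨hP.lift_snd _ _ _, fun j => pullback.hom_ext ?_ ?_⟩, ?_⟩
    · rw [Category.assoc, pullback.lift_fst, hP.lift_fst_assoc, hkq]
    · rw [Category.assoc, pullback.lift_snd, hP.lift_snd_assoc, hg]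
    · rintro l ⟨hlt, hlg⟩
      refine hP.hom_ext ?_ (hlt.trans (hP.lift_snd _ _ _).symm)
      rw [hP.lift_fst]
      refine hk' _ ⟨by rw [Category.assoc, hP.w, reassoc_of% hlt], fun j => ?_⟩
      rw [← hlg, Category.assoc, Category.assoc, pullback.lift_fst]

/-- The points of a fibre product are the families of points of the factors. -/
def pointsEquiv (H : IsFiberProduct w r p q) {T : Scheme.{u}} (t : T ⟶ X) :
    Points p t ≃ ∀ j, Points w (t ≫ r j) :=
  Equiv.ofBijective
    (fun s j => ⟨s.1 ≫ q j, by rw [Category.assoc, H.comp_eq, ← Category.assoc, s.2]⟩) <| by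
    constructor
    · intro s s' h
      have hval (j : J) : s.1 ≫ q j = s'.1 ≫ q j := congr(($h j).1)
      exact Subtype.ext ((H.existsUnique t (fun j => s'.1 ≫ q j) fun j => by
        rw [Category.assoc, H.comp_eq, ← Category.assoc, s'.2]).unique
          ⟨s.2, hval⟩ ⟨s'.2, fun _ => rfl⟩)
    · intro f
      obtain ⟨k, ⟨hk, hkf⟩, -⟩ := H.existsUnique t (fun j => (f j).1) fun j => (f j).2
      exact ⟨⟨k, hk⟩, funext fun j => Subtype.ext (hkf j)⟩

end IsFiberProduct

end FiberProduct

section EquivariantBundle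

variable {G : Type v} [Group G]

lemma ρ_mul (X : Action Scheme.{u} G) (g h : G) : X.ρ (g * h) = X.ρ h ≫ X.ρ g :=
  map_mul X.ρ g h

/-- `π : W' ⟶ X` is coinduced from `w : W ⟶ X`: the lifts of `t` to `W'` are the families of lifts
of the `t ≫ X.ρ g` to `W`, `g : G`, and `G` acts by translation of the indices. -/
structure IsCoinduction {X W' : Action Scheme.{u} G} {W : Scheme.{u}} (w : W ⟶ X.V) (π : W' ⟶ X)
    (q : G → (W'.V ⟶ W)) : Prop extends IsFiberProduct w (fun g => X.ρ g) π.hom q where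
  ρ_comp : ∀ g h, W'.ρ g ≫ q h = q (h * g)

lemma exists_isCoinduction [Finite G] (X : Action Scheme.{u} G) {W : Scheme.{u}} (w : W ⟶ X.V)
    [IsAffineHom w] [IsAffine W] : ∃ (W' : Action Scheme.{u} G) (π : W' ⟶ X) (q : G → (W'.V ⟶ W)),
      IsAffine W'.V ∧ IsCoinduction w π q := by
  obtain ⟨P, p, q, hp, H⟩ := IsFiberProduct.exists_isAffineHom w fun g => X.ρ g
  have hact (g : G) := H.existsUnique (p ≫ X.ρ g) (fun h => q (h * g)) fun h => by
    rw [H.comp_eq, Category.assoc, ρ_mul]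
  choose α hα hαq using fun g => (hact g).exists
  have hone : X.ρ 1 = 𝟙 X.V := map_one X.ρ
  let W' : Action Scheme.{u} G :=
    { V := P
      ρ :=
        { toFun := α
          map_one' := (hact 1).unique ⟨hα 1, hαq 1⟩
            ⟨by rw [hone]; exact (Category.id_comp _).trans (Category.comp_id _).symm,
              fun h => by rw [mul_one]; exact Category.id_comp _⟩
          map_mul' g g' := (hact (g * g')).unique ⟨hα _, hαq _⟩
            ⟨by
              change (α g' ≫ α g) ≫ p = _
              rw [Category.assoc, hα, reassoc_of% hα g', ρ_mul], fun h => by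
              change (α g' ≫ α g) ≫ q h = _
              rw [Category.assoc, hαq, hαq, mul_assoc]⟩ } }
  refine ⟨W', ⟨p, hα⟩, q, ?_, { H with ρ_comp := hαq }⟩
  have hq1 : q 1 ≫ w = p := by rw [H.comp_eq, hone]; exact Category.comp_id _
  have : IsAffineHom (q 1 ≫ w) := hq1 ▸ hp
  have : IsAffineHom (q 1) := .of_comp (q 1) w
  exact isAffine_of_isAffineHom (q 1)

lemma IsCoinduction.baseChange {X W' Y E : Action Scheme.{u} G} {W : Scheme.{u}} {w : W ⟶ X.V}
    {π : W' ⟶ X} {q : G → (W'.V ⟶ W)} (H : IsCoinduction w π q) {f : Y ⟶ X} {fst : E ⟶ W'}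
    {snd : E ⟶ Y} (hE : IsPullback fst.hom snd.hom π.hom f.hom) :
    IsCoinduction (pullback.snd w f.hom) snd fun g => pullback.lift (fst.hom ≫ q g)
      (snd.hom ≫ Y.ρ g) (by
        rw [Category.assoc, Category.assoc, H.comp_eq, reassoc_of% hE.w, f.comm]) where
  __ := H.toIsFiberProduct.baseChange hE fun g => (f.comm g).symm
  ρ_comp g h := by
    apply pullback.hom_ext
    · rw [Category.assoc, pullback.lift_fst, pullback.lift_fst, reassoc_of% fst.comm g, H.ρ_comp]
    · rw [Category.assoc, pullback.lift_snd, pullback.lift_snd, reassoc_of% snd.comm g, ρ_mul]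

/-- The `G`-vector bundle structure obtained from an identification of the functor of points with a
locally free presheaf of modules, under which `G` acts linearly. -/
def GVectorBundleStructure.ofEquiv {E U : Action Scheme.{u} G} {π : E ⟶ U}
    {N : RelModule.{u, w} U.V} (hN : N.IsLocallyFree)
    (Φ : ∀ {T : Scheme.{u}} (t : T ⟶ U.V), Points π.hom t ≃ N.obj t)
    (hΦ : ∀ {T T' : Scheme.{u}} (h : T' ⟶ T) (t : T ⟶ U.V) (s : Points π.hom t),
      Φ (h ≫ t) (s.pull h) = N.pull h rfl (Φ t s))
    (α : ∀ (g : G) {T : Scheme.{u}} (t : T ⟶ U.V), N.obj t →ₗ[Γ(T, ⊤)] N.obj (t ≫ U.ρ g))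
    (hα : ∀ (g : G) {T : Scheme.{u}} (t : T ⟶ U.V) (s : Points π.hom t),
      Φ (t ≫ U.ρ g) (s.act g) = α g t (Φ t s)) : GVectorBundleStructure π :=
  let β := VectorBundleStructure.ofEquiv hN Φ hΦ
  { β with
    act_add g T t s s' := by
      have hadd {t : T ⟶ U.V} (s s' : Points π.hom t) :
          Φ t ((β.addCommGroup t).toAdd.add s s') = Φ t s + Φ t s' := (Φ t).apply_symm_apply _
      apply (Φ (t ≫ U.ρ g)).injective
      rw [hα]
      refine (congrArg _ (hadd s s')).trans ?_
      refine Eq.trans ?_ (hadd (s.act g) (s'.act g)).symm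
      rw [hα, hα, map_add]
    act_smul g T t a s := by
      have hsmul {t : T ⟶ U.V} (s : Points π.hom t) :
          Φ t (letI := β.addCommGroup t; letI := β.module t; a • s) = a • Φ t s :=
        (Φ t).apply_symm_apply _
      apply (Φ (t ≫ U.ρ g)).injective
      rw [hα]
      refine (congrArg _ (hsmul s)).trans ?_
      refine Eq.trans ?_ (hsmul (s.act g)).symm
      rw [hα, map_smul] }

lemma IsCoinduction.isGVectorBundle [Finite G] {U W' : Action Scheme.{u} G} {W : Scheme.{u}}
    {w : W ⟶ U.V} {π : W' ⟶ U} {q : G → (W'.V ⟶ W)} (H : IsCoinduction w π q)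
    (β : VectorBundleStructure w) : IsGVectorBundle π := by
  let N := RelModule.pi fun g : G => β.relModule.comap (U.ρ g)
  have e (g h : G) {T : Scheme.{u}} (t : T ⟶ U.V) :
      𝟙 T ≫ t ≫ U.ρ (h * g) = (t ≫ U.ρ g) ≫ U.ρ h := by
    rw [Category.id_comp, Category.assoc, ρ_mul]
  let α (g : G) {T : Scheme.{u}} (t : T ⟶ U.V) : N.obj t →ₗ[Γ(T, ⊤)] N.obj (t ≫ U.ρ g) :=
    { toFun φ h := β.relModule.pull (𝟙 T) (e g h t) (φ (h * g))
      map_add' φ ψ := funext fun h => map_add _ _ _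
      map_smul' a φ := funext fun h => β.relModule.pull_id_smul (e g h t) a _ }
  refine ⟨.ofEquiv (N := N) (.pi fun g => β.isLocallyFree_relModule.comap (U.ρ g))
    (fun t => H.pointsEquiv t) (fun h t s => ?_) α fun g T t s => ?_⟩
  · exact funext fun g => Subtype.ext (Category.assoc _ _ _)
  · refine funext fun h => Subtype.ext ?_
    change (s.1 ≫ W'.ρ g) ≫ q h = 𝟙 T ≫ s.1 ≫ q (h * g)
    rw [Category.assoc, H.ρ_comp, Category.id_comp]

theorem exists_isGVectorBundle_pullback [Finite G] (X : Action Scheme.{u} G) {A I : Type u}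
    [Finite A] [Finite I] (d : AmpleCocycle X.V A I) :
    ∃ (W : Action Scheme.{u} G) (π : W ⟶ X), IsAffine W.V ∧
      ∀ (Y : Action Scheme.{u} G) (f : Y ⟶ X), IsAffine Y.V →
        IsGVectorBundle (pullback.snd π f) := by
  have := Fintype.ofFinite I
  obtain ⟨W₀, w, univ, hw, H⟩ := d.exists_isUniversal_top_splittings
  have := d.isAffine_of_splitting w univ
  obtain ⟨W, π, q, hW, H'⟩ := exists_isCoinduction X w
  refine ⟨W, π, hW, fun Y f hY => ?_⟩
  obtain ⟨β⟩ := d.nonempty_vectorBundleStructure H f.hom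
  exact (H'.baseChange ((IsPullback.of_hasPullback π f).map (Action.forget Scheme.{u} G))
    ).isGVectorBundle β

end EquivariantBundle

/-! ### Local isomorphisms and distinguished squares -/

lemma etale_of_isLocalIso {X Y : Scheme.{u}} (f : X ⟶ Y) [hf : IsLocalIso f] : Etale f :=
  @IsLocalIso.le_of_isZariskiLocalAtSource @Etale ⟨fun _ => inferInstance⟩
    HasRingHomProperty.instIsZariskiLocalAtSource _ _ f hf

lemma isIso_of_isLocalIso_of_bijective {X Y : Scheme.{u}} (f : X ⟶ Y) [hf : IsLocalIso f]
    (h : Function.Bijective f) : IsIso f := by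
  have : Etale f := etale_of_isLocalIso f
  have : IsOpenImmersion f := by
    rw [IsOpenImmersion.iff_isIso_stalkMap]
    refine ⟨.of_continuous_injective_isOpenMap f.continuous h.1 f.isOpenMap, fun x => ?_⟩
    obtain ⟨U, hxU, hU⟩ := hf.exists_isOpenImmersion x
    obtain ⟨y, rfl⟩ : ∃ y : U.toScheme, U.ι y = x := ⟨⟨x, hxU⟩, rfl⟩
    have : IsIso ((U.ι ≫ f).stalkMap y) := inferInstance
    rw [Scheme.Hom.stalkMap_comp] at this
    exact @IsIso.of_isIso_comp_right _ _ _ _ _ _ (U.ι.stalkMap y) inferInstance this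
  apply isIso_of_isOpenImmersion_of_opensRange_eq_top
  ext y
  simpa using! h.2 y

lemma exists_isReduced_isClosedImmersion (X : Scheme.{u}) {C : Set X} (hC : IsClosed C) :
    ∃ (Z : Scheme.{u}) (z : Z ⟶ X), IsReduced Z ∧ IsClosedImmersion z ∧ Set.range z = C := by
  let I := Scheme.IdealSheafData.vanishingIdeal (X := X) ⟨C, hC⟩
  refine ⟨I.subscheme, I.subschemeι, ?_, inferInstance, ?_⟩
  · have (U : X.affineOpens) : IsReduced (I.subschemeCover.openCover.X U) := by
      have : _root_.IsReduced (Γ(X, U) ⧸ I.ideal U) := by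
        rw [← Ideal.isRadical_iff_quotient_reduced]
        exact PrimeSpectrum.isRadical_vanishingIdeal _
      exact inferInstanceAs (IsReduced (Spec (.of (Γ(X, U) ⧸ I.ideal U))))
    have (U : I.subschemeCover.openCover.I₀) : IsReduced (I.subschemeCover.openCover.X U) := this U
    exact IsReduced.of_openCover _ I.subschemeCover.openCover
  · rw [I.range_subschemeι]
    simp [I]

lemma bijective_pullback_fst {X Y Z : Scheme.{u}} (z : Z ⟶ X) (p : Y ⟶ X) [IsClosedImmersion z]
    (h : Set.BijOn p (p ⁻¹' Set.range z) (Set.range z)) :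
    Function.Bijective (pullback.fst z p) := by
  have comm (a : (pullback z p :)) : p (pullback.snd z p a) = z (pullback.fst z p a) := by
    rw [← Scheme.Hom.comp_apply, ← Scheme.Hom.comp_apply, pullback.condition]
  have hmem (a : (pullback z p :)) : pullback.snd z p a ∈ p ⁻¹' Set.range z := ⟨_, (comm a).symm⟩
  refine ⟨fun a b hab => ?_, fun x => ?_⟩
  · apply (pullback.snd z p).isClosedEmbedding.injective
    apply h.injOn (hmem a) (hmem b)
    rw [comm, comm, hab]
  · obtain ⟨y, -, hy⟩ := h.surjOn ⟨x, rfl⟩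
    obtain ⟨a, ha, -⟩ := Scheme.Pullback.exists_preimage_pullback x y hy.symm
    exact ⟨a, ha⟩

section NAffineBundle

variable {G : Type v} [Group G]

lemma isDistinguished_of_isLocalIso {X A Y : Action Scheme.{u} G} (i : A ⟶ X) (p : Y ⟶ X)
    [IsOpenImmersion i.hom] [QuasiCompact i.hom] [IsLocalIso p.hom] [IsSeparated p.hom]
    [QuasiCompact p.hom]
    (h : Set.BijOn p.hom (p.hom ⁻¹' (Set.range i.hom)ᶜ) (Set.range i.hom)ᶜ) :
    IsDistinguished i p := by
  refine ⟨inferInstance, inferInstance, etale_of_isLocalIso _, inferInstance, inferInstance, ?_⟩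
  obtain ⟨Z, z, hZ, hz, hzr⟩ := exists_isReduced_isClosedImmersion X.V
    i.hom.isOpenEmbedding.isOpen_range.isClosed_compl
  have : IsLocalIso (pullback.fst z p.hom) := MorphismProperty.of_isPullback (P := @IsLocalIso)
    (IsPullback.of_hasPullback z p.hom).flip inferInstance
  have := isIso_of_isLocalIso_of_bijective _ (bijective_pullback_fst z p.hom (hzr ▸ h))
  refine ⟨_, Z, pullback.snd z p.hom, z, asIso (pullback.fst z p.hom),
    isReduced_of_isOpenImmersion (pullback.fst z p.hom), hZ, inferInstance, hz, hzr, ?_,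
    pullback.condition⟩
  rw [Scheme.Pullback.range_snd, hzr, Set.preimage_compl]

/-! ### Invariant open subsets -/

lemma range_ι_comp_subset {X Y : Scheme.{u}} (f : X ⟶ Y) {U : X.Opens} {V : Y.Opens}
    (h : f ⁻¹ᵁ V = U) : Set.range (U.ι ≫ f) ⊆ Set.range V.ι := by
  rintro _ ⟨x, rfl⟩
  have : x.1 ∈ f ⁻¹ᵁ V := h.symm ▸ x.2
  simpa using! this

/-- An invariant open subset of a `G`-scheme, as a `G`-scheme. -/
def invariantOpen (X : Action Scheme.{u} G) (U : X.V.Opens) (hU : ∀ g, X.ρ g ⁻¹ᵁ U = U) :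
    Action Scheme.{u} G where
  V := U
  ρ :=
    { toFun g := IsOpenImmersion.lift U.ι (U.ι ≫ X.ρ g) (range_ι_comp_subset _ (hU g))
      map_one' := by
        apply (cancel_mono U.ι).mp
        rw [IsOpenImmersion.lift_fac, show X.ρ 1 = 𝟙 X.V from map_one X.ρ]
        exact (Category.comp_id _).trans (Category.id_comp _).symm
      map_mul' g h := by
        apply (cancel_mono U.ι).mp
        rw [IsOpenImmersion.lift_fac, ρ_mul]
        change _ = (IsOpenImmersion.lift U.ι (U.ι ≫ X.ρ h) _ ≫
          IsOpenImmersion.lift U.ι (U.ι ≫ X.ρ g) _) ≫ U.ι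
        rw [Category.assoc, IsOpenImmersion.lift_fac, IsOpenImmersion.lift_fac_assoc,
          Category.assoc] }

section InvariantOpen

variable {X : Action Scheme.{u} G} {U : X.V.Opens} (hU : ∀ g, X.ρ g ⁻¹ᵁ U = U)

/-- The inclusion of an invariant open subset, as an equivariant morphism. -/
def invariantOpenι : invariantOpen X U hU ⟶ X where
  hom := U.ι
  comm g := IsOpenImmersion.lift_fac U.ι (U.ι ≫ X.ρ g) (range_ι_comp_subset _ (hU g))

instance : IsOpenImmersion (invariantOpenι hU).hom :=
  inferInstanceAs (IsOpenImmersion U.ι)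

lemma range_invariantOpenι : Set.range (invariantOpenι hU).hom = U := Scheme.Opens.range_ι U

/-- The factorization of an equivariant morphism through an invariant open subset. -/
def invariantOpenLift {Y : Action Scheme.{u} G} (f : Y ⟶ X) (hf : Set.range f.hom ⊆ U) :
    Y ⟶ invariantOpen X U hU where
  hom := IsOpenImmersion.lift (invariantOpenι hU).hom f.hom (hf.trans (Scheme.Opens.range_ι U).ge)
  comm g := by
    rw [← cancel_mono (invariantOpenι hU).hom, Category.assoc, Category.assoc,
      IsOpenImmersion.lift_fac, (invariantOpenι hU).comm, IsOpenImmersion.lift_fac_assoc, f.comm]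

lemma invariantOpenLift_ι {Y : Action Scheme.{u} G} (f : Y ⟶ X) (hf : Set.range f.hom ⊆ U) :
    invariantOpenLift hU f hf ≫ invariantOpenι hU = f := by
  ext1
  exact IsOpenImmersion.lift_fac _ _ _

lemma invariantOpenLift_hom_ι {Y : Action Scheme.{u} G} (f : Y ⟶ X) (hf : Set.range f.hom ⊆ U) :
    (invariantOpenLift hU f hf).hom ≫ (invariantOpenι hU).hom = f.hom :=
  congrArg Action.Hom.hom (invariantOpenLift_ι hU f hf)

lemma invariantOpenLift_apply {Y : Action Scheme.{u} G} (f : Y ⟶ X) (hf : Set.range f.hom ⊆ U)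
    (y : Y.V) : (invariantOpenι hU).hom ((invariantOpenLift hU f hf).hom y) = f.hom y := by
  rw [← Scheme.Hom.comp_apply, invariantOpenLift_hom_ι]

lemma invariantOpenLift_of_postcomp (P : MorphismProperty Scheme.{u})
    [P.IsStableUnderBaseChange] {Y : Action Scheme.{u} G} (f : Y ⟶ X)
    (hf : Set.range f.hom ⊆ U) (h : P f.hom) : P (invariantOpenLift hU f hf).hom :=
  P.of_postcomp (W' := @IsOpenImmersion) _ (invariantOpenι hU).hom inferInstance
    (by rwa [invariantOpenLift_hom_ι])

lemma isDistinguished_invariantOpenLift [QuasiSeparatedSpace X.V] {A Y : Action Scheme.{u} G}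
    (i : A ⟶ X) (p : Y ⟶ X) [IsOpenImmersion i.hom] [IsLocalIso p.hom] [CompactSpace A.V]
    [IsAffine Y.V] (hi : Set.range i.hom ⊆ U) (hp : Set.range p.hom ⊆ U)
    (h : Set.BijOn p.hom (p.hom ⁻¹' (U \ Set.range i.hom)) (U \ Set.range i.hom)) :
    IsDistinguished (invariantOpenLift hU i hi) (invariantOpenLift hU p hp) := by
  have : IsSeparated p.hom := by
    have : IsSeparated (p.hom ≫ terminal.from X.V) := by
      rw [terminal.comp_from]; infer_instance
    exact IsSeparated.of_comp p.hom (terminal.from X.V)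
  have : IsOpenImmersion (invariantOpenLift hU i hi).hom :=
    invariantOpenLift_of_postcomp hU @IsOpenImmersion i hi inferInstance
  have : QuasiCompact (invariantOpenLift hU i hi).hom :=
    invariantOpenLift_of_postcomp hU @QuasiCompact i hi inferInstance
  have : IsLocalIso (invariantOpenLift hU p hp).hom :=
    invariantOpenLift_of_postcomp hU @IsLocalIso p hp inferInstance
  have : IsSeparated (invariantOpenLift hU p hp).hom :=
    invariantOpenLift_of_postcomp hU @IsSeparated p hp inferInstance
  have : QuasiCompact (invariantOpenLift hU p hp).hom :=
    invariantOpenLift_of_postcomp hU @QuasiCompact p hp inferInstance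
  have hinj := (invariantOpenι hU).hom.isOpenEmbedding.injective
  have mem_range (u : (invariantOpen X U hU).V) :
      u ∈ Set.range (invariantOpenLift hU i hi).hom ↔
        (invariantOpenι hU).hom u ∈ Set.range i.hom := by
    refine exists_congr fun a => ?_
    rw [← hinj.eq_iff, invariantOpenLift_apply]
  have mem_preimage {y : Y.V} (hy : y ∈ (invariantOpenLift hU p hp).hom ⁻¹'
      (Set.range (invariantOpenLift hU i hi).hom)ᶜ) :
      y ∈ p.hom ⁻¹' (U \ Set.range i.hom) := by
    rw [Set.mem_preimage, Set.mem_compl_iff, mem_range, invariantOpenLift_apply] at hy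
    exact ⟨hp ⟨y, rfl⟩, hy⟩
  refine isDistinguished_of_isLocalIso _ _ ⟨fun _ hy => hy, fun y hy y' hy' hyy' => ?_,
    fun u hu => ?_⟩
  · apply h.injOn (mem_preimage hy) (mem_preimage hy')
    rw [← invariantOpenLift_apply hU p hp, hyy', invariantOpenLift_apply]
  · rw [Set.mem_compl_iff, mem_range] at hu
    obtain ⟨y, -, hy⟩ := h.surjOn ⟨u.2, hu⟩
    obtain rfl : (invariantOpenLift hU p hp).hom y = u :=
      hinj ((invariantOpenLift_apply hU p hp y).trans hy)
    exact ⟨y, mt (mem_range _).mp hu, rfl⟩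

end InvariantOpen

/-! ### Disjoint unions of open subsets -/

section Sigma

variable {X : Scheme.{u}} {τ : Type*} [Finite τ] (U : τ → X.Opens)

/-- The morphism to a disjoint union of open subsets of `X` induced by a morphism to `X` which
factors through one of these. -/
def toSigma (t : τ) {Z : Scheme.{u}} (f : Z ⟶ X) (hf : Set.range f ⊆ Set.range (U t).ι) :
    Z ⟶ ∐ fun t => (U t : Scheme.{u}) :=
  IsOpenImmersion.lift (U t).ι f hf ≫ Sigma.ι (fun t => (U t : Scheme.{u})) t

lemma toSigma_desc (t : τ) {Z : Scheme.{u}} (f : Z ⟶ X) (hf : Set.range f ⊆ Set.range (U t).ι)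
    {Y : Scheme.{u}} (k : ∀ t, (U t : Scheme.{u}) ⟶ Y) :
    toSigma U t f hf ≫ Sigma.desc k = IsOpenImmersion.lift (U t).ι f hf ≫ k t := by
  rw [toSigma, Category.assoc, Sigma.ι_desc]

lemma toSigma_congr {t t' : τ} (h : t = t') {Z : Scheme.{u}} {f f' : Z ⟶ X} (e : f = f')
    (hf : Set.range f ⊆ Set.range (U t).ι) (hf' : Set.range f' ⊆ Set.range (U t').ι) :
    toSigma U t f hf = toSigma U t' f' hf' := by
  subst h e; rfl

lemma toSigma_ι (t : τ) :
    toSigma U t (U t).ι le_rfl = Sigma.ι (fun t => (U t : Scheme.{u})) t := by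
  have : IsOpenImmersion.lift (U t).ι (U t).ι le_rfl = 𝟙 _ := by
    rw [← cancel_mono (U t).ι, IsOpenImmersion.lift_fac, Category.id_comp]
  rw [toSigma, this, Category.id_comp]

lemma lift_toSigma {t s : τ} {Z : Scheme.{u}} (f : Z ⟶ X) (hf : Set.range f ⊆ Set.range (U t).ι)
    (r : X ⟶ X) (hr : Set.range ((U t).ι ≫ r) ⊆ Set.range (U s).ι)
    (hr' : Set.range (f ≫ r) ⊆ Set.range (U s).ι) :
    IsOpenImmersion.lift (U t).ι f hf ≫ toSigma U s ((U t).ι ≫ r) hr =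
      toSigma U s (f ≫ r) hr' := by
  rw [toSigma, toSigma, ← Category.assoc]
  congr 1
  rw [← cancel_mono (U s).ι, Category.assoc, IsOpenImmersion.lift_fac, IsOpenImmersion.lift_fac,
    IsOpenImmersion.lift_fac_assoc]

end Sigma

section SigmaAction

variable {X : Action Scheme.{u} G} {τ : Type*} [Finite τ] [MulAction G τ] {U : τ → X.V.Opens}
  (hU : ∀ (g : G) (t : τ), X.ρ g ⁻¹ᵁ U (g • t) = U t)

/-- The disjoint union of a finite family of open subsets which is permuted by the group. -/
def sigmaAction : Action Scheme.{u} G where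
  V := ∐ fun t => (U t : Scheme.{u})
  ρ :=
    { toFun g := Sigma.desc fun t => toSigma U (g • t) ((U t).ι ≫ X.ρ g)
        (range_ι_comp_subset _ (hU g t))
      map_one' := by
        apply Sigma.hom_ext
        intro t
        rw [Sigma.ι_desc]
        refine (toSigma_congr U (one_smul G t) ?_ _ le_rfl).trans ((toSigma_ι U t).trans ?_)
        · rw [show X.ρ 1 = 𝟙 X.V from map_one X.ρ]
          exact Category.comp_id _
        · exact (Category.comp_id _).symm
      map_mul' g h := by
        apply Sigma.hom_ext
        intro t
        change _ = _ ≫ (Sigma.desc _ ≫ Sigma.desc _)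
        rw [Sigma.ι_desc, Sigma.ι_desc_assoc, toSigma_desc]
        refine Eq.trans ?_ (lift_toSigma U _ _ (X.ρ g) (range_ι_comp_subset _ (hU g _)) ?_).symm
        · apply toSigma_congr _ (mul_smul g h t)
          rw [ρ_mul, Category.assoc]
        · rw [Category.assoc, ← ρ_mul, smul_smul]
          exact range_ι_comp_subset _ (hU _ _) }

/-- The equivariant morphism from the disjoint union which is the inclusion on each member. -/
def sigmaActionDesc : sigmaAction hU ⟶ X where
  hom := Sigma.desc fun t => (U t).ι
  comm g := by
    apply Sigma.hom_ext
    intro t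
    change _ ≫ Sigma.desc (fun t => toSigma U (g • t) ((U t).ι ≫ X.ρ g) _) ≫ _ =
      _ ≫ Sigma.desc (fun t => (U t).ι) ≫ _
    rw [Sigma.ι_desc_assoc, Sigma.ι_desc_assoc, toSigma_desc, IsOpenImmersion.lift_fac]

lemma isLocalIso_sigmaActionDesc : IsLocalIso (sigmaActionDesc hU).hom :=
  IsZariskiLocalAtSource.sigmaDesc (P := @IsLocalIso) fun _ =>
    ⟨fun _ => ⟨⊤, trivial, inferInstance⟩⟩

lemma sigmaActionDesc_ι_apply (t : τ) (x : (U t : Scheme.{u})) :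
    (sigmaActionDesc hU).hom (Sigma.ι (fun t => (U t : Scheme.{u})) t x) = x.1 := by
  change (Sigma.desc fun t => (U t).ι) (Sigma.ι (fun t => (U t : Scheme.{u})) t x) = _
  rw [← Scheme.Hom.comp_apply, Sigma.ι_desc]
  rfl

lemma exists_sigma_ι_eq (y : (sigmaAction hU).V) : ∃ (t : τ) (x : U t),
    Sigma.ι (fun t => (U t : Scheme.{u})) t x = y ∧ (sigmaActionDesc hU).hom y = x.1 := by
  obtain ⟨t, x, rfl⟩ : ∃ (t : τ) (x : (U t : Scheme.{u})),
      Sigma.ι (fun t => (U t : Scheme.{u})) t x = y :=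
    (sigmaOpenCover fun t => (U t : Scheme.{u})).exists_eq y
  exact ⟨t, x, rfl, sigmaActionDesc_ι_apply hU t x⟩

lemma range_sigmaActionDesc : Set.range (sigmaActionDesc hU).hom = ⋃ t, (U t : Set X.V) := by
  ext x
  rw [Set.mem_iUnion]
  constructor
  · rintro ⟨y, rfl⟩
    obtain ⟨t, x, -, hx⟩ := exists_sigma_ι_eq hU y
    exact ⟨t, hx ▸ x.2⟩
  · rintro ⟨t, hx⟩
    exact ⟨_, sigmaActionDesc_ι_apply hU t ⟨x, hx⟩⟩

lemma injOn_sigmaActionDesc {C : Set X.V}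
    (hC : ∀ x ∈ C, ∀ t t', x ∈ U t → x ∈ U t' → t = t') :
    Set.InjOn (sigmaActionDesc hU).hom ((sigmaActionDesc hU).hom ⁻¹' C) := by
  intro y hy y' _ hyy'
  obtain ⟨t, x, rfl, hx⟩ := exists_sigma_ι_eq hU y
  obtain ⟨t', x', rfl, hx'⟩ := exists_sigma_ι_eq hU y'
  have hxx' : x.1 = x'.1 := by rw [← hx, ← hx', hyy']
  obtain rfl : t = t' := hC x.1 (hx ▸ hy) t t' x.2 (hxx' ▸ x'.2)
  rw [Subtype.ext hxx']

end SigmaAction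

/-! ### The stratification of an open cover -/

section Strata

variable {X : Scheme.{u}} {K : Type*} (V : K → X.Opens)

/-- The intersection of the members of a family of open subsets with indices in `T`. -/
def interOpen (T : Finset K) : X.Opens := T.inf V

/-- The set of points contained in at least `n` members of a family of open subsets. -/
def stratumOpen (n : ℕ) : X.Opens :=
  ⨆ T : {T : Finset K // n ≤ T.card}, interOpen V T.1

variable {V}

lemma mem_interOpen {T : Finset K} {x : X} : x ∈ interOpen V T ↔ ∀ k ∈ T, x ∈ V k := by
  rw [interOpen, ← SetLike.mem_coe, TopologicalSpace.Opens.coe_finset_inf, Finset.inf_eq_iInf]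
  simp

lemma mem_stratumOpen {n : ℕ} {x : X} :
    x ∈ stratumOpen V n ↔ ∃ T : Finset K, n ≤ T.card ∧ x ∈ interOpen V T := by
  simp [stratumOpen]

lemma stratumOpen_succ_le (n : ℕ) : stratumOpen V (n + 1) ≤ stratumOpen V n := fun x hx => by
  obtain ⟨T, hT, h⟩ := mem_stratumOpen.mp hx
  exact mem_stratumOpen.mpr ⟨T, (Nat.le_succ n).trans hT, h⟩

lemma coe_stratumOpen_eq_iUnion (n : ℕ) :
    (stratumOpen V n : Set X) = ⋃ T : Set.powersetCard K n, (interOpen V T.1 : Set X) := by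
  ext x
  rw [Set.mem_iUnion, SetLike.mem_coe, mem_stratumOpen]
  constructor
  · rintro ⟨T, hT, hx⟩
    obtain ⟨T', hT', hcard⟩ := Finset.exists_subset_card_eq hT
    exact ⟨⟨T', hcard⟩, mem_interOpen.mpr fun k hk => mem_interOpen.mp hx k (hT' hk)⟩
  · rintro ⟨T, hx⟩
    exact ⟨T.1, T.2.ge, hx⟩

lemma stratumOpen_one_eq_top (hV : ⨆ k, V k = ⊤) : stratumOpen V 1 = ⊤ := by
  rw [eq_top_iff, ← hV]
  exact iSup_le fun k x hx => mem_stratumOpen.mpr ⟨{k}, by simp, by simpa [interOpen] using hx⟩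

lemma le_card_of_mem_stratumOpen [Finite K] {n : ℕ} {x : X} (hx : x ∈ stratumOpen V n) :
    n ≤ Nat.card K := by
  obtain ⟨T, hT, -⟩ := mem_stratumOpen.mp hx
  have := Fintype.ofFinite K
  exact hT.trans (T.card_le_univ.trans_eq Nat.card_eq_fintype_card.symm)

lemma eq_of_mem_interOpen_of_notMem_stratumOpen {n : ℕ} {x : X} (hx : x ∉ stratumOpen V (n + 1))
    {T T' : Set.powersetCard K n} (hT : x ∈ interOpen V T.1) (hT' : x ∈ interOpen V T'.1) :
    T = T' := by
  classical
  by_contra hne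
  refine hx (mem_stratumOpen.mpr ⟨T.1 ∪ T'.1, ?_, mem_interOpen.mpr fun k hk => ?_⟩)
  · refine T.2.symm.trans_lt (Finset.card_lt_card ?_)
    refine Finset.subset_union_left.ssubset_of_ne fun h => ?_
    refine hne (Set.powersetCard.eq_iff_subset.mpr ?_).symm
    exact Finset.subset_union_right.trans h.symm.subset
  · rcases Finset.mem_union.mp hk with hk | hk
    · exact mem_interOpen.mp hT k hk
    · exact mem_interOpen.mp hT' k hk

lemma isAffineOpen_interOpen [IsAffineHom (pullback.diagonal (terminal.from X))]
    (hV : ∀ k, IsAffineOpen (V k)) {T : Finset K} (hT : T.Nonempty) :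
    IsAffineOpen (interOpen V T) := by
  have := IsAffineOpen.biInf (T : Set K) T.finite_toSet hT (U := V) fun k _ => hV k
  rwa [interOpen, Finset.inf_eq_iInf]

lemma isCompact_stratumOpen [Finite K] [IsAffineHom (pullback.diagonal (terminal.from X))]
    (hV : ∀ k, IsAffineOpen (V k)) {n : ℕ} (hn : n ≠ 0) :
    IsCompact (stratumOpen V n : Set X) := by
  rw [coe_stratumOpen_eq_iUnion]
  refine isCompact_iUnion fun T => (isAffineOpen_interOpen hV ?_).isCompact
  exact Set.powersetCard.coe_nonempty_iff.mpr (Nat.one_le_iff_ne_zero.mpr hn)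

lemma quasiSeparatedSpace_of_isAffineHom_diagonal (X : Scheme.{u})
    [IsAffineHom (pullback.diagonal (terminal.from X))] : QuasiSeparatedSpace X := by
  have : QuasiSeparated (terminal.from X) := ⟨inferInstance⟩
  exact (quasiSeparatedSpace_iff_quasiSeparated X).mpr this

end Strata

section EquivariantStrata

open scoped Pointwise

variable {X : Action Scheme.{u} G} {K : Type*} [MulAction G K]
  {V : K → X.V.Opens} (hV : ∀ (g : G) (k : K), X.ρ g ⁻¹ᵁ V (g • k) = V k)

include hV in
lemma preimage_interOpen [DecidableEq K] (g : G) (T : Finset K) :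
    X.ρ g ⁻¹ᵁ interOpen V (g • T) = interOpen V T := by
  ext x
  let r : X.V ⟶ X.V := X.ρ g
  change r x ∈ interOpen V (g • T) ↔ x ∈ interOpen V T
  have mem_smul (k : K) : r x ∈ V (g • k) ↔ x ∈ V k := by rw [← hV g k]; rfl
  rw [mem_interOpen, mem_interOpen, Finset.smul_finset_def, Finset.forall_mem_image]
  exact forall₂_congr fun k _ => mem_smul k

include hV in
lemma preimage_stratumOpen (n : ℕ) (g : G) :
    X.ρ g ⁻¹ᵁ stratumOpen V n = stratumOpen V n := by
  classical
  rw [stratumOpen, Scheme.Hom.preimage_iSup]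
  apply le_antisymm
  · refine iSup_le fun T => ?_
    refine le_iSup_of_le ⟨g⁻¹ • T.1, by rw [Finset.card_smul_finset]; exact T.2⟩ ?_
    rw [← preimage_interOpen hV g (g⁻¹ • T.1), smul_inv_smul]
  · refine iSup_le fun T => ?_
    refine le_iSup_of_le ⟨g • T.1, by rw [Finset.card_smul_finset]; exact T.2⟩ ?_
    rw [preimage_interOpen hV g]

/-- The `G`-scheme of points contained in at least `n` members of a family of open subsets which
is permuted by the group. -/
abbrev stratum (n : ℕ) : Action Scheme.{u} G :=
  invariantOpen X (stratumOpen V n) (preimage_stratumOpen hV n)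

/-- The inclusion of a stratum. -/
abbrev stratumι (n : ℕ) : stratum hV n ⟶ X := invariantOpenι (preimage_stratumOpen hV n)

lemma range_stratumι_succ_subset (n : ℕ) :
    Set.range (stratumι hV (n + 1)).hom ⊆ stratumOpen V n := by
  rw [range_invariantOpenι]
  exact stratumOpen_succ_le n

variable [Finite K] [DecidableEq K]

/-- The disjoint union of the intersections of `n` members of a family of open subsets which is
permuted by the group. -/
abbrev stratumCover (n : ℕ) : Action Scheme.{u} G :=
  sigmaAction (U := fun T : Set.powersetCard K n => interOpen V T.1)
    fun g T => preimage_interOpen hV g T.1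

/-- The morphism to `X` from the disjoint union of the intersections of `n` open subsets. -/
abbrev stratumCoverDesc (n : ℕ) : stratumCover hV n ⟶ X :=
  sigmaActionDesc (U := fun T : Set.powersetCard K n => interOpen V T.1)
    fun g T => preimage_interOpen hV g T.1

instance (n : ℕ) : IsLocalIso (stratumCoverDesc hV n).hom := isLocalIso_sigmaActionDesc _

lemma range_stratumCoverDesc (n : ℕ) :
    Set.range (stratumCoverDesc hV n).hom = stratumOpen V n := by
  rw [coe_stratumOpen_eq_iUnion]
  exact range_sigmaActionDesc _

lemma bijOn_stratumCoverDesc (n : ℕ) :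
    Set.BijOn (stratumCoverDesc hV n).hom
      ((stratumCoverDesc hV n).hom ⁻¹' (stratumOpen V n \ stratumOpen V (n + 1)))
      (stratumOpen V n \ stratumOpen V (n + 1)) := by
  refine ⟨fun _ hy => hy, ?_, ?_⟩
  · exact injOn_sigmaActionDesc _ fun x hx T T' hT hT' =>
      eq_of_mem_interOpen_of_notMem_stratumOpen hx.2 hT hT'
  · rw [← range_stratumCoverDesc hV n]
    rintro x hx
    obtain ⟨y, rfl⟩ := hx.1
    exact ⟨y, hx, rfl⟩

variable [IsAffineHom (pullback.diagonal (terminal.from X.V))] (hV' : ∀ k, IsAffineOpen (V k))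

include hV' in
lemma isAffine_stratumCover {n : ℕ} (hn : n ≠ 0) : IsAffine (stratumCover hV n).V := by
  have (T : Set.powersetCard K n) : IsAffine (interOpen V T.1 : Scheme.{u}) :=
    isAffineOpen_interOpen hV'
      (Set.powersetCard.coe_nonempty_iff.mpr (Nat.one_le_iff_ne_zero.mpr hn))
  exact inferInstanceAs (IsAffine (∐ fun T : Set.powersetCard K n =>
    (interOpen V T.1 : Scheme.{u})))

include hV' in
lemma isDistinguished_stratum {n : ℕ} (hn : n ≠ 0) :
    IsDistinguished
      (invariantOpenLift (preimage_stratumOpen hV n) (stratumι hV (n + 1))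
        (range_stratumι_succ_subset hV n))
      (invariantOpenLift (preimage_stratumOpen hV n) (stratumCoverDesc hV n)
        (range_stratumCoverDesc hV n).le) := by
  have := quasiSeparatedSpace_of_isAffineHom_diagonal X.V
  have := isAffine_stratumCover hV hV' hn
  have : CompactSpace (stratum hV (n + 1)).V :=
    isCompact_iff_compactSpace.mp (isCompact_stratumOpen hV' n.succ_ne_zero)
  apply isDistinguished_invariantOpenLift
  rw [range_invariantOpenι]
  exact bijOn_stratumCoverDesc hV n

/-- The family of the `stratumCover hV n` with `1 ≤ n ≤ Nat.card K`. -/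
abbrev stratumCovers : ULift.{u} (Fin (Nat.card K)) → Action Scheme.{u} G :=
  fun n => stratumCover hV (n.down + 1)

include hV' in
lemma pullback_ofArrows_stratumCovers_mem {J : GrothendieckTopology (Action Scheme.{u} G)}
    (hJ : ∀ {X A Y : Action Scheme.{u} G} (i : A ⟶ X) (p : Y ⟶ X), IsDistinguished i p →
      Sieve.generate (Presieve.singleton i ⊔ Presieve.singleton p) ∈ J X)
    (hJ' : ∀ X : Action Scheme.{u} G, IsEmpty X.V → (⊥ : Sieve X) ∈ J X) {n : ℕ}
    (hn : n ≤ Nat.card K) :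
    (Sieve.ofArrows (stratumCovers hV) fun n => stratumCoverDesc hV (n.down + 1)).pullback
      (stratumι hV (n + 1)) ∈ J (stratum hV (n + 1)) := by
  induction hn using Nat.decreasingInduction with
  | self =>
    refine J.superset_covering bot_le (hJ' _ ⟨fun x => ?_⟩)
    exact (le_card_of_mem_stratumOpen x.2).not_gt (Nat.lt_succ_self _)
  | of_succ n hn ih =>
    have hmem : Sieve.ofArrows (stratumCovers hV) (fun n => stratumCoverDesc hV (n.down + 1))
        (stratumCoverDesc hV (n + 1)) :=
      Sieve.ofArrows_mk _ _ (⟨⟨n, hn⟩⟩ : ULift.{u} (Fin (Nat.card K)))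
    refine J.transitive (hJ _ _ (isDistinguished_stratum hV hV' n.succ_ne_zero)) _ ?_
    change Sieve.generate _ ≤ J.close _
    rw [Sieve.generate_le_iff]
    rintro Y f (⟨⟨⟩⟩ | ⟨⟨⟩⟩)
    · change Sieve.pullback _ _ ∈ J _
      rw [← Sieve.pullback_comp, invariantOpenLift_ι]
      exact ih
    · change Sieve.pullback _ _ ∈ J _
      rw [← Sieve.pullback_comp, invariantOpenLift_ι, (Sieve.mem_iff_pullback_eq_top _).mp hmem]
      exact J.top_mem _

include hV' in
theorem isNisnevichCover_stratumCovers (hcov : ⨆ k, V k = ⊤) :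
    IsNisnevichCover (stratumCovers hV) fun n => stratumCoverDesc hV (n.down + 1) := by
  have := quasiSeparatedSpace_of_isAffineHom_diagonal X.V
  have haff (n : ULift.{u} (Fin (Nat.card K))) : IsAffine (stratumCovers hV n).V :=
    isAffine_stratumCover hV hV' n.down.1.succ_ne_zero
  refine ⟨fun n => etale_of_isLocalIso _, fun n => ?_, fun n => ?_, ?_⟩
  · have := haff n
    have : IsSeparated ((stratumCoverDesc hV (n.down + 1)).hom ≫ terminal.from _) := by
      rw [terminal.comp_from]; infer_instance
    exact IsSeparated.of_comp _ (terminal.from _)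
  · have := haff n
    infer_instance
  · rw [nisnevichTopology, GrothendieckTopology.mem_sInf]
    rintro J ⟨hJ, hJ'⟩
    have : IsIso (stratumι hV 1).hom := by
      apply isIso_of_isOpenImmersion_of_opensRange_eq_top
      ext1
      rw [Scheme.Hom.coe_opensRange, range_invariantOpenι, stratumOpen_one_eq_top hcov]
    have : IsIso (stratumι hV 1) := Action.isIso_of_hom_isIso _
    exact J.pullback_mem_iff_of_isIso.mp
      (pullback_ofArrows_stratumCovers_mem hV hV' hJ hJ' (Nat.zero_le _))

end EquivariantStrata

/-! ### The affine `N`-affine bundle -/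

section Translates

/-- The index set `G × A` of the translates of a family of open subsets of a `G`-scheme indexed by
`A`; here `(k, a)` stands for the preimage of the `a`-th open subset under `k`. -/
def TranslateIndex (G : Type v) (A : Type u) : Type (max u v) := G × A

instance [Finite G] (A : Type u) [Finite A] : Finite (TranslateIndex G A) :=
  inferInstanceAs (Finite (G × A))

instance (A : Type u) : MulAction G (TranslateIndex G A) where
  smul g k := (k.1 * g⁻¹, k.2)
  one_smul k := Prod.ext ((congrArg (k.1 * ·) inv_one).trans (mul_one k.1)) rfl
  mul_smul g h k := Prod.ext (by
    change k.1 * (g * h)⁻¹ = k.1 * h⁻¹ * g⁻¹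
    rw [mul_inv_rev, mul_assoc]) rfl

instance (X : Action Scheme.{u} G) (g : G) : IsIso (X.ρ g) := by
  refine ⟨X.ρ g⁻¹, ?_, ?_⟩
  · exact (ρ_mul X _ _).symm.trans (by rw [inv_mul_cancel]; exact map_one X.ρ)
  · exact (ρ_mul X _ _).symm.trans (by rw [mul_inv_cancel]; exact map_one X.ρ)

theorem exists_isNisnevichCover_isAffine [Finite G] (X : Action Scheme.{u} G)
    [IsAffineHom (pullback.diagonal (terminal.from X.V))] {A : Type u} [Finite A]
    (U : A → X.V.Opens) (hU : ∀ a, IsAffineOpen (U a)) (hcov : ⨆ a, U a = ⊤) :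
    ∃ (ι : Type u) (Y : ι → Action Scheme.{u} G) (f : ∀ i, Y i ⟶ X),
      IsNisnevichCover Y f ∧ ∀ i, IsAffine (Y i).V := by
  classical
  let V (k : TranslateIndex G A) : X.V.Opens := X.ρ k.1 ⁻¹ᵁ U k.2
  have hV (g : G) (k : TranslateIndex G A) : X.ρ g ⁻¹ᵁ V (g • k) = V k := by
    change X.ρ g ⁻¹ᵁ X.ρ (k.1 * g⁻¹) ⁻¹ᵁ U k.2 = X.ρ k.1 ⁻¹ᵁ U k.2
    rw [← Scheme.Hom.comp_preimage, ← ρ_mul, inv_mul_cancel_right]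
  have hV' (k : TranslateIndex G A) : IsAffineOpen (V k) := (hU k.2).preimage (X.ρ k.1)
  have hVcov : ⨆ k, V k = ⊤ := by
    rw [eq_top_iff, ← hcov]
    refine iSup_le fun a => le_iSup_of_le (1, a) ?_
    change _ ≤ X.ρ 1 ⁻¹ᵁ U a
    rw [show X.ρ 1 = 𝟙 X.V from map_one X.ρ, Scheme.Hom.id_preimage]
  exact ⟨_, _, _, isNisnevichCover_stratumCovers hV hV' hVcov, fun n =>
    isAffine_stratumCover hV hV' n.down.1.succ_ne_zero⟩

end Translates

theorem exists_isNAffineBundle_of_ampleCocycle [Finite G] (X : Action Scheme.{u} G) {A I : Type u}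
    [Finite A] [Finite I] (d : AmpleCocycle X.V A I) :
    ∃ (W : Action Scheme.{u} G) (π : W ⟶ X), IsNAffineBundle π ∧ IsAffine W.V := by
  have := d.isAffineHom_diagonal
  obtain ⟨W, π, hW, H⟩ := exists_isGVectorBundle_pullback X d
  obtain ⟨ι, Y, f, hf, hY⟩ := exists_isNisnevichCover_isAffine X d.U d.isAffineOpen_U d.iSup_U
  exact ⟨W, π, ⟨ι, Y, f, hf, fun i => H (Y i) (f i) (hY i)⟩, hW⟩

end NAffineBundle

/-! ### Ample families give cocycles -/

section LineBundle

variable {X : Scheme.{u}} {L : X.Modules}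

theorem res_smul {U V : X.Opens} (h : V ≤ U) (a : Γ(X, U)) (e : Γ(L, U)) :
    res h (a • e) = resFn h a • res h e := L.map_smul (homOfLE h) a e

theorem res_res {U V W : X.Opens} (h : V ≤ U) (h' : W ≤ V) (e : Γ(L, U)) :
    res h' (res h e) = res (h'.trans h) e := by
  have := L.presheaf.map_comp (homOfLE h).op (homOfLE h').op
  exact congr($(this.symm) e)

theorem res_self {U : X.Opens} (h : U ≤ U) (e : Γ(L, U)) : res h e = e :=
  congr($(L.presheaf.map_id _) e)

namespace IsFreeGenerator

theorem restrict {U V : X.Opens} {e : Γ(L, U)} (he : IsFreeGenerator e) (h : V ≤ U) :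
    IsFreeGenerator (res h e) := by
  intro W hW
  simp only [res_res]
  exact he W _

theorem smul {U : X.Opens} {e : Γ(L, U)} (he : IsFreeGenerator e) {a : Γ(X, U)} (ha : IsUnit a) :
    IsFreeGenerator (a • e) := by
  intro W hW
  have hu := ha.map (resFn hW)
  simp only [res_smul, smul_smul]
  exact (he W hW).comp (IsUnit.isUnit_iff_mulRight_bijective.mp hu)

theorem eq_of_smul_eq {U V : X.Opens} {e : Γ(L, U)} (he : IsFreeGenerator e) (h : V ≤ U)
    {a b : Γ(X, V)} (hab : a • res h e = b • res h e) : a = b :=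
  (he V h).1 hab

theorem exists_smul_eq {U : X.Opens} {e : Γ(L, U)} (he : IsFreeGenerator e) (x : Γ(L, U)) :
    ∃ a : Γ(X, U), a • e = x := by
  obtain ⟨a, ha⟩ := (he U le_rfl).2 x
  exact ⟨a, by simpa only [res_self] using ha⟩

theorem transition_mul {U V W : X.Opens} {e : Γ(L, U)} {e' : Γ(L, V)} {e'' : Γ(L, W)}
    (he : IsFreeGenerator e) {a : Γ(X, U ⊓ V)} {b : Γ(X, V ⊓ W)} {c : Γ(X, U ⊓ W)}
    (ha : a • res inf_le_left e = res inf_le_right e')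
    (hb : b • res inf_le_left e' = res inf_le_right e'')
    (hc : c • res inf_le_left e = res inf_le_right e'') :
    resFn (inf_le_left : U ⊓ V ⊓ W ≤ U ⊓ V) a *
      resFn (le_inf (inf_le_left.trans inf_le_right) inf_le_right) b =
        resFn (le_inf (inf_le_left.trans inf_le_left) inf_le_right) c := by
  apply he.eq_of_smul_eq (inf_le_left.trans inf_le_left : U ⊓ V ⊓ W ≤ U)
  have ha' := congr(res (inf_le_left : U ⊓ V ⊓ W ≤ U ⊓ V) $ha)
  have hb' := congr(res (le_inf (inf_le_left.trans inf_le_right) inf_le_right :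
    U ⊓ V ⊓ W ≤ V ⊓ W) $hb)
  have hc' := congr(res (le_inf (inf_le_left.trans inf_le_left) inf_le_right :
    U ⊓ V ⊓ W ≤ U ⊓ W) $hc)
  simp only [res_smul, res_res] at ha' hb' hc'
  rw [mul_comm, mul_smul, ha', hb', hc']

theorem coord_eq_transition_mul {U V : X.Opens} {e : Γ(L, U)} {e' : Γ(L, V)}
    (he : IsFreeGenerator e) {s : Γ(L, ⊤)} {a : Γ(X, U)} {b : Γ(X, V)} {g : Γ(X, U ⊓ V)}
    (ha : a • e = res le_top s) (hb : b • e' = res le_top s)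
    (hg : g • res inf_le_left e = res inf_le_right e') :
    resFn inf_le_left a = g * resFn inf_le_right b := by
  apply he.eq_of_smul_eq (inf_le_left : U ⊓ V ≤ U)
  rw [← res_smul, ha, mul_comm, mul_smul, hg, ← res_smul, hb, res_res, res_res]

theorem nonvanishingLocus_inf {U : X.Opens} {e : Γ(L, U)} (he : IsFreeGenerator e) {s : Γ(L, ⊤)}
    {a : Γ(X, U)} (ha : a • e = res le_top s) : nonvanishingLocus s ⊓ U = X.basicOpen a := by
  apply le_antisymm
  · rintro x ⟨hx, hxU⟩
    obtain ⟨V, hV, hxV⟩ := TopologicalSpace.Opens.mem_sSup.mp hx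
    obtain ⟨c, hc⟩ := (hV.restrict (inf_le_left : V ⊓ U ≤ V)).exists_smul_eq (res inf_le_right e)
    have hmul : c * resFn (inf_le_right : V ⊓ U ≤ U) a = 1 := by
      apply he.eq_of_smul_eq (inf_le_right : V ⊓ U ≤ U)
      rw [mul_smul, ← res_smul, ha, one_smul, ← hc, res_res, res_res]
    have hbasic := X.basicOpen_of_isUnit (IsUnit.of_mul_eq_one_right c hmul)
    rw [basicOpen_resFn] at hbasic
    exact (hbasic.ge ⟨hxV, hxU⟩).2
  · refine le_inf (le_sSup ?_) (X.basicOpen_le a)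
    have hunit : IsUnit (resFn (X.basicOpen_le a) a) := RingedSpace.isUnit_res_basicOpen _ a
    have hgen := (he.restrict (X.basicOpen_le a)).smul hunit
    rwa [← res_smul, ha, res_res] at hgen

end IsFreeGenerator

end LineBundle

theorem exists_finset_iSup_eq_top {X : Scheme.{u}} [CompactSpace X] {O : X → X.Opens}
    (hO : ∀ x, x ∈ O x) : ∃ S : Finset X, ⨆ x : S, O x = ⊤ := by
  obtain ⟨S, hS⟩ := isCompact_univ.elim_finite_subcover (fun x => (O x : Set X))
    (fun x => (O x).isOpen) fun x _ => Set.mem_iUnion.mpr ⟨x, hO x⟩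
  refine ⟨S, top_le_iff.mp fun x _ => ?_⟩
  obtain ⟨y, hy, hxy⟩ := Set.mem_iUnion₂.mp (hS (Set.mem_univ x))
  exact TopologicalSpace.Opens.mem_iSup.mpr ⟨⟨y, hy⟩, hxy⟩

theorem exists_isAffineOpen_isFreeGenerator {X : Scheme.{u}} {I : Type*} [Finite I]
    {L : I → X.Modules} (hL : ∀ i, IsLineBundle (L i)) (x : X) :
    ∃ U : X.Opens, x ∈ U ∧ IsAffineOpen U ∧ ∀ i, ∃ e : Γ(L i, U), IsFreeGenerator e := by
  choose O hxO e he using fun i => hL i x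
  obtain ⟨_, ⟨U, hU, rfl⟩, hxU, hUO⟩ := X.isBasis_affineOpens.exists_subset_of_mem_open
    (Set.mem_iInter.mpr hxO) (isOpen_iInter_of_finite fun i => (O i).isOpen)
  exact ⟨U, hxU, hU, fun i => ⟨_, (he i).restrict fun y hy => Set.mem_iInter.mp (hUO hy) i⟩⟩

theorem nonempty_ampleCocycle_of_isFreeGenerator {X : Scheme.{u}} {A I : Type u}
    {L : I → X.Modules} {s : ∀ i, Γ(L i, ⊤)} (hs : ∀ i, IsAffineOpen (nonvanishingLocus (s i)))
    (hcov : ⨆ i, nonvanishingLocus (s i) = ⊤) {U : A → X.Opens} (hU : ∀ a, IsAffineOpen (U a))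
    (hUcov : ⨆ a, U a = ⊤) {e : ∀ a i, Γ(L i, U a)} (he : ∀ a i, IsFreeGenerator (e a i)) :
    Nonempty (AmpleCocycle X A I) := by
  choose σ hσ using fun i a => (he a i).exists_smul_eq (res (le_top : U a ≤ ⊤) (s i))
  choose g hg using fun i a b =>
    ((he a i).restrict (inf_le_left : U a ⊓ U b ≤ _)).exists_smul_eq (res inf_le_right (e b i))
  exact ⟨{
    U := U
    isAffineOpen_U := hU
    iSup_U := hUcov
    s := σ
    g := g
    g_self i a := (he a i).eq_of_smul_eq inf_le_left ((hg i a a).trans (one_smul _ _).symm)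
    g_mul i a b c := (he a i).transition_mul (hg i a b) (hg i b c) (hg i a c)
    s_eq i a b := (he a i).coord_eq_transition_mul (hσ i a) (hσ i b) (hg i a b)
    D i := nonvanishingLocus (s i)
    isAffineOpen_D := hs
    iSup_D := hcov
    D_inf i a := (he a i).nonvanishingLocus_inf (hσ i a) }⟩

theorem HasAmpleFamily.exists_ampleCocycle {X : Scheme.{u}} (h : HasAmpleFamily X) :
    ∃ (A I : Type u) (_ : Finite A) (_ : Finite I), Nonempty (AmpleCocycle X A I) := by
  obtain ⟨_, ι, L, hL, H⟩ := h
  choose k s hmem haff using H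
  obtain ⟨I, hI⟩ := exists_finset_iSup_eq_top hmem
  choose U hxU hU e he using exists_isAffineOpen_isFreeGenerator fun i : I => hL (k i)
  obtain ⟨A, hA⟩ := exists_finset_iSup_eq_top hxU
  exact ⟨A, I, inferInstance, inferInstance,
    nonempty_ampleCocycle_of_isFreeGenerator (fun i : I => haff i) hI (fun a : A => hU a) hA
      fun a => he a⟩

/-! ### Regular local rings are domains -/

section RegularLocal

open IsLocalRing

theorem exists_generators_of_notMem_sq {R : Type u} [CommRing R] [IsLocalRing R]
    [IsNoetherianRing R] {x : R} (hx : x ∈ maximalIdeal R) (hx2 : x ∉ maximalIdeal R ^ 2) :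
    ∃ (n : ℕ) (t : Fin n → R), n + 1 = (maximalIdeal R).spanFinrank ∧
      maximalIdeal R = Ideal.span (insert x (Set.range t)) := by
  let xb : CotangentSpace R := (maximalIdeal R).toCotangent ⟨x, hx⟩
  let K := Submodule.span (ResidueField R) {xb}
  have hxb : xb ≠ 0 := fun h => hx2 ((Ideal.toCotangent_eq_zero _ _).1 h)
  let b := Module.finBasis (ResidueField R) (CotangentSpace R ⧸ K)
  have hn : Module.finrank (ResidueField R) (CotangentSpace R ⧸ K) + 1 =
      (maximalIdeal R).spanFinrank := by
    rw [spanFinrank_maximalIdeal_eq_finrank_cotangentSpace,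
      ← finrank_span_singleton (K := ResidueField R) hxb, Submodule.finrank_quotient_add_finrank]
  choose t ht using fun i =>
    (K.mkQ_surjective.comp (maximalIdeal R).toCotangent_surjective) (b i)
  refine ⟨_, fun i => (t i : R), hn, ?_⟩
  have hspan : Submodule.span R (insert ⟨x, hx⟩ (Set.range t)) =
      (⊤ : Submodule R (maximalIdeal R)) := by
    rw [← CotangentSpace.span_image_eq_top_iff, Set.image_insert_eq, Submodule.span_insert,
      ← Set.range_comp, ← Submodule.map_mkQ_eq_top (p := K), Submodule.map_span, ← Set.range_comp]
    exact (congrArg (Submodule.span (ResidueField R)) (congrArg Set.range (funext ht))).trans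
      b.span_eq
  have := congrArg (Submodule.map (Submodule.subtype _)) hspan
  rw [Submodule.map_span, Submodule.map_top, Submodule.range_subtype, Set.image_insert_eq,
    ← Set.range_comp] at this
  exact this.symm

instance isLocalRing_quotient_span_singleton {R : Type u} [CommRing R] [IsLocalRing R]
    (x : maximalIdeal R) : IsLocalRing (R ⧸ Ideal.span {(x : R)}) :=
  have : Nontrivial (R ⧸ Ideal.span {(x : R)}) := Ideal.Quotient.nontrivial_iff.2 fun h =>
    (maximalIdeal.isMaximal R).ne_top
      (top_le_iff.1 (h ▸ (Ideal.span_singleton_le_iff_mem _).2 x.2))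
  .of_surjective' _ Ideal.Quotient.mk_surjective

theorem spanFinrank_maximalIdeal_quotient_add_one_le {R : Type u} [CommRing R] [IsLocalRing R]
    [IsNoetherianRing R] (x : maximalIdeal R) (hx : (x : R) ∉ maximalIdeal R ^ 2) :
    (maximalIdeal (R ⧸ Ideal.span {(x : R)})).spanFinrank + 1 ≤ (maximalIdeal R).spanFinrank := by
  obtain ⟨n, t, hn, hm⟩ := exists_generators_of_notMem_sq x.2 hx
  have hmap : maximalIdeal (R ⧸ Ideal.span {(x : R)}) =
      Ideal.span (Set.range (Ideal.Quotient.mk (Ideal.span {(x : R)}) ∘ t)) := by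
    refine (map_maximalIdeal_of_surjective _ Ideal.Quotient.mk_surjective).symm.trans
      ((congrArg (Ideal.map _) hm).trans ?_)
    rw [Ideal.map_span, Set.image_insert_eq, ← Set.range_comp,
      Ideal.Quotient.eq_zero_iff_mem.2 (Ideal.mem_span_singleton_self (x : R)),
      Ideal.span_insert_zero]
  rw [← hn, hmap]
  refine Nat.succ_le_succ
    ((Submodule.spanFinrank_span_le_ncard_of_finite (Set.finite_range _)).trans ?_)
  rw [← Set.image_univ]
  refine (Set.ncard_image_le Set.finite_univ).trans ?_
  rw [Set.ncard_univ, Nat.card_fin]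

theorem ringKrullDim_le_ringKrullDim_quotient_span_singleton_add_one {R : Type u} [CommRing R]
    [IsLocalRing R] [IsNoetherianRing R] (x : maximalIdeal R) :
    ringKrullDim R ≤ ringKrullDim (R ⧸ Ideal.span {(x : R)}) + 1 := by
  have := ringKrullDim_le_ringKrullDim_quotient_add_encard {(x : R)} (R := R)
    (by simp [ringJacobson_eq_maximalIdeal])
  rwa [Set.encard_singleton] at this

theorem isRegularLocalRing_quotient {R : Type u} [CommRing R] [IsRegularLocalRing R]
    (x : maximalIdeal R) (hx : (x : R) ∉ maximalIdeal R ^ 2) :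
    IsRegularLocalRing (R ⧸ Ideal.span {(x : R)}) ∧
      ringKrullDim (R ⧸ Ideal.span {(x : R)}) + 1 = ringKrullDim R := by
  have hrank : ((maximalIdeal (R ⧸ Ideal.span {(x : R)})).spanFinrank : WithBot ℕ∞) + 1 ≤
      ringKrullDim R := by
    rw [← IsRegularLocalRing.spanFinrank_maximalIdeal]
    exact_mod_cast spanFinrank_maximalIdeal_quotient_add_one_le x hx
  have hdim := ringKrullDim_le_ringKrullDim_quotient_span_singleton_add_one x
  have hreg : IsRegularLocalRing (R ⧸ Ideal.span {(x : R)}) :=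
    .of_spanFinrank_maximalIdeal_le _
      (ENat.WithBot.add_le_add_one_right_iff.1 (hrank.trans hdim))
  rw [IsRegularLocalRing.spanFinrank_maximalIdeal] at hrank
  exact ⟨hreg, hrank.antisymm hdim⟩

theorem maximalIdeal_eq_bot_of_ringKrullDim_eq_zero {R : Type u} [CommRing R]
    [IsRegularLocalRing R] (h : ringKrullDim R = 0) : maximalIdeal R = ⊥ := by
  rw [← IsRegularLocalRing.spanFinrank_maximalIdeal] at h
  exact (Submodule.spanFinrank_eq_zero_iff_eq_bot (IsNoetherian.noetherian _)).1
    (by exact_mod_cast h)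

theorem exists_mem_maximalIdeal_notMem_sq {R : Type u} [CommRing R] [IsRegularLocalRing R]
    (h : ringKrullDim R ≠ 0) (S : Finset (Ideal R)) (hS : ∀ p ∈ S, p.IsPrime)
    (hS' : ∀ p ∈ S, p ≠ maximalIdeal R) :
    ∃ x : maximalIdeal R, (x : R) ∉ maximalIdeal R ^ 2 ∧ ∀ p ∈ S, (x : R) ∉ p := by
  classical
  by_contra! H
  have hsub : (maximalIdeal R : Set R) ⊆
      ⋃ p ∈ ((insert (maximalIdeal R ^ 2) S : Finset (Ideal R)) : Set (Ideal R)), (p : Set R) := by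
    intro x hx
    simp only [Finset.coe_insert, Set.mem_insert_iff, Set.iUnion_iUnion_eq_or_left,
      Set.mem_union, Set.mem_iUnion, SetLike.mem_coe, exists_prop]
    exact or_iff_not_imp_left.mpr (H ⟨x, hx⟩)
  obtain ⟨p, hp, hle⟩ := (Ideal.subset_union_prime (f := id) (maximalIdeal R ^ 2)
    (maximalIdeal R ^ 2)
    (fun i hi h1 _ => hS i ((Finset.mem_insert.1 hi).resolve_left h1))).1 hsub
  rcases Finset.mem_insert.1 hp with rfl | hp
  · have hbot : maximalIdeal R = ⊥ := by
      refine Submodule.eq_bot_of_le_smul_of_le_jacobson_bot (maximalIdeal R) _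
        (IsNoetherian.noetherian _) ?_ (IsLocalRing.jacobson_eq_maximalIdeal _ bot_ne_top).ge
      rwa [smul_eq_mul, ← pow_two]
    exact h (by simp [← IsRegularLocalRing.spanFinrank_maximalIdeal, hbot])
  · exact hS' p hp ((le_maximalIdeal (hS p hp).ne_top).antisymm hle)

theorem isDomain_of_isPrime_span_singleton {R : Type u} [CommRing R] [IsLocalRing R]
    [IsNoetherianRing R] {x : R} (hx : x ∈ maximalIdeal R) (hprime : (Ideal.span {x}).IsPrime)
    (hmin : ∀ p ∈ minimalPrimes R, x ∉ p) : IsDomain R := by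
  obtain ⟨p, hp, hpx⟩ := Ideal.exists_minimalPrimes_le (bot_le : ⊥ ≤ Ideal.span {x})
  have hpp : p.IsPrime := hp.1.1
  have hle : p ≤ Ideal.span {x} • p := fun y hy => by
    obtain ⟨z, rfl⟩ := Ideal.mem_span_singleton'.1 (hpx hy)
    rw [mul_comm]
    exact Submodule.smul_mem_smul (Ideal.mem_span_singleton_self x)
      ((hpp.mem_or_mem hy).resolve_right (hmin p hp))
  have hbot : p = ⊥ := by
    refine Submodule.eq_bot_of_le_smul_of_le_jacobson_bot (Ideal.span {x}) _
      (IsNoetherian.noetherian _) hle ?_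
    rw [IsLocalRing.jacobson_eq_maximalIdeal _ bot_ne_top]
    exact (Ideal.span_singleton_le_iff_mem _).2 hx
  subst hbot
  exact IsDomain.of_bot_isPrime R

theorem isDomain_of_ringKrullDim_eq (n : ℕ) : ∀ {R : Type u} [CommRing R]
    [IsRegularLocalRing R], ringKrullDim R = n → IsDomain R := by
  induction n with
  | zero =>
    intro R _ _ h
    have : (⊥ : Ideal R).IsMaximal :=
      maximalIdeal_eq_bot_of_ringKrullDim_eq_zero h ▸ maximalIdeal.isMaximal R
    have := this.isPrime
    exact IsDomain.of_bot_isPrime R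
  | succ n ih =>
    intro R _ _ h
    have hne : ringKrullDim R ≠ 0 := by rw [h]; exact_mod_cast n.succ_ne_zero
    have hfin := minimalPrimes.finite_of_isNoetherianRing R
    obtain ⟨x, hx2, hxp⟩ := exists_mem_maximalIdeal_notMem_sq hne hfin.toFinset
      (fun p hp => (hfin.mem_toFinset.1 hp).1.1) (fun p hp hpm => hne (by
        have := (hfin.mem_toFinset.1 hp).1.1
        rw [← maximalIdeal_height_eq_ringKrullDim, ← hpm,
          Ideal.height_eq_zero_iff.2 (hfin.mem_toFinset.1 hp)]
        rfl))
    obtain ⟨hreg, hdim⟩ := isRegularLocalRing_quotient x hx2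
    have := ih (ENat.WithBot.add_one_cancel.1 (hdim.trans (h.trans (by push_cast; rfl))))
    exact isDomain_of_isPrime_span_singleton x.2 ((Ideal.Quotient.isDomain_iff_prime _).1 this)
      fun p hp => hxp p (hfin.mem_toFinset.2 hp)

theorem isDomain_of_isRegularLocalRing (R : Type u) [CommRing R] [IsRegularLocalRing R] :
    IsDomain R :=
  isDomain_of_ringKrullDim_eq _ (IsRegularLocalRing.spanFinrank_maximalIdeal (R := R)).symm

end RegularLocal

/-! ### Finite free resolutions over regular local rings -/

section Resolution

open IsLocalRing Pointwise

/-- The kernel at the end of any chain of `n` successive finite free covers starting from `M` is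
free. For finite modules over a Noetherian local ring this says that the projective dimension is at
most `n`; the form below, about all chains rather than some chain, is the one which passes from
`M / x M` over `R / x` to `M` over `R`. -/
def HasFreeSyzygy (R : Type u) [CommRing R] :
    ℕ → ∀ (M : Type u) [AddCommGroup M] [Module R M], Prop
  | 0, M, _, _ => Module.Free R M
  | n + 1, M, _, _ => ∀ (F : Type u) [AddCommGroup F] [Module R F] [Module.Free R F]
      [Module.Finite R F] (f : F →ₗ[R] M), Function.Surjective f →
        HasFreeSyzygy R n (LinearMap.ker f)

theorem HasFreeSyzygy.of_equiv {R : Type u} [CommRing R] {n : ℕ} {M N : Type u} [AddCommGroup M]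
    [Module R M] [AddCommGroup N] [Module R N] (e : M ≃ₗ[R] N) (h : HasFreeSyzygy R n M) :
    HasFreeSyzygy R n N := by
  cases n with
  | zero =>
    have : Module.Free R M := h
    exact Module.Free.of_equiv e
  | succ n =>
    intro F _ _ _ _ f hf
    have := h F (e.symm.toLinearMap ∘ₗ f) (e.symm.surjective.comp hf)
    rwa [LinearMap.ker_comp, LinearEquiv.ker, Submodule.comap_bot] at this

theorem exists_quotSMulTop_ker_equiv {R : Type u} [CommRing R] {x : R} {F M : Type u}
    [AddCommGroup F] [Module R F] [AddCommGroup M] [Module R M] (hreg : IsSMulRegular M x)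
    {f : F →ₗ[R] M} (hf : Function.Surjective f) :
    ∃ f' : QuotSMulTop x F →ₗ[R ⧸ Ideal.span {x}] QuotSMulTop x M, Function.Surjective f' ∧
      Nonempty (LinearMap.ker f' ≃ₗ[R ⧸ Ideal.span {x}] QuotSMulTop x (LinearMap.ker f)) := by
  have hs : Function.Surjective (algebraMap R (R ⧸ Ideal.span {x})) :=
    Ideal.Quotient.mk_surjective
  let f' := (QuotSMulTop.map x f).extendScalarsOfSurjective hs
  let g' := (QuotSMulTop.map x (LinearMap.ker f).subtype).extendScalarsOfSurjective hs
  have hex : Function.Exact (LinearMap.ker f).subtype f := LinearMap.exact_subtype_ker_map f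
  have hg' : Function.Injective g' := by
    have hzero : Function.Exact (0 : PUnit.{u+1} →ₗ[R] LinearMap.ker f)
        (LinearMap.ker f).subtype :=
      (LinearMap.exact_zero_iff_injective _ _).2 (Submodule.injective_subtype _)
    have := QuotSMulTop.map_first_exact_on_four_term_exact_of_isSMulRegular_last hzero hex hreg
    rw [map_zero] at this
    exact (LinearMap.exact_zero_iff_injective _ _).1 this
  have hex' : LinearMap.ker f' = LinearMap.range g' :=
    LinearMap.exact_iff.1 (QuotSMulTop.map_exact x hex hf : Function.Exact g' f')
  exact ⟨f', QuotSMulTop.map_surjective x hf,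
    ⟨((LinearEquiv.ofInjective g' hg').trans (LinearEquiv.ofEq _ _ hex'.symm)).symm⟩⟩

theorem HasFreeSyzygy.of_quotSMulTop {R : Type u} [CommRing R] [IsLocalRing R]
    [IsNoetherianRing R] [IsDomain R] {x : R} (hx : x ∈ maximalIdeal R) (hx0 : x ≠ 0) (n : ℕ) :
    ∀ (M : Type u) [AddCommGroup M] [Module R M] [Module.Finite R M], IsSMulRegular M x →
      HasFreeSyzygy (R ⧸ Ideal.span {x}) n (QuotSMulTop x M) → HasFreeSyzygy R n M := by
  induction n with
  | zero =>
    intro M _ _ _ hreg h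
    have := Module.finitePresentation_of_finite R M
    refine (Module.free_quotSMulTop_iff_free R M ?_ hreg).1 h
    rwa [IsLocalRing.jacobson_eq_maximalIdeal (⊥ : Ideal R) bot_ne_top]
  | succ n ih =>
    intro M _ _ _ hreg h F _ _ _ _ f hf
    have hregF : IsSMulRegular F x :=
      Module.Flat.isSMulRegular_of_nonZeroDivisors (mem_nonZeroDivisors_of_ne_zero hx0)
    obtain ⟨f', hf', ⟨e⟩⟩ := exists_quotSMulTop_ker_equiv hreg hf
    have : Module.Finite (R ⧸ Ideal.span {x}) (QuotSMulTop x F) :=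
      Module.Finite.of_restrictScalars_finite R _ _
    exact ih (LinearMap.ker f) (hregF.submodule _ _) ((h (QuotSMulTop x F) f' hf').of_equiv e)

theorem hasFreeSyzygy_of_isRegularLocalRing (n : ℕ) : ∀ {R : Type u} [CommRing R]
    [IsRegularLocalRing R], ringKrullDim R = n → ∀ (M : Type u) [AddCommGroup M] [Module R M]
    [Module.Finite R M], HasFreeSyzygy R n M := by
  induction n with
  | zero =>
    intro R _ _ h M _ _ _
    let _ : Field R := (isField_iff_maximalIdeal_eq.2
      (maximalIdeal_eq_bot_of_ringKrullDim_eq_zero h)).toField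
    exact Module.Free.of_divisionRing R M
  | succ n ih =>
    -- The first syzygy of `M` is torsion free, so it may be treated modulo `x`.
    intro R _ _ h M _ _ _ F _ _ _ _ f _
    have := isDomain_of_isRegularLocalRing R
    have hne : ringKrullDim R ≠ 0 := by rw [h]; exact_mod_cast n.succ_ne_zero
    obtain ⟨x, hx, -⟩ := exists_mem_maximalIdeal_notMem_sq hne ∅ (by simp) (by simp)
    obtain ⟨hreg, hdim⟩ := isRegularLocalRing_quotient x hx
    have hdim' : ringKrullDim (R ⧸ Ideal.span {(x : R)}) = n :=
      ENat.WithBot.add_one_cancel.1 (hdim.trans (h.trans (by push_cast; rfl)))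
    have hx0 : (x : R) ≠ 0 := fun h0 => hx (h0 ▸ zero_mem _)
    have hregF : IsSMulRegular F (x : R) :=
      Module.Flat.isSMulRegular_of_nonZeroDivisors (mem_nonZeroDivisors_of_ne_zero hx0)
    have : Module.Finite (R ⧸ Ideal.span {(x : R)}) (QuotSMulTop (x : R) (LinearMap.ker f)) :=
      Module.Finite.of_restrictScalars_finite R _ _
    exact HasFreeSyzygy.of_quotSMulTop x.2 hx0 n _ (hregF.submodule _ _) (ih hdim' _)

end Resolution

/-! ### Regular local rings are factorial -/

section Factorial

open IsLocalRing

instance isRegularRing_localization {R : Type u} [CommRing R] [IsRegularRing R] (S : Submonoid R) :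
    IsRegularRing (Localization S) := by
  have : IsNoetherianRing (Localization S) := IsLocalization.isNoetherianRing S _ inferInstance
  refine isRegularRing_iff.2 fun p _ => ?_
  have := IsLocalization.isLocalization_isLocalization_atPrime_isLocalization S
    (Localization.AtPrime p) p
  exact IsRegularLocalRing.of_ringEquiv (IsLocalization.algEquiv
    (p.comap (algebraMap R (Localization S))).primeCompl
    (Localization.AtPrime (p.comap (algebraMap R (Localization S))))
    (Localization.AtPrime p)).toRingEquiv

theorem nonempty_linearEquiv_prod_localizedModule {R : Type*} [CommRing R] (S : Submonoid R)
    {F M : Type*} [AddCommGroup F] [Module R F] [AddCommGroup M] [Module R M] {f : F →ₗ[R] M}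
    (hf : Function.Surjective f) [Module.Projective (Localization S) (LocalizedModule S M)] :
    Nonempty (LocalizedModule S F ≃ₗ[Localization S]
      LocalizedModule S (LinearMap.ker f) × LocalizedModule S M) := by
  let φK := LocalizedModule.mkLinearMap S (LinearMap.ker f)
  let φF := LocalizedModule.mkLinearMap S F
  let φM := LocalizedModule.mkLinearMap S M
  let g' := IsLocalizedModule.mapExtendScalars S φK φF (Localization S) (LinearMap.ker f).subtype
  let f' := IsLocalizedModule.mapExtendScalars S φF φM (Localization S) f
  have hg' : Function.Injective g' :=
    IsLocalizedModule.map_injective S φK φF _ (Submodule.injective_subtype _)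
  have hf' : Function.Surjective f' := IsLocalizedModule.map_surjective S φF φM _ hf
  have hex : Function.Exact g' f' :=
    IsLocalizedModule.map_exact S φK φF φM _ _ (LinearMap.exact_subtype_ker_map f)
  obtain ⟨l, hl⟩ := Module.projective_lifting_property f' LinearMap.id hf'
  exact ⟨(Function.Exact.splitSurjectiveEquiv hex hg' ⟨l, hl⟩).1⟩

theorem isStablyFree_of_linearEquiv_prod {A F K M : Type u} [CommRing A] [AddCommGroup F]
    [Module A F] [Module.Free A F] [Module.Finite A F] [AddCommGroup K] [Module A K]
    [AddCommGroup M] [Module A M] (e : F ≃ₗ[A] K × M) [Module.IsStablyFree A K] :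
    Module.IsStablyFree A M := by
  have : Module.Finite A K := .of_surjective (LinearMap.fst A K M ∘ₗ e.toLinearMap)
    (Prod.fst_surjective.comp e.surjective)
  obtain ⟨N, _, _, _, _, _⟩ := Module.IsStablyFree.exist_free_prod A K
  have : Module.Free A ((K × N) × M) :=
    .of_equiv ((e.prodCongr (LinearEquiv.refl _ N)).trans
      ((LinearEquiv.prodAssoc _ _ _ _).trans
        (((LinearEquiv.refl _ _).prodCongr (LinearEquiv.prodComm _ _ _)).trans
          (LinearEquiv.prodAssoc _ _ _ _).symm)))
  exact Module.IsStablyFree.of_free_prod' _ _ (K × N)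

theorem HasFreeSyzygy.isStablyFree_localizedModule {R : Type u} [CommRing R] [IsNoetherianRing R]
    (S : Submonoid R) (n : ℕ) : ∀ (M : Type u) [AddCommGroup M] [Module R M] [Module.Finite R M],
      HasFreeSyzygy R n M → Module.Projective (Localization S) (LocalizedModule S M) →
        Module.IsStablyFree (Localization S) (LocalizedModule S M) := by
  induction n with
  | zero =>
    intro M _ _ _ h _
    have : Module.Free R M := h
    have := Module.free_of_isLocalizedModule (Rₛ := Localization S) S
      (LocalizedModule.mkLinearMap S M)
    infer_instance
  | succ n ih =>
    intro M _ _ _ h _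
    obtain ⟨m, f, hf⟩ := Module.Finite.exists_fin' R M
    obtain ⟨e⟩ := nonempty_linearEquiv_prod_localizedModule S hf
    have := Module.free_of_isLocalizedModule (Rₛ := Localization S) S
      (LocalizedModule.mkLinearMap S (Fin m → R))
    have := Module.Finite.of_isLocalizedModule (Rₚ := Localization S) S
      (LocalizedModule.mkLinearMap S (Fin m → R))
    have hproj : Module.Projective (Localization S) (LocalizedModule S (LinearMap.ker f)) :=
      .of_split (e.symm.toLinearMap ∘ₗ LinearMap.inl _ _ _)
        (LinearMap.fst _ _ _ ∘ₗ e.toLinearMap) (by ext; simp)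
    have := ih (LinearMap.ker f) (h (Fin m → R) f hf) hproj
    exact isStablyFree_of_linearEquiv_prod (A := Localization S)
      (F := LocalizedModule S (Fin m → R)) (K := LocalizedModule S (LinearMap.ker f)) e

theorem exists_forall_dvd_mul_of_isPrincipal_map {R : Type*} [CommRing R] {S : Submonoid R}
    (hS : S ≤ nonZeroDivisors R) (A : Type*) [CommRing A] [Algebra R A] [IsLocalization S A]
    {J : Ideal R} (hJ : J.FG) (h : (J.map (algebraMap R A)).IsPrincipal) :
    ∃ a ∈ J, ∃ s ∈ S, ∀ b ∈ J, a ∣ s * b := by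
  obtain ⟨π, hπ⟩ := h
  obtain ⟨⟨⟨a, ha⟩, t⟩, hat⟩ := (IsLocalization.mem_map_algebraMap_iff S A).1
    (hπ ▸ Submodule.mem_span_singleton_self π)
  have hdvd (b : J) : algebraMap R A a ∣ algebraMap R A b := by
    have hπb : π ∣ algebraMap R A b :=
      Ideal.mem_span_singleton.1 (hπ.le (Ideal.mem_map_of_mem _ b.2))
    exact hat ▸ (IsLocalization.map_units A t).mul_right_dvd.2 hπb
  choose d hd using hdvd
  obtain ⟨T, hT⟩ := Module.Finite.iff_fg.2 hJ
  obtain ⟨s, hs⟩ := IsLocalization.exist_integer_multiples S T d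
  have hle : ⊤ ≤ Submodule.comap (LinearMap.mulLeft R (s : R) ∘ₗ J.subtype) (Ideal.span {a}) := by
    rw [← hT, Submodule.span_le]
    intro b hb
    obtain ⟨c, hc⟩ := hs b hb
    refine Ideal.mem_span_singleton.2 ⟨c, IsLocalization.injective A hS ?_⟩
    change algebraMap R A (s * b) = _
    rw [map_mul, map_mul, hc, hd, Algebra.smul_def]
    ring
  exact ⟨a, ha, s, s.2, fun b hb => Ideal.mem_span_singleton.1 (@hle ⟨b, hb⟩ trivial)⟩

theorem algebraMap_mem_mul_one_div {A K : Type*} [CommRing A] [Field K] [Algebra A K]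
    [FaithfulSMul A K] {J : Ideal A} {a s : A} (ha : a ∈ J) (ha0 : a ≠ 0)
    (h : ∀ b ∈ J, a ∣ s * b) :
    algebraMap A K s ∈ Submodule.map (Algebra.linearMap A K) J *
      (1 / Submodule.map (Algebra.linearMap A K) J) := by
  have haK : algebraMap A K a ≠ 0 := by rwa [Ne, FaithfulSMul.algebraMap_eq_zero_iff]
  rw [← mul_div_cancel₀ (algebraMap A K s) haK]
  refine Submodule.mul_mem_mul (Submodule.mem_map_of_mem ha)
    (Submodule.mem_div_iff_forall_mul_mem.2 ?_)
  rintro _ ⟨b, hb, rfl⟩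
  obtain ⟨c, hc⟩ := h b hb
  refine Submodule.mem_one.2 ⟨c, ?_⟩
  rw [Algebra.linearMap_apply, div_mul_eq_mul_div, eq_div_iff haK, ← map_mul, ← map_mul, hc,
    mul_comm]

theorem invertible_of_isPrincipal_map_atPrime {A : Type u} [CommRing A] [IsDomain A] {J : Ideal A}
    (hJ : J ≠ ⊥) (hfg : J.FG) (h : ∀ (m : Ideal A) [m.IsMaximal],
      (J.map (algebraMap A (Localization.AtPrime m))).IsPrincipal) :
    Module.Invertible A J := by
  let K := FractionRing A
  let I : Submodule A K := Submodule.map (Algebra.linearMap A K) J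
  have hI : I * (1 / I) = 1 := by
    refine Submodule.mul_one_div_le_one.antisymm (Submodule.one_le.2 ?_)
    by_contra hne
    obtain ⟨m, hm, hle⟩ := Ideal.exists_le_maximal
      (Submodule.comap (Algebra.linearMap A K) (I * (1 / I)))
      ((Ideal.ne_top_iff_one _).2 fun h1 => hne (by simpa using h1))
    obtain ⟨a, ha, s, hs, hdvd⟩ := exists_forall_dvd_mul_of_isPrincipal_map
      m.primeCompl_le_nonZeroDivisors (Localization.AtPrime m) hfg (h m)
    refine hs (hle (algebraMap_mem_mul_one_div ha ?_ hdvd))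
    rintro rfl
    obtain ⟨b, hb, hb0⟩ := Submodule.exists_mem_ne_zero_of_ne_bot hJ
    exact hs ((mul_eq_zero.1 (zero_dvd_iff.1 (hdvd b hb))).resolve_right hb0 ▸ zero_mem m)
  let Iu : (Submodule A K)ˣ := ⟨I, 1 / I, hI, mul_comm I _ ▸ hI⟩
  have : Module.Invertible A (Iu : Submodule A K) := .left (Submodule.tensorInvEquiv Iu)
  exact Module.Invertible.congr (R := A) (M := I)
    (Submodule.equivMapOfInjective _ (IsFractionRing.injective A K) J).symm

theorem isPrincipal_map_of_height_eq_one {R A : Type*} [CommRing R] [CommRing A] [IsDomain A]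
    [UniqueFactorizationMonoid A] [Algebra R A] (S : Submonoid R) [IsLocalization S A]
    {P : Ideal R} [P.IsPrime] (hP : P.height = 1) : (P.map (algebraMap R A)).IsPrincipal := by
  by_cases hdisj : Disjoint (S : Set R) (P : Set R)
  · have := IsLocalization.isPrime_of_isPrime_disjoint S A P inferInstance hdisj
    refine UniqueFactorizationMonoid.isPrincipal_of_height_eq_one ?_
    rw [← IsLocalization.height_under S,
      IsLocalization.under_map_of_isPrime_disjoint S A inferInstance hdisj, hP]
  · rw [not_not.1 (mt (IsLocalization.map_algebraMap_ne_top_iff_disjoint S A P).1 hdisj)]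
    exact top_isPrincipal

theorem isPrincipal_of_linearEquiv {A : Type*} [CommRing A] {J : Ideal A} (e : J ≃ₗ[A] A) :
    J.IsPrincipal := by
  refine ⟨(e.symm 1 : J), le_antisymm (fun b hb => ?_) ((Ideal.span_singleton_le_iff_mem J).2
    (e.symm 1).2)⟩
  refine Submodule.mem_span_singleton.2 ⟨e ⟨b, hb⟩, ?_⟩
  rw [← Submodule.coe_smul, ← map_smul, smul_eq_mul, mul_one, e.symm_apply_apply]

theorem uniqueFactorizationMonoid_localization {R : Type u} [CommRing R] [IsRegularLocalRing R]
    {S : Submonoid R} (hS : S ≤ nonZeroDivisors R)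
    (h : ∀ (m : Ideal (Localization S)) [m.IsMaximal],
      UniqueFactorizationMonoid (Localization.AtPrime m)) :
    UniqueFactorizationMonoid (Localization S) := by
  have := isDomain_of_isRegularLocalRing R
  have : IsDomain (Localization S) := IsLocalization.isDomain_of_le_nonZeroDivisors _ hS
  have : IsNoetherianRing (Localization S) := IsLocalization.isNoetherianRing S _ inferInstance
  refine UniqueFactorizationMonoid.of_forall_isPrincipal_of_height_eq_one fun J _ hJ => ?_
  have hinv : Module.Invertible (Localization S) J :=
    invertible_of_isPrincipal_map_atPrime (J.ne_bot_of_height_eq_one hJ)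
      (IsNoetherian.noetherian J) fun m _ => by
        have := h m
        have : IsDomain (Localization.AtPrime m) :=
          IsLocalization.isDomain_of_le_nonZeroDivisors _ m.primeCompl_le_nonZeroDivisors
        exact isPrincipal_map_of_height_eq_one m.primeCompl hJ
  let P := J.under R
  let e : LocalizedModule S P ≃ₗ[Localization S] J :=
    ((IsLocalizedModule.iso S (Algebra.idealMap (Localization S) P)).extendScalarsOfIsLocalization
      S (Localization S)).trans (LinearEquiv.ofEq _ _ (IsLocalization.map_under S _ J))
  have : Module.Invertible (Localization S) (LocalizedModule S P) := .congr e.symm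
  have := HasFreeSyzygy.isStablyFree_localizedModule S _ P (hasFreeSyzygy_of_isRegularLocalRing _
    (IsRegularLocalRing.spanFinrank_maximalIdeal (R := R)).symm P) inferInstance
  have hfree := Module.free_of_isStablyFree_of_invertible (Localization S) (LocalizedModule S P)
  obtain ⟨e'⟩ := Module.Invertible.free_iff_linearEquiv.1 hfree
  exact isPrincipal_of_linearEquiv (e.symm.trans e')

theorem prime_of_notMem_sq {R : Type u} [CommRing R] [IsRegularLocalRing R] (x : maximalIdeal R)
    (hx : (x : R) ∉ maximalIdeal R ^ 2) : Prime (x : R) := by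
  obtain ⟨_, -⟩ := isRegularLocalRing_quotient x hx
  have := isDomain_of_isRegularLocalRing (R ⧸ Ideal.span {(x : R)})
  exact (Ideal.span_singleton_prime fun h0 : (x : R) = 0 => hx (by rw [h0]; exact zero_mem _)).1
    ((Ideal.Quotient.isDomain_iff_prime _).1 this)

theorem exists_ringKrullDim_atPrime_eq_and_lt {R : Type u} [CommRing R] [IsLocalRing R]
    [IsNoetherianRing R] {n : ℕ} (hn : ringKrullDim R = n) {S : Submonoid R}
    (x : maximalIdeal R) (hx : (x : R) ∈ S) (m : Ideal (Localization S)) [m.IsPrime] :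
    ∃ k < n, ringKrullDim (Localization.AtPrime m) = k := by
  have hxm : (x : R) ∉ m.under R := fun hxm =>
    ‹m.IsPrime›.ne_top (Ideal.eq_top_of_isUnit_mem _ hxm
      (IsLocalization.map_units (Localization S) (⟨x, hx⟩ : S)))
  have hlt : m.under R < maximalIdeal R :=
    lt_of_le_of_ne (le_maximalIdeal Ideal.IsPrime.ne_top') fun h => hxm (h.ge x.2)
  have hheight : m.height < n := by
    rw [← maximalIdeal_height_eq_ringKrullDim] at hn
    rw [← IsLocalization.height_under S, ← show (maximalIdeal R).height = n by exact_mod_cast hn]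
    exact Ideal.height_strict_mono_of_isPrime_of_isPrime hlt
  obtain ⟨k, hk⟩ := ENat.ne_top_iff_exists.1 (ne_top_of_lt hheight)
  refine ⟨k, by rwa [← hk, Nat.cast_lt] at hheight, ?_⟩
  rw [IsLocalization.AtPrime.ringKrullDim_eq_height m, ← hk]
  rfl

theorem uniqueFactorizationMonoid_of_ringKrullDim_eq (n : ℕ) : ∀ {R : Type u} [CommRing R]
    [IsLocalRing R] [IsRegularRing R], ringKrullDim R = n → UniqueFactorizationMonoid R := by
  induction n using Nat.strong_induction_on with
  | _ n ih =>
    intro R _ _ _ hn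
    have := IsRegularLocalRing.of_isRegularRing_of_isLocalRing R
    have := isDomain_of_isRegularLocalRing R
    by_cases hdim : ringKrullDim R = 0
    · let _ := (isField_iff_maximalIdeal_eq.2
        (maximalIdeal_eq_bot_of_ringKrullDim_eq_zero hdim)).toField
      infer_instance
    obtain ⟨x, hx, -⟩ := exists_mem_maximalIdeal_notMem_sq hdim ∅ (by simp) (by simp)
    have hxp := prime_of_notMem_sq x hx
    refine (UniqueFactorizationMonoid.iff_localizationAway_of_prime hxp).2
      (uniqueFactorizationMonoid_localization
        (powers_le_nonZeroDivisors_of_noZeroDivisors hxp.ne_zero) fun m _ => ?_)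
    obtain ⟨k, hk, hkm⟩ := exists_ringKrullDim_atPrime_eq_and_lt hn x
      (Submonoid.mem_powers (x : R)) m
    exact ih k hk hkm

-- The Auslander-Buchsbaum theorem: that localizations of `R` are regular is here part of
-- `IsRegularRing`, which bypasses Serre's homological characterization.
theorem uniqueFactorizationMonoid_of_isRegularRing (R : Type u) [CommRing R] [IsLocalRing R]
    [IsRegularRing R] : UniqueFactorizationMonoid R :=
  have := IsRegularLocalRing.of_isRegularRing_of_isLocalRing R
  uniqueFactorizationMonoid_of_ringKrullDim_eq _
    (IsRegularLocalRing.spanFinrank_maximalIdeal (R := R)).symm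

end Factorial

/-! ### Smooth schemes over regular schemes are regular -/

section Smooth

open IsLocalRing

theorem isRegularRing_of_etale (A B : Type u) [CommRing A] [IsRegularRing A] [CommRing B]
    [Algebra A B] [Algebra.Etale A B] : IsRegularRing B := by
  have : IsNoetherianRing B := Algebra.FiniteType.isNoetherianRing A B
  refine isRegularRing_iff.2 fun q _ => ?_
  let p := q.under A
  let _ := Localization.AtPrime.algebraOfLiesOver p q
  have hmap : (maximalIdeal (Localization.AtPrime p)).map (algebraMap _ (Localization.AtPrime q)) =
      maximalIdeal (Localization.AtPrime q) := by
    rw [← ((Algebra.isUnramifiedAt_iff_map_eq A p q).1 inferInstance).2,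
      ← Localization.AtPrime.map_eq_maximalIdeal, Ideal.map_map, ← IsScalarTower.algebraMap_eq]
  have hheight : p.height ≤ q.height :=
    (Ideal.height_eq_height_add_of_liesOver_of_hasGoingDown p q).ge.trans' le_self_add
  refine .of_spanFinrank_maximalIdeal_le _ ?_
  rw [← hmap]
  refine (Nat.cast_le.2 (Ideal.spanFinrank_map_le_of_fg _
    (IsNoetherian.noetherian (maximalIdeal (Localization.AtPrime p))))).trans ?_
  rw [IsRegularLocalRing.spanFinrank_maximalIdeal,
    IsLocalization.AtPrime.ringKrullDim_eq_height p,
    IsLocalization.AtPrime.ringKrullDim_eq_height q]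
  exact WithBot.coe_le_coe.2 hheight

theorem isRegularRing_of_isStandardSmooth {A B : Type u} [CommRing A] [IsRegularRing A]
    [CommRing B] (f : A →+* B) (hf : f.IsStandardSmooth) : IsRegularRing B := by
  obtain ⟨n, g, -, hg⟩ := hf.exists_etale_mvPolynomial
  let _ := g.toAlgebra
  have : Algebra.Etale (MvPolynomial (Fin n) A) B := hg
  exact isRegularRing_of_etale (MvPolynomial (Fin n) A) B

theorem isRegularRing_of_isAffineOpen {S : Scheme.{u}} [IsRegular S] {U : S.Opens}
    (hU : IsAffineOpen U) : IsRegularRing Γ(S, U) := by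
  have : IsNoetherianRing Γ(S, U) := IsLocallyNoetherian.component_noetherian ⟨U, hU⟩
  refine isRegularRing_iff.2 fun p hp => ?_
  let y : PrimeSpectrum Γ(S, U) := ⟨p, hp⟩
  have hy : hU.fromSpec y ∈ U := (hU.isoSpec.inv y).2
  let _ : Algebra Γ(S, U) (S.presheaf.stalk (hU.fromSpec y)) :=
    S.presheaf.algebra_section_stalk (⟨_, hy⟩ : U)
  have : IsLocalization p.primeCompl (S.presheaf.stalk (hU.fromSpec y)) :=
    hU.isLocalization_stalk' y hy
  have := IsRegular.stalk (hU.fromSpec y)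
  exact IsRegularLocalRing.of_ringEquiv (IsLocalization.algEquiv p.primeCompl
    (S.presheaf.stalk (hU.fromSpec y)) (Localization.AtPrime p)).toRingEquiv

theorem isRegularRing_stalk_of_smooth {X S : Scheme.{u}} [IsRegular S] (f : X ⟶ S) [Smooth f]
    (x : X) : IsRegularRing (X.presheaf.stalk x) := by
  obtain ⟨U, hU, V, hV, hx, e, hf⟩ := Smooth.exists_isStandardSmooth f x
  have := isRegularRing_of_isAffineOpen hU
  have := isRegularRing_of_isStandardSmooth _ hf
  let _ := X.presheaf.algebra_section_stalk (⟨x, hx⟩ : V)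
  have := hV.isLocalization_stalk ⟨x, hx⟩
  exact IsRegularRing.of_ringEquiv (IsLocalization.algEquiv
    (hV.primeIdealOf ⟨x, hx⟩).asIdeal.primeCompl
    (Localization.AtPrime (hV.primeIdealOf ⟨x, hx⟩).asIdeal) (X.presheaf.stalk x)).toRingEquiv

end Smooth

/-! ### Complements of affine open subsets of locally factorial schemes -/

section Complement

theorem isUnit_gcd_pow {R : Type*} [CommRing R] [Nontrivial R] [UniqueFactorizationMonoid R]
    [NormalizedGCDMonoid R] {ι : Type*} {s : Finset ι} {β : ι → R} (h : s.gcd β = 1) (n : ℕ) :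
    IsUnit (s.gcd fun i => β i ^ n) := by
  by_contra hu
  obtain ⟨j, hj, hβj⟩ := Finset.gcd_ne_zero_iff.1 (h ▸ one_ne_zero)
  obtain ⟨π, hπ, hdvd⟩ := WfDvdMonoid.exists_irreducible_factor hu
    (Finset.gcd_ne_zero_iff.2 ⟨j, hj, pow_ne_zero n hβj⟩)
  refine hπ.not_isUnit (isUnit_of_dvd_one (h ▸ Finset.dvd_gcd fun k hk => ?_))
  exact hπ.prime.dvd_of_dvd_pow (hdvd.trans (Finset.gcd_dvd hk))

-- In the fraction field `b i j / a j ^ n` is independent of `j`; calling it `t i`, `h₂` says that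
-- `∑ i, t i * a i = 1`. The greatest common divisor `g` of the `a j` also satisfies
-- `g ^ n * t i ∈ R`.
theorem exists_dvd_pow_mem_span {R : Type*} [CommRing R]
    [UniqueFactorizationMonoid R] {ι : Type*} [Fintype ι] {a : ι → R} {n : ℕ} {b : ι → ι → R}
    (h₁ : ∀ i j k, a j ^ n * b i k = a k ^ n * b i j) (h₂ : ∀ j, ∑ i, a i * b i j = a j ^ n)
    {j : ι} (hj : a j ≠ 0) :
    ∃ g, (∀ i, g ∣ a i) ∧ g ^ n ∈ Ideal.span (Set.range a) := by
  classical
  have : Nontrivial R := ⟨_, _, hj⟩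
  let _ : StrongNormalizationMonoid R := UniqueFactorizationMonoid.strongNormalizationMonoid
  let _ : StrongNormalizedGCDMonoid R := UniqueFactorizationMonoid.toStrongNormalizedGCDMonoid R
  obtain ⟨β, hβ, hgcd⟩ := Finset.univ.extract_gcd a ⟨j, Finset.mem_univ j⟩
  set g := Finset.univ.gcd a
  replace hβ (i) : a i = g * β i := hβ i (Finset.mem_univ i)
  have hg0 : g ≠ 0 := fun h => hj (by rw [hβ, h, zero_mul])
  have hβj : β j ≠ 0 := fun h => hj (by rw [hβ, h, mul_zero])
  have hdvd (i) : β j ^ n ∣ b i j := by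
    have hgcd_mul : β j ^ n ∣ Finset.univ.gcd fun k => β k ^ n * b i j := by
      refine Finset.dvd_gcd fun k _ => ⟨b i k, mul_left_cancel₀ (pow_ne_zero n hg0) ?_⟩
      rw [← mul_assoc, ← mul_assoc, ← mul_pow, ← mul_pow, ← hβ, ← hβ, h₁]
    rw [Finset.gcd_mul_right] at hgcd_mul
    exact dvd_normalize_iff.1 ((isUnit_gcd_pow hgcd n).dvd_mul_left.1 hgcd_mul)
  choose c hc using hdvd
  have hgn : g ^ n = ∑ i, c i * a i := by
    refine mul_right_cancel₀ (pow_ne_zero n hβj) ?_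
    rw [← mul_pow, ← hβ, ← h₂ j, Finset.sum_mul]
    exact Finset.sum_congr rfl fun i _ => by rw [hc i]; ring
  refine ⟨g, fun i => ⟨β i, hβ i⟩, ?_⟩
  rw [hgn]
  exact Ideal.sum_mem _ fun i _ => Ideal.mul_mem_left _ _ (Ideal.subset_span ⟨i, rfl⟩)

theorem exists_forall_map_pow_mul_mem_range {B C ι : Type*} [CommSemiring B] [CommSemiring C]
    [Finite ι] {φ : B →+* C} {a : ι → B} (h : ∀ i c, ∃ n : ℕ, φ (a i) ^ n * c ∈ φ.rangeS)
    (t : ι → C) : ∃ n : ℕ, ∀ i j, φ (a j) ^ n * t i ∈ φ.rangeS := by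
  cases nonempty_fintype ι
  choose n hn using h
  refine ⟨∑ i, ∑ j, n j (t i), fun i j => ?_⟩
  have hle : n j (t i) ≤ ∑ i, ∑ j, n j (t i) :=
    (Finset.single_le_sum_of_canonicallyOrdered (f := fun j => n j (t i))
      (Finset.mem_univ j)).trans
      (Finset.single_le_sum_of_canonicallyOrdered (f := fun i => ∑ j, n j (t i))
        (Finset.mem_univ i))
  rw [← Nat.sub_add_cancel hle, pow_add, mul_assoc, ← map_pow]
  exact mul_mem ⟨_, rfl⟩ (hn j (t i))

-- `φ` stands for the restriction from an affine open `Spec B` to an affine open `Spec C` in it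
-- whose complement is the zero locus of `I`.
theorem isPrincipal_map_of_isRadical {B C R : Type*} [CommRing B] [CommRing C] [CommRing R]
    [UniqueFactorizationMonoid R] [Algebra B R] (M : Submonoid B)
    [IsLocalization M R] {I : Ideal B} (hI : I.IsRadical) (hfg : I.FG) {φ : B →+* C}
    (hφ : Function.Injective φ) (htop : I.map φ = ⊤)
    (hext : ∀ a ∈ I, ∀ c, ∃ n : ℕ, φ a ^ n * c ∈ φ.rangeS) :
    (I.map (algebraMap B R)).IsPrincipal := by
  obtain ⟨m, a, rfl⟩ := Submodule.fg_iff_exists_fin_generating_family.1 hfg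
  change Ideal.map φ (Ideal.span (Set.range a)) = ⊤ at htop
  change (Ideal.span (Set.range a)).IsRadical at hI
  change (Ideal.map _ (Ideal.span (Set.range a))).IsPrincipal
  obtain ⟨t, ht⟩ : ∃ t : Fin m → C, ∑ i, t i * φ (a i) = 1 := by
    rw [Ideal.map_span, ← Set.range_comp] at htop
    exact Ideal.mem_span_range_iff_exists_fun.1 ((Ideal.eq_top_iff_one _).1 htop)
  obtain ⟨n, hn⟩ := exists_forall_map_pow_mul_mem_range
    (fun i c => hext (a i) (Ideal.subset_span ⟨i, rfl⟩) c) t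
  choose b hb using hn
  have h₁ (i j k) : a j ^ n * b i k = a k ^ n * b i j := hφ (by
    rw [map_mul, map_mul, map_pow, map_pow, hb, hb, mul_left_comm])
  have h₂ (j) : ∑ i, a i * b i j = a j ^ n := hφ (by
    simp only [map_sum, map_mul, map_pow, hb, mul_left_comm (φ (a _)), mul_comm (φ (a _)) (t _),
      ← Finset.mul_sum, ht, mul_one])
  by_cases hzero : ∀ j, algebraMap B R (a j) = 0
  · rw [Ideal.map_span, ← Set.range_comp, Ideal.span_eq_bot.2 (by rintro _ ⟨j, rfl⟩; exact hzero j)]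
    exact bot_isPrincipal
  push Not at hzero
  obtain ⟨j, hj⟩ := hzero
  obtain ⟨g, hg, hgn⟩ := exists_dvd_pow_mem_span (a := fun i => algebraMap B R (a i)) (n := n)
    (b := fun i k => algebraMap B R (b i k))
    (fun i j k => by simp only [← map_pow, ← map_mul, h₁ i j k])
    (fun j => by simp only [← map_pow, ← map_mul, ← map_sum, h₂ j]) hj
  have hrad : (Ideal.map (algebraMap B R) (Ideal.span (Set.range a))).IsRadical := by
    rw [Ideal.IsRadical, ← IsLocalization.map_radical M, hI.radical]
  rw [Ideal.map_span, ← Set.range_comp] at hrad ⊢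
  refine ⟨g, le_antisymm (Ideal.span_le.2 ?_)
    ((Ideal.span_singleton_le_iff_mem _).2 (hrad ⟨n, hgn⟩))⟩
  rintro _ ⟨i, rfl⟩
  exact Ideal.mem_span_singleton.2 (hg i)

end Complement

section ComplIdeal

variable {X : Scheme.{u}}

/-- The ideal sheaf of the complement of an open subset, with its reduced structure. -/
def complIdeal (U : X.Opens) : X.IdealSheafData := .vanishingIdeal U.compl

theorem mem_complIdeal_iff {U : X.Opens} {V : X.affineOpens} {f : Γ(X, V)} :
    f ∈ (complIdeal U).ideal V ↔ X.basicOpen f ≤ U := by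
  have h : f ∈ (complIdeal U).ideal V ↔ V.2.fromSpec ⁻¹ᵁ (X.basicOpen f) ≤ V.2.fromSpec ⁻¹ᵁ U := by
    rw [V.2.fromSpec_preimage_basicOpen]
    change f ∈ PrimeSpectrum.vanishingIdeal _ ↔ _
    rw [PrimeSpectrum.mem_vanishingIdeal]
    exact ⟨fun h x hx => not_not.1 fun hxU => hx (h x hxU),
      fun h x hx => not_not.1 fun hxf => hx (h hxf)⟩
  rw [h]
  refine ⟨fun h x hx => ?_, fun h => V.2.fromSpec.preimage_mono h⟩
  obtain ⟨y, rfl⟩ : ∃ y, V.2.fromSpec y = x :=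
    ⟨_, V.2.fromSpec_primeIdealOf ⟨x, X.basicOpen_le f hx⟩⟩
  exact h hx

theorem isRadical_complIdeal (U : X.Opens) (V : X.affineOpens) :
    ((complIdeal U).ideal V).IsRadical := by
  rintro f ⟨n, hn⟩
  rcases Nat.eq_zero_or_pos n with rfl | h
  · exact (Ideal.eq_top_of_isUnit_mem _ hn (by simp)).ge trivial
  · rw [mem_complIdeal_iff, X.basicOpen_pow _ h] at hn
    exact mem_complIdeal_iff.2 hn

theorem map_resFn_complIdeal (U : X.Opens) {V W : X.Opens} (hV : IsAffineOpen V)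
    (hW : IsAffineOpen W) (h : W ≤ V) :
    ((complIdeal U).ideal ⟨V, hV⟩).map (resFn h) = (complIdeal U).ideal ⟨W, hW⟩ :=
  (complIdeal U).map_ideal (U := ⟨W, hW⟩) (V := ⟨V, hV⟩) h

theorem map_resFn_complIdeal_eq_top {U V : X.Opens} (hV : IsAffineOpen V)
    (hUV : IsAffineOpen (U ⊓ V)) :
    ((complIdeal U).ideal ⟨V, hV⟩).map (resFn (inf_le_right : U ⊓ V ≤ V)) = ⊤ := by
  rw [map_resFn_complIdeal U hV hUV, Ideal.eq_top_iff_one, mem_complIdeal_iff]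
  exact (X.basicOpen_le _).trans inf_le_left

theorem inf_eq_basicOpen_of_complIdeal_eq_span {U V : X.Opens} (hV : IsAffineOpen V) {f : Γ(X, V)}
    (h : (complIdeal U).ideal ⟨V, hV⟩ = Ideal.span {f}) : U ⊓ V = X.basicOpen f := by
  refine le_antisymm ?_ (le_inf (mem_complIdeal_iff.1 (h.ge (Ideal.mem_span_singleton_self f)))
    (X.basicOpen_le f))
  rintro x ⟨hxU, hxV⟩
  obtain ⟨t, ht, hxt⟩ := hV.exists_basicOpen_le ⟨x, hxU⟩ hxV
  obtain ⟨c, rfl⟩ := Ideal.mem_span_singleton.1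
    (h.le ((mem_complIdeal_iff (V := ⟨V, hV⟩)).2 ht))
  rw [X.basicOpen_mul] at hxt
  exact hxt.1

theorem complIdeal_ne_bot {U V : X.Opens} (hV : IsAffineOpen V) {x : X} (hxU : x ∈ U)
    (hxV : x ∈ V) : (complIdeal U).ideal ⟨V, hV⟩ ≠ ⊥ := by
  intro h
  obtain ⟨f, hf, hxf⟩ := hV.exists_basicOpen_le ⟨x, hxU⟩ hxV
  have hf0 : f = 0 := h.le ((mem_complIdeal_iff (V := ⟨V, hV⟩)).2 hf)
  rw [hf0, Scheme.basicOpen_zero] at hxf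
  exact hxf

theorem germ_injective_of_isDomain {V : X.Opens} (hV : IsAffineOpen V) [IsDomain Γ(X, V)] {x : X}
    (hx : x ∈ V) : Function.Injective (X.presheaf.germ V x hx) := by
  let _ := X.presheaf.algebra_section_stalk (⟨x, hx⟩ : V)
  have := hV.isLocalization_stalk ⟨x, hx⟩
  exact IsLocalization.injective (X.presheaf.stalk x)
    (hV.primeIdealOf ⟨x, hx⟩).asIdeal.primeCompl_le_nonZeroDivisors

theorem isDomain_stalk {V : X.Opens} (hV : IsAffineOpen V) [IsDomain Γ(X, V)] {x : X}
    (hx : x ∈ V) : IsDomain (X.presheaf.stalk x) := by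
  let _ := X.presheaf.algebra_section_stalk (⟨x, hx⟩ : V)
  have := hV.isLocalization_stalk ⟨x, hx⟩
  exact IsLocalization.isDomain_of_le_nonZeroDivisors _
    (hV.primeIdealOf ⟨x, hx⟩).asIdeal.primeCompl_le_nonZeroDivisors

theorem germ_resFn {V W : X.Opens} (h : W ≤ V) {x : X} (hx : x ∈ W) (f : Γ(X, V)) :
    X.presheaf.germ W x hx (resFn h f) = X.presheaf.germ V x (h hx) f :=
  TopCat.Presheaf.germ_res_apply _ _ _ _ _

theorem resFn_injective_of_isDomain {V W : X.Opens} (hV : IsAffineOpen V) [IsDomain Γ(X, V)]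
    (h : W ≤ V) {x : X} (hx : x ∈ W) : Function.Injective (resFn h) :=
  .of_comp (f := X.presheaf.germ W x hx) (by
    convert germ_injective_of_isDomain hV (h hx) using 1
    exact funext (germ_resFn h hx))

theorem eq_zero_of_resFn_mul_eq_zero {V : X.Opens} (hV : IsAffineOpen V) [IsDomain Γ(X, V)]
    {f : Γ(X, V)} (hf : f ≠ 0) {W : X.Opens} (h : W ≤ V) {t : Γ(X, W)}
    (ht : resFn h f * t = 0) : t = 0 := by
  refine TopCat.Presheaf.section_ext X.sheaf W t 0 fun x hx => ?_
  have := isDomain_stalk hV (h hx)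
  have hmul := congrArg (X.presheaf.germ W x hx) ht
  rw [map_mul, map_zero, germ_resFn] at hmul
  exact ((mul_eq_zero.1 hmul).resolve_left
    ((map_ne_zero_iff _ (germ_injective_of_isDomain hV (h hx))).2 hf)).trans (map_zero _).symm

theorem exists_isAffineOpen_isDomain [IsLocallyNoetherian X] (x : X)
    [IsDomain (X.presheaf.stalk x)] :
    ∃ V : X.Opens, IsAffineOpen V ∧ x ∈ V ∧ IsDomain Γ(X, V) := by
  obtain ⟨V, hx, hV, hinj⟩ := X.exists_germ_injective x
  exact ⟨V, hV, hx, hinj.isDomain (X.presheaf.germ V x hx).hom⟩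

theorem exists_pow_mul_mem_range_resFn {V W : X.Opens} (hV : IsAffineOpen V)
    (hW : IsAffineOpen W) (h : W ≤ V) {a : Γ(X, V)} (ha : X.basicOpen a ≤ W) (t : Γ(X, W)) :
    ∃ n : ℕ, resFn h a ^ n * t ∈ (resFn h).rangeS := by
  have hle : X.basicOpen (resFn h a) ≤ X.basicOpen a := (X.basicOpen_res a _).trans_le inf_le_right
  obtain ⟨k, y, hy⟩ := exists_eq_pow_mul_of_isAffineOpen X V hV a (resFn ha t)
  have hy' : resFn ha (resFn h y) = resFn ha (resFn h a ^ k * t) := by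
    rw [map_mul, map_pow, resFn_resFn, resFn_resFn]
    exact hy
  obtain ⟨l, hl⟩ : ∃ l, resFn h a ^ l * resFn h y = resFn h a ^ l * (resFn h a ^ k * t) := by
    refine exists_of_res_eq_of_qcqs hW.isCompact hW.isQuasiSeparated ?_
    have h₂ (z : Γ(X, W)) : resFn hle (resFn ha z) = resFn (X.basicOpen_le _) z :=
      resFn_resFn _ _ z
    exact (h₂ _).symm.trans ((congrArg (resFn hle) hy').trans (h₂ _))
  exact ⟨l + k, a ^ l * y, by rw [map_mul, map_pow, hl, pow_add, mul_assoc]⟩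

theorem isPrincipal_map_stalk_complIdeal [IsLocallyNoetherian X] [X.IsSeparated] {U V : X.Opens}
    (hU : IsAffineOpen U) (hdense : Dense (U : Set X)) (hV : IsAffineOpen V) [IsDomain Γ(X, V)]
    {x : X} (hx : x ∈ V) [UniqueFactorizationMonoid (X.presheaf.stalk x)] :
    (((complIdeal U).ideal ⟨V, hV⟩).map (X.presheaf.germ V x hx).hom).IsPrincipal := by
  have : IsNoetherianRing Γ(X, V) := IsLocallyNoetherian.component_noetherian ⟨V, hV⟩
  obtain ⟨y, hyV, hyU⟩ := hdense.inter_open_nonempty V V.isOpen ⟨x, hx⟩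
  have hUV : IsAffineOpen (U ⊓ V) := hU.inf hV
  let _ := X.presheaf.algebra_section_stalk (⟨x, hx⟩ : V)
  have := hV.isLocalization_stalk ⟨x, hx⟩
  exact isPrincipal_map_of_isRadical (hV.primeIdealOf ⟨x, hx⟩).asIdeal.primeCompl
    (isRadical_complIdeal U ⟨V, hV⟩) (IsNoetherian.noetherian _)
    (resFn_injective_of_isDomain hV (inf_le_right : U ⊓ V ≤ V) ⟨hyU, hyV⟩)
    (map_resFn_complIdeal_eq_top hV hUV) fun a ha =>
      exists_pow_mul_mem_range_resFn hV hUV inf_le_right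
        (le_inf (mem_complIdeal_iff.1 ha) (X.basicOpen_le a))

theorem complIdeal_basicOpen_eq_span {U V : X.Opens} (hV : IsAffineOpen V) {f s : Γ(X, V)}
    (hf : f ∈ (complIdeal U).ideal ⟨V, hV⟩)
    (hs : ∀ c ∈ (complIdeal U).ideal ⟨V, hV⟩, f ∣ s * c) :
    (complIdeal U).ideal ⟨X.basicOpen s, hV.basicOpen s⟩ =
      Ideal.span {resFn (X.basicOpen_le s) f} := by
  rw [← map_resFn_complIdeal U hV (hV.basicOpen s) (X.basicOpen_le s)]
  refine le_antisymm (Ideal.map_le_iff_le_comap.2 fun c hc => ?_)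
    ((Ideal.span_singleton_le_iff_mem _).2 (Ideal.mem_map_of_mem _ hf))
  have hunit : IsUnit (resFn (X.basicOpen_le s) s) := RingedSpace.isUnit_res_basicOpen _ s
  have hdvd := map_dvd (resFn (X.basicOpen_le s)) (hs c hc)
  rw [map_mul] at hdvd
  exact Ideal.mem_span_singleton.2 (hunit.dvd_mul_left.1 hdvd)

theorem exists_complIdeal_eq_span [IsLocallyNoetherian X] [X.IsSeparated] {U : X.Opens}
    (hU : IsAffineOpen U) (hdense : Dense (U : Set X)) (x : X)
    [UniqueFactorizationMonoid (X.presheaf.stalk x)] :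
    ∃ (V : X.Opens) (hV : IsAffineOpen V), x ∈ V ∧ IsDomain Γ(X, V) ∧
      ∃ f : Γ(X, V), f ≠ 0 ∧ (complIdeal U).ideal ⟨V, hV⟩ = Ideal.span {f} := by
  have : IsDomain (X.presheaf.stalk x) := {}
  obtain ⟨V, hV, hx, _⟩ := exists_isAffineOpen_isDomain x
  have : IsNoetherianRing Γ(X, V) := IsLocallyNoetherian.component_noetherian ⟨V, hV⟩
  let _ := X.presheaf.algebra_section_stalk (⟨x, hx⟩ : V)
  have := hV.isLocalization_stalk ⟨x, hx⟩
  obtain ⟨f, hf, s, hs, hfs⟩ := exists_forall_dvd_mul_of_isPrincipal_map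
    (hV.primeIdealOf ⟨x, hx⟩).asIdeal.primeCompl_le_nonZeroDivisors (X.presheaf.stalk x)
    (IsNoetherian.noetherian _) (isPrincipal_map_stalk_complIdeal hU hdense hV hx)
  have hs0 : s ≠ 0 := fun h => hs (h ▸ zero_mem _)
  have hxs : x ∈ X.basicOpen s := (X.mem_basicOpen s x hx).2 (IsLocalization.map_units
    (X.presheaf.stalk x) (⟨s, hs⟩ : (hV.primeIdealOf ⟨x, hx⟩).asIdeal.primeCompl))
  have : IsLocalization.Away s Γ(X, X.basicOpen s) := hV.isLocalization_basicOpen s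
  have hdom : IsDomain Γ(X, X.basicOpen s) := IsLocalization.isDomain_of_le_nonZeroDivisors _
    (powers_le_nonZeroDivisors_of_noZeroDivisors hs0)
  have hspan := complIdeal_basicOpen_eq_span hV hf hfs
  refine ⟨X.basicOpen s, hV.basicOpen s, hxs, hdom, resFn _ f, fun h0 => ?_, hspan⟩
  obtain ⟨y, hy, hyU⟩ := hdense.inter_open_nonempty _ (X.basicOpen s).isOpen ⟨x, hxs⟩
  refine complIdeal_ne_bot (hV.basicOpen s) hyU hy ?_
  rw [hspan, h0, Ideal.span_singleton_eq_bot]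

end ComplIdeal

/-! ### Locally factorial and smooth schemes -/

/-- A scheme is locally factorial if its local rings are unique factorization domains. -/
class IsLocallyFactorial (X : Scheme.{u}) : Prop where
  stalk : ∀ x : X, UniqueFactorizationMonoid (X.presheaf.stalk x)

section LocallyFactorial

variable {X : Scheme.{u}}

-- An affine open subset disjoint from a maximal affine open subset would enlarge it.
theorem exists_isAffineOpen_dense [IsNoetherian X] (x : X) :
    ∃ U : X.Opens, IsAffineOpen U ∧ x ∈ U ∧ Dense (U : Set X) := by
  have hwf : WellFoundedGT X.Opens :=
    (inferInstance : TopologicalSpace.NoetherianSpace X)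
  obtain ⟨_, ⟨U₀, hU₀, rfl⟩, hx, -⟩ :=
    X.isBasis_affineOpens.exists_subset_of_mem_open (Set.mem_univ x) isOpen_univ
  obtain ⟨U, ⟨hU, hxU⟩, hmax⟩ := hwf.wf.has_min {U : X.Opens | IsAffineOpen U ∧ x ∈ U}
    ⟨U₀, hU₀, hx⟩
  refine ⟨U, hU, hxU, dense_iff_inter_open.2 fun V hV ⟨y, hy⟩ => ?_⟩
  by_contra hVU
  obtain ⟨_, ⟨W, hW, rfl⟩, hyW, hWV⟩ := X.isBasis_affineOpens.exists_subset_of_mem_open hy hV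
  have hdisj : Disjoint U W :=
    disjoint_iff_inf_le.2 fun z ⟨hzU, hzW⟩ => (hVU ⟨z, hWV hzW, hzU⟩).elim
  refine hmax (U ⊔ W) ⟨hU.sup_of_disjoint hW hdisj, Or.inl hxU⟩ (left_lt_sup.2 fun hWU => ?_)
  exact (disjoint_iff.1 hdisj).le ⟨hWU hyW, hyW⟩

theorem exists_isAffineOpen_le {ι : Type*} [Finite ι] {x : X} {V : ι → X.Opens}
    (hx : ∀ i, x ∈ V i) : ∃ U : X.Opens, x ∈ U ∧ IsAffineOpen U ∧ ∀ i, U ≤ V i := by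
  obtain ⟨_, ⟨U, hU, rfl⟩, hxU, hUV⟩ := X.isBasis_affineOpens.exists_subset_of_mem_open
    (Set.mem_iInter.2 hx) (isOpen_iInter_of_finite fun i => (V i).isOpen)
  exact ⟨U, hxU, hU, fun i y hy => Set.mem_iInter.1 (hUV hy) i⟩

theorem nonempty_ampleCocycle_of_dvd {A I : Type u} {U : A → X.Opens}
    (hU : ∀ a, IsAffineOpen (U a)) (hU_top : ⨆ a, U a = ⊤) {D : I → X.Opens}
    (hD : ∀ i, IsAffineOpen (D i)) (hD_top : ⨆ i, D i = ⊤) {s : ∀ (_ : I) (a : A), Γ(X, U a)}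
    (hreg : ∀ i a {W : X.Opens} (h : W ≤ U a) {t : Γ(X, W)}, resFn h (s i a) * t = 0 → t = 0)
    (hdvd : ∀ i a b, resFn (inf_le_right : U a ⊓ U b ≤ U b) (s i b) ∣ resFn inf_le_left (s i a))
    (hDU : ∀ i a, D i ⊓ U a = X.basicOpen (s i a)) : Nonempty (AmpleCocycle X A I) := by
  have hcancel (i a) {W : X.Opens} (h : W ≤ U a) {t t' : Γ(X, W)}
      (ht : t * resFn h (s i a) = t' * resFn h (s i a)) : t = t' :=
    sub_eq_zero.1 (hreg i a h (by rw [mul_comm, sub_mul, ht, sub_self]))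
  choose g hg using fun i a b => exists_eq_mul_left_of_dvd (hdvd i a b)
  refine ⟨{
    U := U
    isAffineOpen_U := hU
    iSup_U := hU_top
    s := s
    g := g
    g_self i a := hcancel i a inf_le_left (by rw [← hg, one_mul])
    g_mul i a b c := ?_
    s_eq := hg
    D := D
    isAffineOpen_D := hD
    iSup_D := hD_top
    D_inf := hDU }⟩
  refine hcancel i c inf_le_right ?_
  have hab := congrArg (resFn (inf_le_left : U a ⊓ U b ⊓ U c ≤ U a ⊓ U b)) (hg i a b)
  have hbc := congrArg (resFn (le_inf (inf_le_left.trans inf_le_right) inf_le_right :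
    U a ⊓ U b ⊓ U c ≤ U b ⊓ U c)) (hg i b c)
  have hac := congrArg (resFn (le_inf (inf_le_left.trans inf_le_left) inf_le_right :
    U a ⊓ U b ⊓ U c ≤ U a ⊓ U c)) (hg i a c)
  simp only [map_mul, resFn_resFn] at hab hbc hac
  rw [mul_assoc, ← hbc, ← hab, hac]

-- The complement of a dense affine open subset is an effective Cartier divisor, and the canonical
-- sections of the associated line bundles are the required ones.
theorem exists_ampleCocycle_of_isLocallyFactorial (X : Scheme.{u}) [IsNoetherian X]
    [X.IsSeparated] [IsLocallyFactorial X] :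
    ∃ (A I : Type u) (_ : Finite A) (_ : Finite I), Nonempty (AmpleCocycle X A I) := by
  choose D hD hxD hdense using exists_isAffineOpen_dense (X := X)
  obtain ⟨I, hI⟩ := exists_finset_iSup_eq_top hxD
  choose V hV hxV hVdom f hf0 hf using fun (i : I) (x : X) =>
    have := IsLocallyFactorial.stalk x
    exists_complIdeal_eq_span (hD i) (hdense i) x
  choose U hxU hU hUV using fun x => exists_isAffineOpen_le fun i => hxV i x
  obtain ⟨A, hA⟩ := exists_finset_iSup_eq_top hxU
  have hspan (i : I) (x : X) {W : X.Opens} (hW : IsAffineOpen W) (h : W ≤ V i x) :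
      (complIdeal (D i)).ideal ⟨W, hW⟩ = Ideal.span {resFn h (f i x)} := by
    rw [← map_resFn_complIdeal (D i) (hV i x) hW h, hf, Ideal.map_span, Set.image_singleton]
  refine ⟨A, I, inferInstance, inferInstance, nonempty_ampleCocycle_of_dvd
    (fun a : A => hU a) hA (fun i : I => hD i) hI (s := fun i a => resFn (hUV a i) (f i a))
    (fun i a W h t ht => ?_) (fun i a b => ?_) fun i a =>
      inf_eq_basicOpen_of_complIdeal_eq_span (hU a) (hspan i a (hU a) (hUV a i))⟩
  · have := hVdom i a
    rw [resFn_resFn] at ht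
    exact eq_zero_of_resFn_mul_eq_zero (hV i a) (hf0 i a) _ ht
  · have hab : IsAffineOpen (U a ⊓ U b) := (hU a).inf (hU b)
    rw [resFn_resFn, resFn_resFn, ← Ideal.span_singleton_le_span_singleton, ← hspan i a hab,
      ← hspan i b hab]

theorem isLocallyFactorial_of_smooth {S : Scheme.{u}} [IsRegular S] (p : X ⟶ S) [Smooth p] :
    IsLocallyFactorial X where
  stalk x :=
    have := isRegularRing_stalk_of_smooth p x
    uniqueFactorizationMonoid_of_isRegularRing _

theorem isNoetherian_of_locallyOfFiniteType {S : Scheme.{u}} [IsNoetherian S] (p : X ⟶ S)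
    [LocallyOfFiniteType p] [QuasiCompact p] : IsNoetherian X :=
  have := LocallyOfFiniteType.isLocallyNoetherian p
  have := QuasiCompact.compactSpace_of_compactSpace p
  {}

theorem isSeparated_of_hom {S : Scheme.{u}} [S.IsSeparated] (p : X ⟶ S) [IsSeparated p] :
    X.IsSeparated := by
  constructor
  rw [← terminal.comp_from p]
  infer_instance

end LocallyFactorial

end

end EquivariantJouanolou

theorem mainTheorem6_general (G : Type v) [Group G] [Finite G] (X : Action Scheme.{u} G) :
    (EquivariantJouanolou.HasAmpleFamily X.V →
      ∃ (W : Action Scheme.{u} G) (π : W ⟶ X),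
        EquivariantJouanolou.IsNAffineBundle π ∧ IsAffine W.V) ∧
    (∀ [IsNoetherian X.V] [X.V.IsSeparated] [EquivariantJouanolou.IsLocallyFactorial X.V],
      ∃ (W : Action Scheme.{u} G) (π : W ⟶ X),
        EquivariantJouanolou.IsNAffineBundle π ∧ IsAffine W.V) := by
  constructor
  · intro hX
    obtain ⟨A, I, _, _, ⟨d⟩⟩ := hX.exists_ampleCocycle
    exact EquivariantJouanolou.exists_isNAffineBundle_of_ampleCocycle X d
  · intro _ _ _
    obtain ⟨A, I, _, _, ⟨d⟩⟩ := EquivariantJouanolou.exists_ampleCocycle_of_isLocallyFactorial X.V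
    exact EquivariantJouanolou.exists_isNAffineBundle_of_ampleCocycle X d

theorem mainTheorem6 (G : Type v) [Group G] [Finite G] :
    (∀ X : Action Scheme.{u} G,
      EquivariantJouanolou.HasAmpleFamily X.V →
      IsUnit (Nat.card G : Γ(X.V, ⊤)) →
      ∃ (W : Action Scheme.{u} G) (π : W ⟶ X),
        EquivariantJouanolou.IsNAffineBundle π ∧ IsAffine W.V) ∧
    (∀ (S : Scheme.{u}) [IsNoetherian S] [S.IsSeparated] [EquivariantJouanolou.IsRegular S],
      IsUnit (Nat.card G : Γ(S, ⊤)) →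
      ∀ (X : Action Scheme.{u} G) (p : X ⟶ Action.trivial G S)
        [IsSeparated p.hom] [LocallyOfFiniteType p.hom] [QuasiCompact p.hom] [Smooth p.hom],
      ∃ (W : Action Scheme.{u} G) (π : W ⟶ X),
        EquivariantJouanolou.IsNAffineBundle π ∧ IsAffine W.V) := by
  refine ⟨fun X hX _ => (mainTheorem6_general G X).1 hX,
    fun S _ _ _ _ X p hsep hft hqc hsm => ?_⟩
  let q : X.V ⟶ S := p.hom
  have : IsSeparated q := hsep
  have : LocallyOfFiniteType q := hft
  have : QuasiCompact q := hqc
  have : Smooth q := hsm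
  have := EquivariantJouanolou.isNoetherian_of_locallyOfFiniteType q
  have := EquivariantJouanolou.isSeparated_of_hom q
  have := EquivariantJouanolou.isLocallyFactorial_of_smooth q
  exact (mainTheorem6_general G X).2
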